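/- **Setting.** Let $(K,E_0)$ be a finite connected simple graph, let $N$ discrete half-lines $L_\alpha=\{1,2,\dots\}$, $\alpha=1,\dots,N$, be attached to it at vertices $x_\alpha\in K$ (not necessarily distinct), and let $G=K\cup L_1\cup\dots\cup L_N$ be the resulting vertex set. For $u\colon G\to\mathbb C$ let $H_0=h_0\oplus h_1\oplus\dots\oplus h_N$, where $$(h_0u)[x]=\sum_{y\in K,\ \{x,y\}\in E_0}(u[x]-u[y])+\#\{\alpha: x_\alpha=x\}\,u[x]\quad (x\in K),$$ $$(h_\alpha u)[n]=2u[n]-u[n+1]-u[n-1]\quad (n\in L_\alpha,\ u[0]:=0\text{ on } L_\alpha).$$ Let $w(x)=1$ for $x\in K$ and $w(n)=(1+n^2)^{1/2}$ for $n\in L_\alpha$. For $s\in\mathbb R$ put $\mathcal L^s=\{u:\sum_x w(x)^s|u[x]|<\infty\}$, $(\mathcal L^s)^*=\{u:\sup_x w(x)^{-s}|u[x]|<\infty\}$ with their natural norms, $\mathcal B^s=\mathcal B(\mathcal L^s,(\mathcal L^s)^*)$ (bounded operators, with the operator norm), $\mathcal H=\ell^2(G)$, and $\langle\Psi,u\rangle=\sum_x\overline{\Psi[x]}\,u[x]$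 whenever the sum converges absolutely. Let $\beta\ge 3$ be an integer, and let $V\in\mathcal B(\mathcal H)$ be self-adjoint with $V=vUv^*$, where $v\in\mathcal B(\mathcal K,\mathcal L^\beta)$ is injective, $U\in\mathcal B(\mathcal K)$ is self-adjoint and unitary, $\mathcal K$ is a complex Hilbert space, and $v^*\colon(\mathcal L^\beta)^*\to\mathcal K$ is the adjoint of $v$; thus $V$ also acts from $(\mathcal L^\beta)^*$ to $\mathcal L^\beta$. Let $H=H_0+V$ and $R(\kappa)=(H+\kappa^2)^{-1}\in\mathcal B(\mathcal H)$ for $-\kappa^2\notin\sigma(H)$. Let $\mathbf 1^{(\alpha)}$ be the indicator function of $L_\alpha$, $\mathbb C\mathbf 1$ the span of $\mathbf 1^{(1)},\dots,\mathbf 1^{(N)}$, and $$\widetilde{\mathcal E}=\{\Psi\in(\mathcal L^\beta)^*: H\Psi=0\},\qquad \mathcal E=\widetilde{\mathcal E}\cap(\mathbb C\mathbf 1\oplus\mathcal L^{\beta-2}),\qquad \mathsf E=\widetilde{\mathcal E}\cap\mathcal L^{\beta-2}.$$ The threshold $0$ is an exceptional point of the first kind if $\mathcal E\supsetneq\mathsf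 E=\{0\}$. An orthonormal resonance basis is a finite family $(\Psi_\gamma)$ in $\mathcal E$ whose classes form a basis of $\mathcal E/\mathsf E$, such that $\overline\Phi\,\Psi_\gamma\in\mathcal L^0$ and $\langle\Phi,\Psi_\gamma\rangle=0$ for all $\Phi\in\mathsf E$ and all $\gamma$, and such that there is an orthonormal system $(c^{(\gamma)})$ in $\mathbb C^N$ with $\Psi_\gamma-\sum_\alpha c^{(\gamma)}_\alpha\mathbf 1^{(\alpha)}\in\mathcal L^{\beta-2}$ for all $\gamma$. The orthogonal resonance projection is $\mathcal P=\sum_\gamma|\Psi_\gamma\rangle\langle\Psi_\gamma|$. An orthonormal bound basis is a finite basis $(\Psi_\gamma)$ of $\mathsf E$ with $\overline{\Psi_{\gamma'}}\Psi_\gamma\in\mathcal L^0$ and $\langle\Psi_{\gamma'},\Psi_\gamma\rangle=\delta_{\gamma\gamma'}$; the orthogonal bound projection is $\mathsf P=\sum_\gamma|\Psi_\gamma\rangle\langle\Psi_\gamma|$. **Theorem 3.6.** In this setting, assume that the threshold $0$ is an exceptional point of the first kind. Then $-\kappa^2\notin\sigma(H)$ for all $\kappa$ with $\operatorname{Re}\kappa>0$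 and $|\kappa|$ sufficiently small, and there are operators $G_j\in\mathcal B^{\beta-1}$ such that, as $\kappa\to0$ with $\operatorname{Re}\kappa>0$, $$R(\kappa)=\sum_{j=-1}^{\beta-4}\kappa^jG_j+\mathcal O(\kappa^{\beta-3})\quad\text{in }\mathcal B^{\beta-1},$$ where, for $-1\le j\le\beta-4$, $G_j\in\mathcal B^{j+3}$ if $j$ is even and $G_j\in\mathcal B^{j+2}$ if $j$ is odd. Moreover $G_{-2}=\mathsf P=0$ (there is no $\kappa^{-2}$ term), orthonormal resonance bases exist, and $G_{-1}=\mathcal P\ne0$ for every choice of orthonormal resonance basis. -/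

import Mathlib

open Filter Topology Asymptotics
open scoped ENNReal ComplexConjugate

namespace RayGraph

noncomputable section

/-- The vertices of the graph obtained from the finite graph on `K` by attaching `N` discrete
half-lines.  The half-line number `α` is `{1, 2, 3, …}`; its vertex `n + 1` is `.inr (α, n)`,
where `n : ℕ`. -/
abbrev Vtx (K : Type*) (N : ℕ) : Type _ := K ⊕ (Fin N × ℕ)

variable {K : Type*} {N : ℕ}

/-! ### Weighted sequence spaces -/

/-- The weight: `1` on `K`, and `(1 + m²)^(s/2)` at the vertex `m = n + 1` of a half-line. -/
def wt (s : ℝ) : Vtx K N → ℝ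
  | .inl _ => 1
  | .inr (_, n) => (1 + ((n : ℝ) + 1) ^ 2) ^ (s / 2)

lemma wt_pos (s : ℝ) (x : Vtx K N) : 0 < wt s x := by
  rcases x with x | ⟨α, n⟩
  · simp [wt]
  · simp only [wt]; positivity

lemma wt_neg_mul (s : ℝ) (x : Vtx K N) : wt (-s) x * wt s x = 1 := by
  rcases x with x | ⟨α, n⟩
  · simp [wt]
  · simp only [wt]
    rw [← Real.rpow_add (by positivity)]
    simp [neg_div]

lemma one_le_wt {s : ℝ} (hs : 0 ≤ s) (x : Vtx K N) : 1 ≤ wt s x := by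
  rcases x with x | ⟨α, n⟩
  · simp [wt]
  · simp only [wt]
    exact Real.one_le_rpow (by nlinarith [sq_nonneg ((n : ℝ) + 1)]) (by positivity)

lemma wt_neg_le_one {s : ℝ} (hs : 0 ≤ s) (x : Vtx K N) : wt (-s) x ≤ 1 := by
  have h := wt_neg_mul s x
  nlinarith [one_le_wt hs x, wt_pos (-s) x]

/-- The weighted space `ℓ^{p,s}(G)`, as a space of functions on the vertices. -/
def wlp (K : Type*) (N : ℕ) (p : ℝ≥0∞) (s : ℝ) : Submodule ℂ (Vtx K N → ℂ) where
  carrier := {u | Memℓp (fun x => (wt s x : ℂ) * u x) p}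
  zero_mem' := by
    have : (fun x : Vtx K N => (wt s x : ℂ) * (0 : Vtx K N → ℂ) x) = 0 := by ext; simp
    simp only [Set.mem_ofPred_eq, this]
    exact zero_memℓp
  add_mem' := by
    intro a b ha hb
    have := Memℓp.add ha hb
    simp only [Set.mem_ofPred_eq]
    convert this using 1
    ext x
    simp [mul_add]
  smul_mem' := by
    intro c a ha
    have := Memℓp.const_smul ha c
    simp only [Set.mem_ofPred_eq]
    convert this using 1
    ext x
    simp [mul_left_comm]

/-- `ℓ^{p,s}(G)` as a normed space, with norm `‖u‖ = ‖(w_s(x) u(x))_x‖_{ℓ^p}`. -/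
def WL (K : Type*) (N : ℕ) (p : ℝ≥0∞) (s : ℝ) : Type _ := ↥(wlp K N p s)

namespace WL

variable {p : ℝ≥0∞} {s : ℝ}

instance : AddCommGroup (WL K N p s) := inferInstanceAs (AddCommGroup ↥(wlp K N p s))

instance : Module ℂ (WL K N p s) := inferInstanceAs (Module ℂ ↥(wlp K N p s))

/-- The underlying function on the vertices. -/
def toFun : WL K N p s →ₗ[ℂ] (Vtx K N → ℂ) := (wlp K N p s).subtype

instance : CoeFun (WL K N p s) (fun _ => Vtx K N → ℂ) := ⟨fun u => toFun u⟩

lemma memlp (u : WL K N p s) : Memℓp (fun x => (wt s x : ℂ) * u x) p := u.2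

@[simp] lemma add_apply (u v : WL K N p s) (x : Vtx K N) : (u + v) x = u x + v x := rfl

@[simp] lemma smul_apply (c : ℂ) (u : WL K N p s) (x : Vtx K N) : (c • u) x = c * u x := rfl

/-- Multiplication by the weight, `ℓ^{p,s}(G) → ℓ^p(G)`. -/
def toLp : WL K N p s →ₗ[ℂ] lp (fun _ : Vtx K N => ℂ) p where
  toFun u := ⟨fun x => (wt s x : ℂ) * u x, u.memlp⟩
  map_add' u v := by
    apply lp.ext
    funext x
    exact mul_add _ _ _
  map_smul' c u := by
    apply lp.ext
    funext x
    exact mul_left_comm _ _ _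

lemma toLp_apply (u : WL K N p s) (x : Vtx K N) : toLp u x = (wt s x : ℂ) * u x := rfl

lemma toLp_injective : Function.Injective (toLp : WL K N p s → lp (fun _ : Vtx K N => ℂ) p) := by
  intro u v h
  apply Subtype.ext
  funext x
  have hx : (wt s x : ℂ) * u x = (wt s x : ℂ) * v x := by
    rw [← toLp_apply, ← toLp_apply, h]
  exact mul_left_cancel₀ (by exact_mod_cast (wt_pos s x).ne') hx

instance [Fact (1 ≤ p)] : NormedAddCommGroup (WL K N p s) :=
  NormedAddCommGroup.induced (WL K N p s) (lp (fun _ : Vtx K N => ℂ) p) toLp toLp_injective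

instance [Fact (1 ≤ p)] : NormedSpace ℂ (WL K N p s) :=
  NormedSpace.induced ℂ (WL K N p s) (lp (fun _ : Vtx K N => ℂ) p) toLp

lemma norm_def [Fact (1 ≤ p)] (u : WL K N p s) : ‖u‖ = ‖toLp u‖ := rfl

end WL

/-- `𝓛^s = ℓ^{1,s}(G)`. -/
abbrev Ls (K : Type*) (N : ℕ) (s : ℝ) : Type _ := WL K N 1 s

/-- `(𝓛^s)^* = ℓ^{∞,-s}(G)`. -/
abbrev LsDual (K : Type*) (N : ℕ) (s : ℝ) : Type _ := WL K N ∞ (-s)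

/-- `𝓑^s = 𝓑(𝓛^s, (𝓛^s)^*)` with the operator norm. -/
abbrev Bs (K : Type*) (N : ℕ) (s : ℝ) : Type _ := Ls K N s →L[ℂ] LsDual K N s

/-- The Hilbert space `𝓗 = ℓ²(G)`. -/
abbrev Hsp (K : Type*) (N : ℕ) : Type _ := lp (fun _ : Vtx K N => ℂ) 2

/-- The sesquilinear pairing `⟨Ψ, u⟩ = ∑ₓ conj (Ψ[x]) u[x]`, used where the sum converges
absolutely. -/
def pairing (Ψ u : Vtx K N → ℂ) : ℂ := ∑' x, conj (Ψ x) * u x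

lemma norm_mul_le_of_dual {s : ℝ} (Ψ : LsDual K N s) (u : Ls K N s) (x : Vtx K N) :
    ‖conj (Ψ x) * u x‖ ≤ ‖Ψ‖ * ‖WL.toLp u x‖ := by
  have h1 : ‖WL.toLp Ψ x‖ ≤ ‖Ψ‖ := lp.norm_apply_le_norm (by simp) _ x
  have h2 : ‖conj (Ψ x) * u x‖ = ‖WL.toLp Ψ x‖ * ‖WL.toLp u x‖ := by
    rw [WL.toLp_apply, WL.toLp_apply, norm_mul, norm_mul, norm_mul, Complex.norm_real,
      Complex.norm_real, RCLike.norm_conj, Real.norm_of_nonneg (wt_pos _ x).le,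
      Real.norm_of_nonneg (wt_pos _ x).le]
    linear_combination (-(‖Ψ x‖ * ‖u x‖)) * wt_neg_mul s x
  rw [h2]
  gcongr

lemma hasSum_norm_toLp {s : ℝ} (u : Ls K N s) : HasSum (fun x => ‖WL.toLp u x‖) ‖u‖ := by
  have h := lp.hasSum_norm (p := 1) (by simp) (WL.toLp u)
  simpa [WL.norm_def] using h

lemma summable_pairing {s : ℝ} (Ψ : LsDual K N s) (u : Ls K N s) :
    Summable (fun x => conj (Ψ x) * u x) :=
  Summable.of_norm_bounded ((hasSum_norm_toLp u).summable.mul_left ‖Ψ‖) (norm_mul_le_of_dual Ψ u)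

/-- For `Ψ ∈ (𝓛^s)^*`, the bounded functional `u ↦ ⟨Ψ, u⟩` on `𝓛^s`. -/
def pairCLM {s : ℝ} (Ψ : LsDual K N s) : Ls K N s →L[ℂ] ℂ :=
  LinearMap.mkContinuous
    { toFun := fun u => pairing Ψ u
      map_add' := by
        intro u v
        simp only [pairing, WL.add_apply, mul_add]
        exact (summable_pairing Ψ u).tsum_add (summable_pairing Ψ v)
      map_smul' := by
        intro c u
        simp only [pairing, WL.smul_apply, RingHom.id_apply, smul_eq_mul]
        rw [← tsum_mul_left]
        congr 1
        funext x
        ring } ‖Ψ‖ (by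
      intro u
      have h := tsum_of_norm_bounded ((hasSum_norm_toLp u).mul_left ‖Ψ‖) (norm_mul_le_of_dual Ψ u)
      exact h)

lemma pairCLM_apply {s : ℝ} (Ψ : LsDual K N s) (u : Ls K N s) :
    pairCLM Ψ u = pairing Ψ u := rfl

section Adjoint

variable {𝒦 : Type*} [NormedAddCommGroup 𝒦] [InnerProductSpace ℂ 𝒦] [CompleteSpace 𝒦]

/-- The adjoint `v^* : (𝓛^s)^* → 𝒦` of `v ∈ 𝓑(𝒦, 𝓛^s)`, i.e. `⟪v^* Ψ, f⟫ = ⟨Ψ, v f⟩`. -/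
def adj {s : ℝ} (v : 𝒦 →L[ℂ] Ls K N s) : LsDual K N s →ₗ[ℂ] 𝒦 where
  toFun Ψ := (InnerProductSpace.toDual ℂ 𝒦).symm ((pairCLM Ψ).comp v)
  map_add' Ψ₁ Ψ₂ := by
    rw [← map_add]
    congr 1
    ext f
    simp only [ContinuousLinearMap.comp_apply, add_apply, pairCLM_apply]
    rw [pairing, pairing, pairing,
      ← (summable_pairing Ψ₁ (v f)).tsum_add (summable_pairing Ψ₂ (v f))]
    congr 1
    funext x
    simp [add_mul]
  map_smul' c Ψ := by
    apply (InnerProductSpace.toDual ℂ 𝒦).injective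
    ext f
    simp only [RingHom.id_apply, map_smulₛₗ, LinearIsometryEquiv.apply_symm_apply,
      ContinuousLinearMap.comp_apply, smul_apply, pairCLM_apply, pairing,
      smul_eq_mul]
    rw [← tsum_mul_left]
    congr 1
    funext x
    simp [mul_assoc]

lemma inner_adj {s : ℝ} (v : 𝒦 →L[ℂ] Ls K N s) (Ψ : LsDual K N s) (f : 𝒦) :
    inner ℂ (adj v Ψ) f = pairing Ψ (v f) :=
  InnerProductSpace.toDual_symm_apply

end Adjoint

/-! ### The inclusions `𝓛^s ⊂ 𝓗 ⊂ (𝓛^s)^*` for `s ≥ 0` -/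

lemma norm_le_toLp {s : ℝ} (hs : 0 ≤ s) (u : Ls K N s) (x : Vtx K N) :
    ‖u x‖ ≤ ‖WL.toLp u x‖ := by
  rw [WL.toLp_apply, norm_mul, Complex.norm_real, Real.norm_of_nonneg (wt_pos _ x).le]
  nlinarith [one_le_wt hs x, norm_nonneg (u x)]

lemma memlp_two_of_Ls {s : ℝ} (hs : 0 ≤ s) (u : Ls K N s) :
    Memℓp (E := fun _ : Vtx K N => ℂ) (WL.toFun u) 2 := by
  have h1 : Memℓp (E := fun _ : Vtx K N => ℂ) (WL.toFun u) 1 :=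
    memℓp_gen (by
      simpa using Summable.of_nonneg_of_le (fun _ => norm_nonneg _) (norm_le_toLp hs u)
        (hasSum_norm_toLp u).summable)
  exact h1.of_exponent_ge (by norm_num)

/-- The inclusion `𝓛^s ⊂ 𝓗`. -/
def LsToH {s : ℝ} (hs : 0 ≤ s) : Ls K N s →L[ℂ] Hsp K N :=
  LinearMap.mkContinuous
    { toFun := fun u => ⟨WL.toFun u, memlp_two_of_Ls hs u⟩
      map_add' := fun u v => lp.ext (WL.toFun.map_add u v)
      map_smul' := fun c u => lp.ext (WL.toFun.map_smul c u) } 1 (by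
    intro u
    rw [one_mul]
    refine lp.norm_le_of_tsum_le (by norm_num) (norm_nonneg u) ?_
    have hsum := hasSum_norm_toLp u
    have hle : ∀ x : Vtx K N, ‖u x‖ ^ (2 : ℝ) ≤ ‖u‖ * ‖WL.toLp u x‖ := by
      intro x
      have h1 := norm_le_toLp hs u x
      have h2 : ‖WL.toLp u x‖ ≤ ‖u‖ := lp.norm_apply_le_norm (by simp) _ x
      rw [Real.rpow_two]
      nlinarith [norm_nonneg (u x), norm_nonneg (WL.toLp u x)]
    have hs2 := hsum.mul_left ‖u‖
    have hs3 : Summable fun x : Vtx K N => ‖u x‖ ^ (2 : ℝ) :=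
      Summable.of_nonneg_of_le (fun x => by positivity) hle hs2.summable
    have := hs3.tsum_le_tsum hle hs2.summable
    rw [hs2.tsum_eq] at this
    simpa [sq] using this)

lemma LsToH_apply {s : ℝ} (hs : 0 ≤ s) (u : Ls K N s) (x : Vtx K N) :
    LsToH hs u x = u x := rfl

lemma norm_wt_neg_mul_le {s : ℝ} (hs : 0 ≤ s) (ψ : Hsp K N) (x : Vtx K N) :
    ‖(wt (-s) x : ℂ) * ψ x‖ ≤ ‖ψ‖ := by
  have h1 : ‖ψ x‖ ≤ ‖ψ‖ := lp.norm_apply_le_norm (by simp) ψ x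
  rw [norm_mul, Complex.norm_real, Real.norm_of_nonneg (wt_pos _ x).le]
  nlinarith [wt_neg_le_one hs x, wt_pos (-s) x, norm_nonneg (ψ x)]

/-- The inclusion `𝓗 ⊂ (𝓛^s)^*`. -/
def HToDual {s : ℝ} (hs : 0 ≤ s) : Hsp K N →L[ℂ] LsDual K N s :=
  LinearMap.mkContinuous
    { toFun := fun ψ => (⟨ψ, memℓp_infty ⟨‖ψ‖, by
        rintro _ ⟨x, rfl⟩
        exact norm_wt_neg_mul_le hs ψ x⟩⟩ : ↥(wlp K N ∞ (-s)))
      map_add' := fun u v => rfl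
      map_smul' := fun c u => rfl } 1 (by
    intro ψ
    rw [one_mul]
    exact lp.norm_le_of_forall_le (norm_nonneg ψ) (norm_wt_neg_mul_le hs ψ))

lemma HToDual_apply {s : ℝ} (hs : 0 ≤ s) (ψ : Hsp K N) (x : Vtx K N) :
    HToDual hs ψ x = ψ x := rfl

/-- A bounded operator on `𝓗`, regarded as an element of `𝓑^s` for `s ≥ 0`. -/
def toBs {s : ℝ} (hs : 0 ≤ s) (T : Hsp K N →L[ℂ] Hsp K N) : Bs K N s :=
  (HToDual hs).comp (T.comp (LsToH hs))

lemma toBs_apply {s : ℝ} (hs : 0 ≤ s) (T : Hsp K N →L[ℂ] Hsp K N) (u : Ls K N s) (x : Vtx K N) :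
    toBs hs T u x = T (LsToH hs u) x := rfl

/-- `T ∈ 𝓑^s` belongs to the smaller space `𝓑^t`, `t ≤ s` (where `𝓛^s ⊂ 𝓛^t` and
`(𝓛^t)^* ⊂ (𝓛^s)^*`): it is the restriction to `𝓛^s` of a bounded operator
`𝓛^t → (𝓛^t)^*`. -/
def BelongsTo {s : ℝ} (t : ℝ) (T : Bs K N s) : Prop :=
  ∃ T' : Bs K N t, ∀ (u : Ls K N s) (u' : Ls K N t),
    (∀ x, u x = u' x) → ∀ x, T u x = T' u' x

/-! ### The free operator -/

open scoped Classical in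
/-- The free operator `H₀ = h₀ ⊕ h₁ ⊕ ⋯ ⊕ h_N` on all functions on the vertices: `h₀` is the
graph Laplacian of the finite graph `Γ` plus the Dirichlet terms at the vertices `a α` to which
the half-lines are attached, and `h_α` is the Dirichlet Laplacian of the half-line. -/
def H₀fun [Fintype K] (Γ : SimpleGraph K) (a : Fin N → K) :
    (Vtx K N → ℂ) →ₗ[ℂ] (Vtx K N → ℂ) where
  toFun u
    | .inl x =>
        (∑ y ∈ Finset.univ.filter (fun y => Γ.Adj x y), (u (.inl x) - u (.inl y))) +
          ∑ α : Fin N, (if x = a α then 1 else 0) * u (.inl x)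
    | .inr (α, 0) => 2 * u (.inr (α, 0)) - u (.inr (α, 1))
    | .inr (α, n + 1) =>
        2 * u (.inr (α, n + 1)) - u (.inr (α, n + 2)) - u (.inr (α, n))
  map_add' u v := by
    funext x
    rcases x with x | ⟨α, _ | n⟩
    · simp only [Pi.add_apply, mul_add, Finset.sum_add_distrib]
      rw [add_add_add_comm, ← Finset.sum_add_distrib (s := Finset.filter _ _)]
      congr 1
      apply Finset.sum_congr rfl
      intros
      ring
    · simp only [Pi.add_apply]; ring
    · simp only [Pi.add_apply]; ring
  map_smul' c u := by
    funext x
    rcases x with x | ⟨α, _ | n⟩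
    · simp only [Pi.smul_apply, smul_eq_mul, RingHom.id_apply, mul_add, Finset.mul_sum]
      congr 1
      · apply Finset.sum_congr rfl
        intros
        ring
      · apply Finset.sum_congr rfl
        intros
        ring
    · simp only [Pi.smul_apply, smul_eq_mul, RingHom.id_apply]; ring
    · simp only [Pi.smul_apply, smul_eq_mul, RingHom.id_apply]; ring

lemma memlp_two_iff (f : Vtx K N → ℂ) : Memℓp f 2 ↔ Summable fun x => ‖f x‖ ^ 2 := by
  rw [memℓp_gen_iff (by norm_num)]
  simp

lemma H₀fun_memlp [Fintype K] (Γ : SimpleGraph K) (a : Fin N → K) (u : Vtx K N → ℂ)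
    (hu : Memℓp u 2) : Memℓp (H₀fun Γ a u) 2 := by
  rw [memlp_two_iff] at hu ⊢
  have hr : Summable fun q : Fin N × ℕ => ‖u (.inr q)‖ ^ 2 := hu.comp_injective Sum.inr_injective
  have hi : Function.Injective (fun q : Fin N × ℕ => (q.1, q.2 + 1)) := by
    rintro ⟨α, n⟩ ⟨β, m⟩ h
    simpa using h
  have hp : Summable fun q : Fin N × ℕ => ‖u (.inr (q.1, q.2 + 1))‖ ^ 2 := hr.comp_injective hi
  let g : Fin N × ℕ → ℝ
    | (_, 0) => 0
    | (α, n + 1) => ‖u (.inr (α, n))‖ ^ 2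
  have hg : Summable g := by
    refine (hi.summable_iff ?_).1 hr
    rintro ⟨α, _ | n⟩ hx
    · rfl
    · exact absurd ⟨(α, n), rfl⟩ hx
  have hg0 : ∀ q, 0 ≤ g q := by
    rintro ⟨α, _ | n⟩
    · exact le_rfl
    · exact sq_nonneg _
  have key : Summable fun q : Fin N × ℕ => ‖H₀fun Γ a u (.inr q)‖ ^ 2 := by
    refine Summable.of_nonneg_of_le (fun _ => by positivity) ?_
      ((hr.mul_left 12).add ((hp.mul_left 3).add (hg.mul_left 3)))
    have aux : ∀ z₁ z₂ z₃ : ℂ,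
        ‖2 * z₁ - z₂ - z₃‖ ^ 2 ≤ 12 * ‖z₁‖ ^ 2 + (3 * ‖z₂‖ ^ 2 + 3 * ‖z₃‖ ^ 2) := by
      intro z₁ z₂ z₃
      have h1 : ‖2 * z₁ - z₂ - z₃‖ ≤ 2 * ‖z₁‖ + ‖z₂‖ + ‖z₃‖ := by
        have := norm_sub_le (2 * z₁ - z₂) z₃
        have := norm_sub_le (2 * z₁) z₂
        have : ‖2 * z₁‖ = 2 * ‖z₁‖ := by simp
        linarith
      have h0 := norm_nonneg (2 * z₁ - z₂ - z₃)
      nlinarith [sq_nonneg (2 * ‖z₁‖ - ‖z₂‖), sq_nonneg (2 * ‖z₁‖ - ‖z₃‖),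
        sq_nonneg (‖z₂‖ - ‖z₃‖), norm_nonneg z₁, norm_nonneg z₂, norm_nonneg z₃]
    rintro ⟨α, _ | n⟩
    · have := aux (u (.inr (α, 0))) (u (.inr (α, 1))) 0
      simpa [H₀fun, g] using this
    · exact aux (u (.inr (α, n + 1))) (u (.inr (α, n + 2))) (u (.inr (α, n)))
  have hf := (Finset.summable_compl_iff
    (f := fun x => ‖H₀fun Γ a u x‖ ^ 2) (Finset.univ.map ⟨Sum.inl, Sum.inl_injective⟩)).1 ?_
  · exact hf
  · let φ : {x : Vtx K N // x ∉ Finset.univ.map ⟨Sum.inl, Sum.inl_injective⟩} → Fin N × ℕ :=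
      fun x => match x with
        | ⟨.inl k, h⟩ => absurd (by simp) h
        | ⟨.inr q, _⟩ => q
    have hφ : Function.Injective φ := by
      rintro ⟨x | q, hx⟩ ⟨y | r, hy⟩ h
      · exact absurd (by simp) hx
      · exact absurd (by simp) hx
      · exact absurd (by simp) hy
      · have : q = r := h
        subst this
        rfl
    convert key.comp_injective hφ using 1
    funext x
    rcases x with ⟨x | q, hx⟩
    · exact absurd (by simp) hx
    · rfl

/-- The coordinate functionals on `𝓗` are continuous. -/
lemma continuous_coord (x : Vtx K N) : Continuous fun ψ : Hsp K N => ψ x :=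
  (lp.lipschitzWith_one_eval 2 x).continuous

/-- The bounded operator `H₀` on `𝓗`. -/
def H₀ [Fintype K] (Γ : SimpleGraph K) (a : Fin N → K) : Hsp K N →L[ℂ] Hsp K N :=
  ContinuousLinearMap.ofSeqClosedGraph
    (g := { toFun := fun ψ => (⟨H₀fun Γ a ψ, H₀fun_memlp Γ a ψ (lp.memℓp ψ)⟩ : Hsp K N)
            map_add' := fun ψ φ => lp.ext ((H₀fun Γ a).map_add ψ φ)
            map_smul' := fun c ψ => lp.ext ((H₀fun Γ a).map_smul c ψ) }) (by
    intro ψ ψ' φ h1 h2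
    apply lp.ext
    funext x
    have e1 : Tendsto (fun n => H₀fun Γ a (ψ n) x) atTop (𝓝 (φ x)) :=
      ((continuous_coord x).tendsto φ).comp h2
    have e2 : Tendsto (fun n => H₀fun Γ a (ψ n) x) atTop (𝓝 (H₀fun Γ a ψ' x)) := by
      have c : ∀ y, Tendsto (fun n => (ψ n y : ℂ)) atTop (𝓝 (ψ' y : ℂ)) := fun y =>
        ((continuous_coord y).tendsto ψ').comp h1
      refine (show Continuous fun f : Vtx K N → ℂ => H₀fun Γ a f x from ?_).continuousAt.tendsto.comp
        (tendsto_pi_nhds.2 c)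
      rcases x with x | ⟨α, _ | m⟩
      · simp only [H₀fun, LinearMap.coe_mk, AddHom.coe_mk]
        fun_prop
      · simp only [H₀fun, LinearMap.coe_mk, AddHom.coe_mk]
        fun_prop
      · simp only [H₀fun, LinearMap.coe_mk, AddHom.coe_mk]
        fun_prop
    exact tendsto_nhds_unique e1 e2)

lemma H₀_apply [Fintype K] (Γ : SimpleGraph K) (a : Fin N → K) (ψ : Hsp K N) (x : Vtx K N) :
    H₀ Γ a ψ x = H₀fun Γ a ψ x := rfl

/-! ### The perturbed operator -/

/-- The resolvent `R(κ) = (H + κ²)⁻¹` of a bounded operator `H` on `𝓗`; it is the inverse in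
`𝓑(𝓗)` whenever `-κ²` is not in the spectrum of `H`. -/
def R (H : Hsp K N →L[ℂ] Hsp K N) (κ : ℂ) : Hsp K N →L[ℂ] Hsp K N :=
  Ring.inverse (H + κ ^ 2 • ContinuousLinearMap.id ℂ (Hsp K N))

section Perturbed

variable {𝒦 : Type*} [NormedAddCommGroup 𝒦] [InnerProductSpace ℂ 𝒦] [CompleteSpace 𝒦]

/-- The class of perturbations: `V` is bounded and self-adjoint on `𝓗`, and it factorizes as
`V = v U v^*` with `v ∈ 𝓑(𝒦, 𝓛^β)` injective and `U ∈ 𝓑(𝒦)` self-adjoint and unitary. -/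
structure IsFactorized {β : ℝ} (hβ : 0 ≤ β) (V : Hsp K N →L[ℂ] Hsp K N)
    (v : 𝒦 →L[ℂ] Ls K N β) (U : 𝒦 →L[ℂ] 𝒦) : Prop where
  selfAdjoint : IsSelfAdjoint V
  injective : Function.Injective v
  selfAdjoint_U : IsSelfAdjoint U
  unitary_U : U ∈ unitary (𝒦 →L[ℂ] 𝒦)
  factorization : ∀ ψ : Hsp K N, V ψ = LsToH hβ (v (U (adj v (HToDual hβ ψ))))

variable [Fintype K]

/-- The action of `H = H₀ + V` on `(𝓛^β)^*`, where `V = v U v^*` maps `(𝓛^β)^*` into `𝓛^β`. -/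
def Hgen (Γ : SimpleGraph K) (a : Fin N → K) {β : ℝ} (v : 𝒦 →L[ℂ] Ls K N β)
    (U : 𝒦 →L[ℂ] 𝒦) : LsDual K N β →ₗ[ℂ] (Vtx K N → ℂ) :=
  (H₀fun Γ a).comp WL.toFun + WL.toFun.comp (v.toLinearMap.comp (U.toLinearMap.comp (adj v)))

/-- The generalized zero eigenspace `{Ψ ∈ (𝓛^β)^* ; HΨ = 0}`. -/
def genEigenspace (Γ : SimpleGraph K) (a : Fin N → K) {β : ℝ} (v : 𝒦 →L[ℂ] Ls K N β)
    (U : 𝒦 →L[ℂ] 𝒦) : Submodule ℂ (Vtx K N → ℂ) :=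
  (LinearMap.ker (Hgen Γ a v U)).map WL.toFun

end Perturbed

/-- `𝟏^{(α)}`, the indicator function of the half-line number `α`. -/
def oneRay (α : Fin N) : Vtx K N → ℂ
  | .inl _ => 0
  | .inr (α', _) => if α' = α then 1 else 0

section Eigenspaces

variable {𝒦 : Type*} [NormedAddCommGroup 𝒦] [InnerProductSpace ℂ 𝒦] [CompleteSpace 𝒦]
variable [Fintype K]

/-- `𝓔`, the generalized eigenfunctions in `ℂ𝟏 ⊕ 𝓛^{β-2}`. -/
def resonanceSpace (Γ : SimpleGraph K) (a : Fin N → K) {β : ℝ} (v : 𝒦 →L[ℂ] Ls K N β)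
    (U : 𝒦 →L[ℂ] 𝒦) : Submodule ℂ (Vtx K N → ℂ) :=
  genEigenspace Γ a v U ⊓ (Submodule.span ℂ (Set.range oneRay) ⊔ wlp K N 1 (β - 2))

/-- `𝖤`, the generalized eigenfunctions in `𝓛^{β-2}`. -/
def boundSpace (Γ : SimpleGraph K) (a : Fin N → K) {β : ℝ} (v : 𝒦 →L[ℂ] Ls K N β)
    (U : 𝒦 →L[ℂ] 𝒦) : Submodule ℂ (Vtx K N → ℂ) :=
  genEigenspace Γ a v U ⊓ wlp K N 1 (β - 2)

/-- The threshold `0` is an exceptional point of the first kind: `𝓔 ⊋ 𝖤 = {0}`. -/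
def IsExceptionalFirstKind (Γ : SimpleGraph K) (a : Fin N → K) {β : ℝ}
    (v : 𝒦 →L[ℂ] Ls K N β) (U : 𝒦 →L[ℂ] 𝒦) : Prop :=
  boundSpace Γ a v U < resonanceSpace Γ a v U ∧ boundSpace Γ a v U = ⊥

end Eigenspaces

/-! ### Orthogonal resonance and bound projections

Here `ℰ` stands for the resonance space `𝓔`, and `E` for the bound eigenspace `𝖤`. -/

/-- `Ψ` is a resonance basis: the classes of its members form a basis of `ℰ / E`. -/
def IsResonanceBasis (ℰ E : Submodule ℂ (Vtx K N → ℂ)) {d : ℕ} (Ψ : Fin d → ℰ) : Prop :=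
  LinearIndependent ℂ (fun γ => (E.comap ℰ.subtype).mkQ (Ψ γ)) ∧
    Submodule.span ℂ (Set.range fun γ => (E.comap ℰ.subtype).mkQ (Ψ γ)) = ⊤

/-- The resonance basis `Ψ` is orthonormal: it is orthogonal to the bound eigenfunctions, and the
vectors of the leading coefficients of its members along the half-lines are orthonormal
in `ℂ^N`. -/
def IsOrthonormalResonanceBasis (β : ℝ) (ℰ E : Submodule ℂ (Vtx K N → ℂ)) {d : ℕ}
    (Ψ : Fin d → ℰ) : Prop :=
  IsResonanceBasis ℰ E Ψ ∧
    (∀ γ, ∀ Φ ∈ E, (fun x => conj (Φ x) * (Ψ γ).1 x) ∈ wlp K N 1 0 ∧ pairing Φ (Ψ γ).1 = 0) ∧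
    ∃ c : Fin d → EuclideanSpace ℂ (Fin N), Orthonormal ℂ c ∧
      ∀ γ, (Ψ γ).1 - ∑ α, c γ α • oneRay α ∈ wlp K N 1 (β - 2)

/-- `T = ∑_γ |Ψ_γ⟩⟨Ψ_γ|` as an operator in `𝓑^s`. -/
def IsSumRankOne {s : ℝ} {d : ℕ} (Ψ : Fin d → Vtx K N → ℂ) (T : Bs K N s) : Prop :=
  ∀ (u : Ls K N s) (x : Vtx K N), T u x = ∑ γ, pairing (Ψ γ) u * Ψ γ x

/-- `T` is the orthogonal resonance projection: orthonormal resonance bases exist, and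
`T = ∑_γ |Ψ_γ⟩⟨Ψ_γ|` for each of them. -/
def IsResonanceProjection (β : ℝ) (ℰ E : Submodule ℂ (Vtx K N → ℂ)) {s : ℝ} (T : Bs K N s) :
    Prop :=
  (∃ (d : ℕ) (Ψ : Fin d → ℰ), IsOrthonormalResonanceBasis β ℰ E Ψ) ∧
    ∀ (d : ℕ) (Ψ : Fin d → ℰ), IsOrthonormalResonanceBasis β ℰ E Ψ →
      IsSumRankOne (fun γ => (Ψ γ).1) T

/-- `Ψ` is an orthonormal bound basis, i.e. a basis of `E` that is orthonormal in `ℓ²`. -/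
def IsOrthonormalBoundBasis (E : Submodule ℂ (Vtx K N → ℂ)) {d : ℕ} (Ψ : Fin d → E) : Prop :=
  LinearIndependent ℂ Ψ ∧ Submodule.span ℂ (Set.range Ψ) = ⊤ ∧
    ∀ γ γ', (fun x => conj ((Ψ γ').1 x) * (Ψ γ).1 x) ∈ wlp K N 1 0 ∧
      pairing (Ψ γ').1 (Ψ γ).1 = if γ = γ' then 1 else 0

/-- `T` is the orthogonal bound projection: orthonormal bound bases exist, and
`T = ∑_γ |Ψ_γ⟩⟨Ψ_γ|` for each of them. -/
def IsBoundProjection (E : Submodule ℂ (Vtx K N → ℂ)) {s : ℝ} (T : Bs K N s) : Prop :=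
  (∃ (d : ℕ) (Ψ : Fin d → E), IsOrthonormalBoundBasis E Ψ) ∧
    ∀ (d : ℕ) (Ψ : Fin d → E), IsOrthonormalBoundBasis E Ψ →
      IsSumRankOne (fun γ => (Ψ γ).1) T

lemma sub_one_nonneg' {β : ℕ} (hβ : 3 ≤ β) : (0 : ℝ) ≤ (β : ℝ) - 1 := by
  have : (3 : ℝ) ≤ β := by exact_mod_cast hβ
  linarith

end

end RayGraph

open RayGraph

/-! ### Finite asymptotic expansions in a small complex parameter -/

/-! Put `M(κ) = U + v^* R₀(κ) v` with `R₀(κ) = (H₀ + κ²)⁻¹`. Since `U² = 1`, one has `R = R₀ - R₀ v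
M⁻¹ v^* R₀` (`resolvent_formula`), so everything reduces to expanding `R₀` and `M⁻¹`.

The Dirichlet conditions decouple `H₀`. On `K` the operator `h₀` is invertible as soon as some
half-line is attached, because `K` is connected. On a half-line, `θ + θ⁻¹ = 2 + κ²` makes each entry
of the Green function a polynomial in `θ`, with `|θ| < 1` for small `κ` with `Re κ > 0`. Taylor's
formula at `θ = 1`, with remainder bounded by binomial coefficients, expands `R₀` up to `O(κ^j)` in
`𝓑^s` for `1 ≤ j ≤ s` (`hasExpansion_free`). The limit is `G₀`, and the coefficient of `κ` is `-∑
|n^(α)⟩⟨n^(α)|`.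

Hence `M(κ) = M₀ + κ M'(κ)` with `M₀ = U + v^* G₀ v` and `M' → M₁`, where `⟨M₁ f, f⟩ = -∑ |p_α(f)|²`
for the moments `p_α(f) = ⟨n^(α), v f⟩`. The map `f ↦ G₀ v f` identifies `ker M₀` with `𝓔`, and
`p_α(f)` is the constant that `G₀ v f` approaches on the half-line `α`. If all moments of `f ∈ ker
M₀` vanish, then `G₀ v f` lies in `𝖤 = {0}`. So `M₁` is negative definite on `ker M₀`; with `S` the
orthogonal projection onto this kernel, the Fredholm alternative makes `N₀ = M₀ + S M₁` invertible
(`isUnit_Nzero`).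

The factorization `M(κ) = ((1 - S) + κ S) (M₀ + S M' + κ (1 - S) M')` then expands `κ M(κ)⁻¹`, with
limit `N₀⁻¹ S` (`expansion_inverse_of_singular`). In a basis `f_γ` of `ker M₀` with orthonormal
moment vectors, `N₀⁻¹ S = -∑ |f_γ⟩⟨f_γ|`. Therefore `κ R(κ)` tends to `∑ |G₀ v f_γ⟩⟨G₀ v f_γ|`, the
resonance projection.

The weights of the coefficients come from running the same expansion in a smaller `𝓑^t` and
comparing matrix elements (`belongsTo_coeff`). -/

/-- `F` has an asymptotic expansion `F κ = c₀ + κ c₁ + ⋯ + κ^(n-1) c_(n-1) + O(κ^n)` along `l`. -/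
def HasExpansion {E : Type*} [NormedAddCommGroup E] [NormedSpace ℂ E] (l : Filter ℂ) :
    ℕ → (ℂ → E) → Prop
  | 0, F => F =O[l] (fun _ => (1 : ℝ))
  | n + 1, F => ∃ (c : E) (F' : ℂ → E), HasExpansion l n F' ∧ ∀ᶠ κ in l, F κ = c + κ • F' κ

namespace HasExpansion

variable {E E₁ E₂ : Type*} [NormedAddCommGroup E] [NormedSpace ℂ E]
  [NormedAddCommGroup E₁] [NormedSpace ℂ E₁] [NormedAddCommGroup E₂] [NormedSpace ℂ E₂]
  {l : Filter ℂ} {n : ℕ} {F G : ℂ → E}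

lemma congr (h : HasExpansion l n F) (e : ∀ᶠ κ in l, G κ = F κ) : HasExpansion l n G := by
  cases n with
  | zero => exact (isBigO_congr (e : G =ᶠ[l] F) EventuallyEq.rfl).2 h
  | succ n =>
    obtain ⟨c, F', h1, h2⟩ := h
    exact ⟨c, F', h1, by filter_upwards [e, h2] with κ a b; rw [a, b]⟩

lemma isBigO_one (hl : l ≤ 𝓝 0) (h : HasExpansion l n F) : F =O[l] (fun _ => (1 : ℝ)) := by
  induction n generalizing F with
  | zero => exact h
  | succ n ih =>
    obtain ⟨c, F', h1, h2⟩ := h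
    have h3 : (fun κ : ℂ => κ) =O[l] (fun _ => (1 : ℝ)) :=
      (continuous_id.tendsto (0 : ℂ) |>.mono_left hl).isBigO_one ℝ
    have h4 : (fun κ => c + κ • F' κ) =O[l] (fun _ => (1 : ℝ)) := by
      refine (isBigO_const_const c one_ne_zero l).add ?_
      simpa using h3.smul (ih h1)
    exact (isBigO_congr (h2 : F =ᶠ[l] _) EventuallyEq.rfl).2 h4

lemma tendsto_smul_zero (hl : l ≤ 𝓝 0) (h : HasExpansion l n F) :
    Tendsto (fun κ => κ • F κ) l (𝓝 0) := by
  have h1 : (fun κ : ℂ => κ) =o[l] (fun _ => (1 : ℝ)) :=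
    (isLittleO_one_iff ℝ).2 (tendsto_id.mono_left hl)
  have h2 := h1.smul_isBigO (h.isBigO_one hl)
  simp only [smul_eq_mul, mul_one] at h2
  exact (isLittleO_one_iff ℝ).1 h2

lemma exists_tendsto (hl : l ≤ 𝓝 0) (h : HasExpansion l (n + 1) F) :
    ∃ (c : E) (F' : ℂ → E), HasExpansion l n F' ∧ (∀ᶠ κ in l, F κ = c + κ • F' κ) ∧
      Tendsto F l (𝓝 c) := by
  obtain ⟨c, F', h1, h2⟩ := h
  refine ⟨c, F', h1, h2, ?_⟩
  have := (tendsto_const_nhds (x := c)).add (h1.tendsto_smul_zero hl)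
  rw [add_zero] at this
  exact this.congr' (h2.mono fun κ hκ => hκ.symm)

/-- All coefficients are zero: one divides by `κ` repeatedly, which is why the filter must avoid
`0`. This is how remainder estimates enter the recursive calculus. -/
lemma of_isBigO (hl : l ≤ 𝓝[≠] 0) (h : F =O[l] (fun κ => κ ^ n)) : HasExpansion l n F := by
  have hne : ∀ᶠ κ in l, κ ≠ 0 := hl self_mem_nhdsWithin
  induction n generalizing F with
  | zero => exact h.trans (isBigO_of_le _ (by simp))
  | succ n ih =>
    refine ⟨0, fun κ => κ⁻¹ • F κ, ih ?_, ?_⟩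
    · have h1 : (fun κ : ℂ => κ⁻¹) =O[l] (fun κ : ℂ => κ⁻¹) := isBigO_refl _ _
      refine (h1.smul h).congr' EventuallyEq.rfl ?_
      filter_upwards [hne] with κ hκ
      rw [smul_eq_mul, pow_succ]
      field_simp
    · filter_upwards [hne] with κ hκ
      rw [zero_add, smul_inv_smul₀ hκ]

/-- The recursive form is convenient for algebra; this flat form is the one in which coefficients
are compared and in which the final estimate is stated. -/
lemma exists_isBigO (h : HasExpansion l n F) :
    ∃ c : ℕ → E, (fun κ => F κ - ∑ i ∈ Finset.range n, κ ^ i • c i) =O[l] (fun κ => κ ^ n) := by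
  induction n generalizing F with
  | zero =>
    have h1 : (fun _ : ℂ => (1 : ℝ)) =O[l] (fun κ : ℂ => κ ^ 0) := isBigO_of_le _ (by simp)
    exact ⟨0, by simpa using IsBigO.trans h h1⟩
  | succ n ih =>
    obtain ⟨c, F', h1, h2⟩ := h
    obtain ⟨d, hd⟩ := ih h1
    refine ⟨fun i => Nat.casesOn i c d, ?_⟩
    have h3 := (isBigO_refl (fun κ : ℂ => κ) l).smul hd
    refine h3.congr' ?_ ?_
    · filter_upwards [h2] with κ hκ
      rw [hκ, Finset.sum_range_succ', smul_sub, Finset.smul_sum]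
      simp only [pow_succ', mul_smul, pow_zero, one_smul]
      change _ = c + κ • F' κ - (_ + c)
      abel
    · filter_upwards with κ
      simp [pow_succ']

lemma const (c : E) : HasExpansion l n (fun _ => c) := by
  induction n generalizing c with
  | zero => exact isBigO_const_const c one_ne_zero l
  | succ n ih => exact ⟨c, fun _ => 0, ih 0, by simp⟩

lemma id_smul (h : HasExpansion l n F) : HasExpansion l (n + 1) (fun κ => κ • F κ) :=
  ⟨0, F, h, by simp⟩

lemma of_succ (hl : l ≤ 𝓝 0) (h : HasExpansion l (n + 1) F) : HasExpansion l n F := by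
  induction n generalizing F with
  | zero => exact h.isBigO_one hl
  | succ n ih =>
    obtain ⟨c, F', h1, h2⟩ := h
    exact ⟨c, F', ih h1, h2⟩

lemma id_smul' (hl : l ≤ 𝓝 0) (h : HasExpansion l n F) : HasExpansion l n (fun κ => κ • F κ) :=
  h.id_smul.of_succ hl

lemma id (hl : l ≤ 𝓝 0) : HasExpansion l n (fun κ => κ) := by
  simpa using (const (l := l) (n := n) (1 : ℂ)).id_smul' hl

lemma add (hF : HasExpansion l n F) (hG : HasExpansion l n G) :
    HasExpansion l n (fun κ => F κ + G κ) := by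
  induction n generalizing F G with
  | zero => exact IsBigO.add hF hG
  | succ n ih =>
    obtain ⟨c, F', h1, h2⟩ := hF
    obtain ⟨d, G', h3, h4⟩ := hG
    refine ⟨c + d, _, ih h1 h3, ?_⟩
    filter_upwards [h2, h4] with κ a b
    rw [a, b, smul_add]
    abel

lemma clm (L : E →L[ℂ] E₁) (hF : HasExpansion l n F) : HasExpansion l n (fun κ => L (F κ)) := by
  induction n generalizing F with
  | zero => exact (L.isBigO_comp F l).trans hF
  | succ n ih =>
    obtain ⟨c, F', h1, h2⟩ := hF
    refine ⟨L c, _, ih h1, ?_⟩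
    filter_upwards [h2] with κ a
    rw [a, map_add, map_smul]

lemma neg (hF : HasExpansion l n F) : HasExpansion l n (fun κ => -F κ) := by
  simpa using hF.clm (-ContinuousLinearMap.id ℂ E)

lemma sub (hF : HasExpansion l n F) (hG : HasExpansion l n G) :
    HasExpansion l n (fun κ => F κ - G κ) := by
  simpa only [sub_eq_add_neg] using hF.add hG.neg

lemma sum {ι : Type*} (s : Finset ι) {F : ι → ℂ → E} (hF : ∀ i ∈ s, HasExpansion l n (F i)) :
    HasExpansion l n (fun κ => ∑ i ∈ s, F i κ) := by
  classical
  induction s using Finset.induction_on with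
  | empty => simpa using const (l := l) (n := n) (0 : E)
  | insert i s hi ih =>
    simp only [Finset.sum_insert hi]
    exact (hF i (by simp)).add (ih fun j hj => hF j (by simp [hj]))

/-- Leibniz rule in the form `B(F, G) = B(c, d) + κ (B(F', G) + B(c, G'))`. The undivided `G` in the
first term only needs its expansion one order lower, so the induction closes. -/
lemma bilin (hl : l ≤ 𝓝 0) (B : E →L[ℂ] E₁ →L[ℂ] E₂) {G : ℂ → E₁} (hF : HasExpansion l n F)
    (hG : HasExpansion l n G) : HasExpansion l n (fun κ => B (F κ) (G κ)) := by
  induction n generalizing F G with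
  | zero =>
    have h1 : (fun κ => B (F κ) (G κ)) =O[l] (fun κ => ‖F κ‖ * ‖G κ‖) :=
      IsBigO.of_bound ‖B‖ (Eventually.of_forall fun κ => by
        simpa [mul_assoc] using B.le_opNorm₂ (F κ) (G κ))
    have h2 := IsBigO.mul (IsBigO.norm_left hF) (IsBigO.norm_left hG)
    simp only [mul_one] at h2
    exact h1.trans h2
  | succ n ih =>
    obtain ⟨c, F', h1, h2⟩ := hF
    obtain ⟨d, G', h3, h4⟩ := hG
    have hG' := (show HasExpansion l (n + 1) G from ⟨d, G', h3, h4⟩).of_succ hl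
    refine ⟨B c d, _, (ih h1 hG').add (h3.clm (B c)), ?_⟩
    filter_upwards [h2, h4] with κ a b
    rw [a]
    simp only [map_add, map_smul, add_apply, smul_apply, smul_add]
    nth_rewrite 1 [b]
    simp only [map_add, map_smul]
    abel

lemma smul (hl : l ≤ 𝓝 0) {f : ℂ → ℂ} (hf : HasExpansion l n f) (hF : HasExpansion l n F) :
    HasExpansion l n (fun κ => f κ • F κ) := by
  simpa using bilin hl (ContinuousLinearMap.lsmul ℂ ℂ : ℂ →L[ℂ] E →L[ℂ] E) hf hF

lemma pow (hl : l ≤ 𝓝 0) {f : ℂ → ℂ} (hf : HasExpansion l n f) (k : ℕ) :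
    HasExpansion l n (fun κ => f κ ^ k) := by
  induction k with
  | zero => simpa using const (l := l) (n := n) (1 : ℂ)
  | succ k ih => simpa [pow_succ'] using hf.smul hl ih

lemma comp (hl : l ≤ 𝓝 0) {S : ℂ → E₁ →L[ℂ] E₂} {T : ℂ → E →L[ℂ] E₁} (hS : HasExpansion l n S)
    (hT : HasExpansion l n T) : HasExpansion l n (fun κ => (S κ).comp (T κ)) := by
  simpa using bilin hl (ContinuousLinearMap.compL ℂ E E₁ E₂) hS hT

/-- From `F = u + κ F'` follows `F⁻¹ = u⁻¹ - κ u⁻¹ F' F⁻¹`, which bootstraps an expansion of the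
inverse by one order at a time. The limit is a separate hypothesis because order zero records
boundedness only. -/
lemma inverse {A : Type*} [NormedRing A] [NormedAlgebra ℂ A] [CompleteSpace A] (hl : l ≤ 𝓝 0)
    {F : ℂ → A} {c : A} (hF : HasExpansion l n F) (hc : Tendsto F l (𝓝 c)) (hu : IsUnit c) :
    HasExpansion l n (fun κ => Ring.inverse (F κ)) := by
  obtain ⟨u, rfl⟩ := hu
  rcases l.eq_or_neBot with rfl | hbot
  · exact (const (0 : A)).congr (by simp)
  have hcont : Tendsto (fun κ => Ring.inverse (F κ)) l (𝓝 (Ring.inverse (u : A))) :=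
    (NormedRing.inverse_continuousAt u).tendsto.comp hc
  have hunit : ∀ᶠ κ in l, IsUnit (F κ) := hc (Units.isOpen.mem_nhds u.isUnit)
  induction n with
  | zero => exact hcont.isBigO_one ℝ
  | succ n ih =>
    have hn := ih (hF.of_succ hl)
    obtain ⟨d, F', h1, h2, h3⟩ := hF.exists_tendsto hl
    obtain rfl := tendsto_nhds_unique h3 hc
    refine ⟨Ring.inverse (u : A), fun κ => -((Ring.inverse (u : A)) * (F' κ * Ring.inverse (F κ))),
      ?_, ?_⟩
    · have h4 := (bilin hl (ContinuousLinearMap.mul ℂ A) h1 hn).clm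
        (ContinuousLinearMap.mul ℂ A (Ring.inverse (u : A)))
      simpa using h4.neg
    · filter_upwards [h2, hunit] with κ a hu
      have e : κ • F' κ = F κ - u := by rw [a]; abel
      rw [smul_neg, ← mul_smul_comm, ← smul_mul_assoc, e, sub_mul, Ring.mul_inverse_cancel _ hu,
        mul_sub, ← mul_assoc, Ring.inverse_mul_cancel _ u.isUnit]
      simp

lemma of_analyticAt (hl : l ≤ 𝓝 0) [CompleteSpace E] (hF : AnalyticAt ℂ F 0) :
    HasExpansion l n F := by
  have hb : ∀ G : ℂ → E, AnalyticAt ℂ G 0 → HasExpansion l 0 G := fun G hG =>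
    (hG.continuousAt.tendsto.mono_left hl).isBigO_one ℝ
  induction n generalizing F with
  | zero => exact hb F hF
  | succ n ih =>
    obtain ⟨p, hp⟩ := hF
    refine ⟨F 0, dslope F 0, ih ⟨_, hp.has_fpower_series_dslope_fslope⟩, ?_⟩
    filter_upwards with κ
    have := sub_smul_dslope F 0 κ
    rw [sub_zero] at this
    rw [this]
    abel

end HasExpansion

/-! ### Uniqueness of the coefficients -/

/-- The coefficients of an asymptotic expansion are unique. -/
lemma eq_zero_of_sum_pow_smul_isBigO {E : Type*} [NormedAddCommGroup E] [NormedSpace ℂ E]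
    {l : Filter ℂ} [l.NeBot] (hl : l ≤ 𝓝[≠] 0) {n : ℕ} {c : ℕ → E}
    (h : (fun κ => ∑ i ∈ Finset.range n, κ ^ i • c i) =O[l] (fun κ => κ ^ n)) {i : ℕ}
    (hi : i < n) : c i = 0 := by
  have hl' : l ≤ 𝓝 0 := hl.trans nhdsWithin_le_nhds
  have hne : ∀ᶠ κ in l, κ ≠ 0 := hl self_mem_nhdsWithin
  have aux : ∀ (n : ℕ) (c : ℕ → E), (fun κ => ∑ i ∈ Finset.range n, κ ^ i • c i) =O[l]
      (fun κ => κ ^ n) → ∀ i < n, c i = 0 := by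
    clear h hi i c n
    intro n
    induction n with
    | zero => intro c _ i hi; omega
    | succ n ih =>
      intro c h i hi
      have h0 : c 0 = 0 := by
        have t1 : Tendsto (fun κ : ℂ => ∑ i ∈ Finset.range (n + 1), κ ^ i • c i) l (𝓝 (c 0)) := by
          have : Continuous (fun κ : ℂ => ∑ i ∈ Finset.range (n + 1), κ ^ i • c i) := by fun_prop
          have := (this.tendsto 0).mono_left hl'
          simpa [Finset.sum_range_succ'] using this
        have t2 : Tendsto (fun κ : ℂ => κ ^ (n + 1)) l (𝓝 0) := by
          have := ((continuous_pow (M := ℂ) (n + 1)).tendsto 0).mono_left hl'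
          simpa using this
        exact tendsto_nhds_unique t1 (h.trans_tendsto t2)
      cases i with
      | zero => exact h0
      | succ i =>
        refine ih (fun i => c (i + 1)) ?_ i (by omega)
        refine (((isBigO_refl (fun κ : ℂ => κ⁻¹) l).smul h)).congr' ?_ ?_
        · filter_upwards [hne] with κ hκ
          rw [Finset.sum_range_succ', h0, smul_zero, add_zero, Finset.smul_sum]
          refine Finset.sum_congr rfl fun i _ => ?_
          rw [smul_smul, pow_succ']
          field_simp
        · filter_upwards [hne] with κ hκ
          rw [smul_eq_mul, pow_succ']
          field_simp
  exact aux n c h i hi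

/-- The longer expansion is truncated to order `m`; the difference of the two is then a polynomial
of degree below `m` that is `O(κ^m)`. -/
lemma coeff_unique_of_isBigO {E : Type*} [NormedAddCommGroup E] [NormedSpace ℂ E]
    {l : Filter ℂ} [l.NeBot] (hl : l ≤ 𝓝[≠] 0) {m n : ℕ} (hm : m ≤ n) {F : ℂ → E} {c d : ℕ → E}
    (hc : (fun κ => F κ - ∑ i ∈ Finset.range n, κ ^ i • c i) =O[l] (fun κ => κ ^ n))
    (hd : (fun κ => F κ - ∑ i ∈ Finset.range m, κ ^ i • d i) =O[l] (fun κ => κ ^ m)) {i : ℕ}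
    (hi : i < m) : c i = d i := by
  have hpow : ∀ i, m ≤ i → (fun κ : ℂ => κ ^ i) =O[l] (fun κ => κ ^ m) := fun i hi => by
    have h : ∀ᶠ κ : ℂ in 𝓝 0, ‖κ‖ ≤ 1 := by
      filter_upwards [Metric.ball_mem_nhds (0 : ℂ) one_pos] with κ hκ
      exact (mem_ball_zero_iff.1 hκ).le
    refine IsBigO.of_bound 1 ?_
    filter_upwards [(hl.trans nhdsWithin_le_nhds) h] with κ hκ
    rw [norm_pow, norm_pow, one_mul]
    exact pow_le_pow_of_le_one (norm_nonneg _) hκ hi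
  have hc' : (fun κ => F κ - ∑ i ∈ Finset.range m, κ ^ i • c i) =O[l] (fun κ => κ ^ m) := by
    have h1 : (fun κ => ∑ i ∈ Finset.Ico m n, κ ^ i • c i) =O[l] (fun κ => κ ^ m) := by
      refine IsBigO.fun_sum fun i hi => ?_
      have := (hpow i (Finset.mem_Ico.1 hi).1).smul (isBigO_const_const (c i) (one_ne_zero (α := ℂ)) l)
      simpa using this
    refine ((hc.trans (hpow n hm)).add h1).congr_left fun κ => ?_
    rw [← Finset.sum_range_add_sum_Ico _ hm]
    abel
  have h := hd.sub hc'
  have : (c - d) i = 0 := by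
    refine eq_zero_of_sum_pow_smul_isBigO hl (n := m) (c := c - d) (h.congr_left fun κ => ?_) hi
    simp only [Pi.sub_apply, smul_sub, Finset.sum_sub_distrib]
    abel
  exact sub_eq_zero.1 this

/-- The leading coefficient of an asymptotic expansion is the limit. -/
lemma coeff_zero_eq_of_tendsto {E : Type*} [NormedAddCommGroup E] [NormedSpace ℂ E]
    {l : Filter ℂ} [l.NeBot] (hl : l ≤ 𝓝 0) {n : ℕ} (hn : 1 ≤ n) {F : ℂ → E} {c : ℕ → E} {L : E}
    (hc : (fun κ => F κ - ∑ i ∈ Finset.range n, κ ^ i • c i) =O[l] (fun κ => κ ^ n))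
    (hF : Tendsto F l (𝓝 L)) : c 0 = L := by
  obtain ⟨m, rfl⟩ : ∃ m, n = m + 1 := ⟨n - 1, by omega⟩
  have t1 : Tendsto (fun κ : ℂ => ∑ i ∈ Finset.range (m + 1), κ ^ i • c i) l (𝓝 (c 0)) := by
    have : Continuous (fun κ : ℂ => ∑ i ∈ Finset.range (m + 1), κ ^ i • c i) := by fun_prop
    simpa [Finset.sum_range_succ'] using (this.tendsto 0).mono_left hl
  have t2 : Tendsto (fun κ : ℂ => κ ^ (m + 1)) l (𝓝 0) := by
    simpa using ((continuous_pow (M := ℂ) (m + 1)).tendsto 0).mono_left hl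
  have t3 := (hc.trans_tendsto t2).add t1
  simp only [sub_add_cancel, zero_add] at t3
  exact tendsto_nhds_unique t3 hF

namespace RayGraph

/-! ### The parameter `θ = e^{-η}`, where `κ = 2 sinh (η / 2)` -/

/-- The approach to the threshold: `κ → 0` with `Re κ > 0`. -/
noncomputable abbrev thresholdFilter : Filter ℂ := 𝓝[{κ : ℂ | 0 < κ.re}] 0

lemma thresholdFilter_le_punctured : thresholdFilter ≤ 𝓝[≠] 0 :=
  nhdsWithin_mono _ (by rintro κ hκ rfl; simp at hκ)

lemma thresholdFilter_le : thresholdFilter ≤ 𝓝 0 := nhdsWithin_le_nhds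

instance : thresholdFilter.NeBot := by
  refine mem_closure_iff_nhdsWithin_neBot.1 ?_
  rw [Metric.mem_closure_iff]
  intro ε hε
  exact ⟨(ε / 2 : ℝ), by simpa using hε, by
    rw [dist_zero_left, Complex.norm_real, Real.norm_of_nonneg (by positivity)]; linarith⟩

/-- The square root of `1 + κ² / 4` near `1`, i.e. `cosh (η / 2)`. -/
noncomputable def coshHalf (κ : ℂ) : ℂ := (1 + κ ^ 2 / 4) ^ ((2 : ℕ) : ℂ)⁻¹

/-- `θ = e^{-η}` as a function of `κ = 2 sinh (η / 2)`. -/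
noncomputable def theta (κ : ℂ) : ℂ := (coshHalf κ - κ / 2) ^ 2

lemma coshHalf_sq (κ : ℂ) : coshHalf κ ^ 2 = 1 + κ ^ 2 / 4 :=
  Complex.cpow_nat_inv_pow _ two_ne_zero

lemma coshHalf_zero : coshHalf 0 = 1 := by simp [coshHalf]

lemma analyticAt_coshHalf : AnalyticAt ℂ coshHalf 0 := by
  unfold coshHalf
  refine AnalyticAt.cpow (by fun_prop) analyticAt_const ?_
  simp

/-- Equivalently `θ + θ⁻¹ = 2 + κ²`: the powers of `θ` solve the half-line difference equation at
spectral parameter `-κ²`. -/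
lemma theta_quadratic (κ : ℂ) : theta κ ^ 2 + 1 = (2 + κ ^ 2) * theta κ := by
  have h := coshHalf_sq κ
  have e : theta κ = 1 + κ ^ 2 / 2 - κ * coshHalf κ := by
    rw [theta]; linear_combination h
  rw [e]
  linear_combination κ ^ 2 * h

lemma theta_ne_zero (κ : ℂ) : theta κ ≠ 0 := by
  intro h
  simpa [h] using theta_quadratic κ

lemma theta_zero : theta 0 = 1 := by simp [theta, coshHalf_zero]

lemma analyticAt_theta : AnalyticAt ℂ theta 0 := by
  have := analyticAt_coshHalf
  unfold theta
  fun_prop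

lemma hasDerivAt_theta : HasDerivAt theta (-1) 0 := by
  have hc := analyticAt_coshHalf.differentiableAt.hasDerivAt
  -- Differentiating `coshHalf² = 1 + κ²/4` at `0` avoids the derivative of the complex power.
  have h1 : deriv coshHalf 0 = 0 := by
    have h2 := hc.fun_pow 2
    have h3 : HasDerivAt (fun κ : ℂ => 1 + κ ^ 2 / 4) 0 0 := by
      simpa using (((hasDerivAt_id (0 : ℂ)).fun_pow 2).div_const 4).const_add 1
    have h4 := h2.unique (h3.congr_of_eventuallyEq (Eventually.of_forall coshHalf_sq))
    simpa [coshHalf_zero] using h4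
  rw [h1] at hc
  have := (hc.sub ((hasDerivAt_id (0 : ℂ)).div_const 2)).fun_pow 2
  exact this.congr_deriv (by simp [coshHalf_zero])

/-- Write `θ = τ²`. The numbers `τ` and `τ'` are mutually inverse, `Re τ' - Re τ = Re κ > 0`, and
`Re τ' > 0`. Since `Re τ = |τ|² Re τ'`, this forces `|τ| < 1`. -/
lemma eventually_norm_theta_lt_one : ∀ᶠ κ in thresholdFilter, ‖theta κ‖ < 1 := by
  have h1 : ∀ᶠ κ in thresholdFilter, 0 < (coshHalf κ).re := by
    refine thresholdFilter_le ?_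
    have : ContinuousAt (fun κ => (coshHalf κ).re) 0 :=
      Complex.continuous_re.continuousAt.comp analyticAt_coshHalf.continuousAt
    exact this.eventually (lt_mem_nhds (by simp [coshHalf_zero]))
  filter_upwards [h1, self_mem_nhdsWithin] with κ hs hκ
  have hκ : 0 < κ.re := hκ
  set τ := coshHalf κ - κ / 2 with hτ
  set τ' := coshHalf κ + κ / 2 with hτ'
  have hmul : τ * τ' = 1 := by
    rw [hτ, hτ']; linear_combination coshHalf_sq κ
  have hn : ‖τ‖ * ‖τ'‖ = 1 := by rw [← norm_mul, hmul, norm_one]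
  -- `τ' = conj τ / |τ|²`, so `Re τ` and `Re τ'` have the same sign
  have hre : τ'.re * ‖τ‖ ^ 2 = τ.re := by
    have h5 : τ' * (‖τ‖ ^ 2 : ℝ) = conj τ := by
      have := Complex.mul_conj' τ
      push_cast
      rw [← this]; linear_combination conj τ * hmul
    have := congrArg Complex.re h5
    rwa [Complex.re_mul_ofReal, Complex.conj_re] at this
  have e1 : τ.re + τ'.re = 2 * (coshHalf κ).re := by simp [hτ, hτ']; ring
  have e2 : τ'.re - τ.re = κ.re := by simp [hτ, hτ']
  have hp : 0 < τ'.re := by linarith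
  have hlt : ‖τ‖ ^ 2 < 1 := by
    by_contra hcon
    push Not at hcon
    nlinarith
  rw [theta, norm_pow]
  exact hlt

lemma hasExpansion_theta_sub_one (n : ℕ) :
    HasExpansion thresholdFilter n (fun κ => theta κ - 1) :=
  HasExpansion.of_analyticAt thresholdFilter_le (analyticAt_theta.sub analyticAt_const)

lemma theta_sub_one_isBigO : (fun κ => theta κ - 1) =O[thresholdFilter] (fun κ => κ) := by
  have := hasDerivAt_theta.isBigO_sub
  simp only [theta_zero, sub_zero] at this
  exact this.mono thresholdFilter_le

/-- Taylor's formula for `θ ↦ θ^p` at `1`, on the unit disk. -/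
lemma norm_pow_sub_binomial_sum_le {θ : ℂ} (hθ : ‖θ‖ ≤ 1) (j p : ℕ) :
    ‖θ ^ p - ∑ i ∈ Finset.range j, (p.choose i : ℂ) * (θ - 1) ^ i‖ ≤
      p.choose j * ‖θ - 1‖ ^ j := by
  induction p with
  | zero =>
    cases j with
    | zero => simp
    | succ j => simp [Finset.sum_range_succ']
  | succ p ih =>
    cases j with
    | zero => simpa using pow_le_one₀ (norm_nonneg θ) hθ
    | succ j =>
      -- Pascal's rule turns the remainder for `p + 1` into `θ` times the remainder for `p` plus one
      -- binomial term. Because `|θ| ≤ 1`, the two bounds add up to the next binomial coefficient.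
      have e : θ ^ (p + 1) - ∑ i ∈ Finset.range (j + 1), ((p + 1).choose i : ℂ) * (θ - 1) ^ i =
          θ * (θ ^ p - ∑ i ∈ Finset.range (j + 1), (p.choose i : ℂ) * (θ - 1) ^ i) +
            p.choose j * (θ - 1) ^ (j + 1) := by
        have h1 : ∑ i ∈ Finset.range (j + 1), ((p + 1).choose i : ℂ) * (θ - 1) ^ i =
            ∑ i ∈ Finset.range (j + 1), (p.choose i : ℂ) * (θ - 1) ^ i +
              (θ - 1) * ∑ i ∈ Finset.range j, (p.choose i : ℂ) * (θ - 1) ^ i := by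
          rw [Finset.sum_range_succ', Finset.sum_range_succ' (n := j), Finset.mul_sum]
          simp only [Nat.choose_succ_succ, Nat.cast_add, add_mul, Finset.sum_add_distrib,
            Nat.choose_zero_right]
          have : ∀ i, (θ - 1) * ((p.choose i : ℂ) * (θ - 1) ^ i) = p.choose i * (θ - 1) ^ (i + 1) :=
            fun i => by ring
          simp only [this]
          ring
        rw [h1, Finset.sum_range_succ]
        ring
      rw [e]
      calc _ ≤ ‖θ‖ * _ + _ := (norm_add_le _ _).trans (by rw [norm_mul])
        _ ≤ 1 * (p.choose (j + 1) * ‖θ - 1‖ ^ (j + 1)) + p.choose j * ‖θ - 1‖ ^ (j + 1) := by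
            gcongr
            rw [norm_mul, norm_pow, Complex.norm_natCast]
        _ = _ := by rw [Nat.choose_succ_succ]; push_cast; ring

/-! ### The Green function of the discrete half-line -/

/-- `θ^d + θ^(d+2) + ⋯`, with `j` terms. -/
def stepTwoSum (θ : ℂ) (d j : ℕ) : ℂ := ∑ k ∈ Finset.range j, θ ^ (d + 2 * k)

lemma stepTwoSum_succ (θ : ℂ) (d j : ℕ) :
    stepTwoSum θ d (j + 1) = stepTwoSum θ d j + θ ^ (d + 2 * j) := Finset.sum_range_succ _ _

lemma stepTwoSum_succ' (θ : ℂ) (d j : ℕ) :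
    stepTwoSum θ d (j + 1) = θ ^ d + stepTwoSum θ (d + 2) j := by
  rw [stepTwoSum, Finset.sum_range_succ', stepTwoSum, add_comm]
  congr 1
  exact Finset.sum_congr rfl fun k _ => by ring

lemma stepTwoSum_quadratic {θ z : ℂ} (h : θ ^ 2 + 1 = z * θ) (d j : ℕ) :
    z * stepTwoSum θ (d + 1) j = stepTwoSum θ d j + stepTwoSum θ (d + 2) j := by
  simp only [stepTwoSum, Finset.mul_sum, ← Finset.sum_add_distrib]
  refine Finset.sum_congr rfl fun k _ => ?_
  linear_combination (-θ ^ (d + 2 * k)) * h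

/-- The Green function of the half-line with Dirichlet condition, at the vertices `n + 1`
and `m + 1`. -/
def rayGreen (θ : ℂ) (n m : ℕ) : ℂ := stepTwoSum θ (max n m - min n m + 1) (min n m + 1)

lemma rayGreen_add_left (θ : ℂ) (d n : ℕ) : rayGreen θ n (n + d) = stepTwoSum θ (d + 1) (n + 1) := by
  simp [rayGreen]

lemma rayGreen_add_right (θ : ℂ) (d m : ℕ) : rayGreen θ (m + d) m = stepTwoSum θ (d + 1) (m + 1) := by
  simp [rayGreen]

lemma rayGreen_zero_eq {θ z : ℂ} (h : θ ^ 2 + 1 = z * θ) (m : ℕ) :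
    z * rayGreen θ 0 m - rayGreen θ 1 m = if m = 0 then 1 else 0 := by
  rcases m with _ | d
  · have e := stepTwoSum_quadratic h 0 1
    have h1 := rayGreen_add_right θ 0 0
    have h2 := rayGreen_add_right θ 1 0
    rw [show rayGreen θ 0 0 = stepTwoSum θ 1 1 from h1, show rayGreen θ 1 0 = stepTwoSum θ 2 1 from h2,
      e]
    simp [stepTwoSum]
  · have e := stepTwoSum_quadratic h (d + 1) 1
    have h1 := rayGreen_add_left θ (d + 1) 0
    have h2 := rayGreen_add_left θ d 1
    rw [zero_add] at h1
    rw [add_comm 1 d] at h2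
    rw [h1, h2, e]
    simp [stepTwoSum, Finset.sum_range_succ]

lemma rayGreen_succ_eq {θ z : ℂ} (h : θ ^ 2 + 1 = z * θ) (n m : ℕ) :
    z * rayGreen θ (n + 1) m - rayGreen θ (n + 2) m - rayGreen θ n m =
      if m = n + 1 then 1 else 0 := by
  rcases lt_trichotomy m (n + 1) with hm | rfl | hm
  · obtain ⟨d, rfl⟩ := Nat.exists_eq_add_of_le (Nat.lt_succ_iff.1 hm)
    rw [if_neg (by omega), add_assoc, add_assoc, rayGreen_add_right, rayGreen_add_right,
      rayGreen_add_right, stepTwoSum_quadratic h (d + 1)]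
    ring
  · have h1 := rayGreen_add_right θ 0 (n + 1)
    have h2 := rayGreen_add_right θ 1 (n + 1)
    have h3 := rayGreen_add_left θ 1 n
    rw [add_zero] at h1
    -- On the diagonal the source term is the leftover `θ^0`, the first term of the sum starting at
    -- exponent `0`.
    rw [h1, h2, h3, stepTwoSum_quadratic h 0, stepTwoSum_succ' θ 0 (n + 1)]
    simp
  · obtain ⟨d, rfl⟩ := Nat.exists_eq_add_of_lt hm
    rw [if_neg (by omega)]
    have h1 := rayGreen_add_left θ (d + 1) (n + 1)
    have h2 := rayGreen_add_left θ d (n + 2)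
    have h3 := rayGreen_add_left θ (d + 2) n
    rw [show n + 1 + d + 1 = n + 1 + (d + 1) by ring, h1,
      show n + 1 + (d + 1) = n + 2 + d by ring, h2,
      show n + 2 + d = n + (d + 2) by ring, h3, stepTwoSum_quadratic h (d + 1)]
    -- Here the three values are sums with `n + 1`, `n + 2` and `n + 3` terms; the two surplus
    -- powers of `θ` have the same exponent and cancel.
    linear_combination stepTwoSum_succ θ (d + 3) (n + 1) - stepTwoSum_succ θ (d + 1) (n + 2)

lemma rayGreen_one (n m : ℕ) : rayGreen 1 n m = (min n m : ℕ) + 1 := by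
  simp [rayGreen, stepTwoSum]

/-- As `θ'(0) = -1`, the derivative is minus the sum of the exponents, an arithmetic progression.
Its value is a product of the two coordinates, so the first-order coefficient has rank one on each
half-line. -/
lemma hasDerivAt_rayGreen_theta (n m : ℕ) :
    HasDerivAt (fun κ => rayGreen (theta κ) n m) (-((n + 1 : ℂ) * (m + 1))) 0 := by
  have h : HasDerivAt (fun κ => rayGreen (theta κ) n m) (∑ k ∈ Finset.range (min n m + 1),
      -((max n m - min n m + 1 + 2 * k : ℕ) : ℂ)) 0 := by
    simp only [rayGreen, stepTwoSum]
    refine HasDerivAt.fun_sum (A := fun k κ => theta κ ^ (max n m - min n m + 1 + 2 * k))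
      fun k _ => ?_
    exact (hasDerivAt_theta.fun_pow (max n m - min n m + 1 + 2 * k)).congr_deriv
      (by rw [theta_zero]; simp)
  refine h.congr_deriv ?_
  have aux : ∀ d p : ℕ, ∑ k ∈ Finset.range (p + 1), -((d + 1 + 2 * k : ℕ) : ℂ) =
      -((p + 1 : ℂ) * (p + d + 1)) := by
    intro d p
    induction p with
    | zero => simp
    | succ p ih => rw [Finset.sum_range_succ, ih]; push_cast; ring
  rw [aux]
  rcases le_total n m with hnm | hnm
  · obtain ⟨d, rfl⟩ := Nat.exists_eq_add_of_le hnm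
    simp
  · obtain ⟨d, rfl⟩ := Nat.exists_eq_add_of_le hnm
    simp
    ring

/-- The coefficients of the expansion of `rayGreen` in powers of `θ - 1`. -/
def rayGreenCoeff (i n m : ℕ) : ℕ :=
  ∑ k ∈ Finset.range (min n m + 1), (max n m - min n m + 1 + 2 * k).choose i

/-- There are `min + 1` terms, each with exponent at most `2 (max + 1)`. Since `j ≥ 1`, the number
of terms is at most `(min + 1)^j`, and the powers of minimum and maximum combine into a product in
`n` and `m`. -/
lemma rayGreenCoeff_le {i j : ℕ} (hij : i ≤ j) (hj : 1 ≤ j) (n m : ℕ) :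
    rayGreenCoeff i n m ≤ 2 ^ j * ((n + 1) ^ j * (m + 1) ^ j) := by
  have h1 : rayGreenCoeff i n m ≤ (min n m + 1) * (2 * (max n m + 1)) ^ j := by
    rw [rayGreenCoeff, ← smul_eq_mul, ← Finset.card_range (min n m + 1), Finset.card_range]
    conv_rhs => rw [← Finset.card_range (min n m + 1)]
    refine Finset.sum_le_card_nsmul _ _ _ fun k hk => ?_
    have hk := Finset.mem_range.1 hk
    refine (Nat.choose_le_pow _ _).trans ?_
    calc _ ≤ (2 * (max n m + 1)) ^ i := Nat.pow_le_pow_left (by omega) i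
      _ ≤ _ := Nat.pow_le_pow_right (by omega) hij
  refine h1.trans ?_
  rw [mul_pow, mul_left_comm]
  refine Nat.mul_le_mul_left _ ?_
  have h2 : min n m + 1 ≤ (min n m + 1) ^ j := Nat.le_self_pow (by omega) _
  refine (Nat.mul_le_mul_right _ h2).trans_eq ?_
  rcases le_total n m with hnm | hnm
  · simp [hnm]
  · simp [hnm, mul_comm]

lemma norm_rayGreen_sub_le {θ : ℂ} (hθ : ‖θ‖ ≤ 1) (j n m : ℕ) :
    ‖rayGreen θ n m - ∑ i ∈ Finset.range j, (θ - 1) ^ i * (rayGreenCoeff i n m : ℂ)‖ ≤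
      rayGreenCoeff j n m * ‖θ - 1‖ ^ j := by
  have e : rayGreen θ n m - ∑ i ∈ Finset.range j, (θ - 1) ^ i * (rayGreenCoeff i n m : ℂ) =
      ∑ k ∈ Finset.range (min n m + 1), (θ ^ (max n m - min n m + 1 + 2 * k) -
        ∑ i ∈ Finset.range j, ((max n m - min n m + 1 + 2 * k).choose i : ℂ) * (θ - 1) ^ i) := by
    rw [Finset.sum_sub_distrib, Finset.sum_comm]
    congr 1
    refine Finset.sum_congr rfl fun i _ => ?_
    rw [rayGreenCoeff, Nat.cast_sum, Finset.mul_sum]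
    exact Finset.sum_congr rfl fun k _ => mul_comm _ _
  rw [e, rayGreenCoeff, Nat.cast_sum, Finset.sum_mul]
  exact norm_sum_le_of_le _ fun k _ => norm_pow_sub_binomial_sum_le hθ j _

/-- Beyond the source point `m` the Green function is a geometric sequence in `n`. -/
lemma summable_norm_rayGreen_sq {θ : ℂ} (hθ : ‖θ‖ < 1) (m : ℕ) :
    Summable fun n => ‖rayGreen θ n m‖ ^ 2 := by
  rw [← summable_nat_add_iff m]
  have h : ∀ n, rayGreen θ (n + m) m = θ ^ n * stepTwoSum θ 1 (m + 1) := by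
    intro n
    rw [add_comm, rayGreen_add_right, stepTwoSum, stepTwoSum, Finset.mul_sum]
    exact Finset.sum_congr rfl fun k _ => by ring
  simp only [h, norm_mul, norm_pow, mul_pow]
  refine Summable.mul_right _ ?_
  simp only [← pow_mul, mul_comm _ 2]
  simp only [pow_mul]
  exact summable_geometric_of_lt_one (by positivity) (pow_lt_one₀ (norm_nonneg _) hθ two_ne_zero)

end RayGraph

namespace RayGraph

variable {K : Type*} {N : ℕ}

/-! ### Operators on the weighted spaces -/

lemma wt_mono {s t : ℝ} (h : t ≤ s) (x : Vtx K N) : wt t x ≤ wt s x := by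
  rcases x with x | ⟨α, n⟩
  · simp [wt]
  · exact Real.rpow_le_rpow_of_exponent_le (by nlinarith [sq_nonneg ((n : ℝ) + 1)]) (by linarith)

lemma wt_add (s t : ℝ) (x : Vtx K N) : wt (s + t) x = wt s x * wt t x := by
  rcases x with x | ⟨α, n⟩
  · simp [wt]
  · simp only [wt]
    rw [← Real.rpow_add (by positivity), add_div]

lemma wt_neg (s : ℝ) (x : Vtx K N) : wt (-s) x = (wt s x)⁻¹ :=
  eq_inv_of_mul_eq_one_left (wt_neg_mul s x)

lemma wt_inl (s : ℝ) (x : K) : wt (K := K) (N := N) s (.inl x) = 1 := rfl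

lemma pow_le_wt {s : ℝ} {j : ℕ} (h : (j : ℝ) ≤ s) (α : Fin N) (n : ℕ) :
    ((n : ℝ) + 1) ^ j ≤ wt (K := K) s (.inr (α, n)) := by
  have h0 : (0 : ℝ) ≤ (n : ℝ) + 1 := by positivity
  calc ((n : ℝ) + 1) ^ j = (((n : ℝ) + 1) ^ 2) ^ ((j : ℝ) / 2) := by
        rw [← Real.rpow_natCast ((n : ℝ) + 1) 2, ← Real.rpow_mul h0, ← Real.rpow_natCast]
        congr 1
        push_cast
        ring
    _ ≤ (1 + ((n : ℝ) + 1) ^ 2) ^ ((j : ℝ) / 2) :=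
        Real.rpow_le_rpow (by positivity) (by linarith) (by positivity)
    _ ≤ _ := wt_mono (K := K) (N := N) h (.inr (α, n))

lemma wt_le_of_le (s : ℝ) (hs : 0 ≤ s) (α : Fin N) {n m : ℕ} (h : n ≤ m) :
    wt (K := K) s (.inr (α, n)) ≤ wt (K := K) s (.inr (α, m)) := by
  simp only [wt]
  have : (n : ℝ) ≤ m := by exact_mod_cast h
  exact Real.rpow_le_rpow (by positivity) (by gcongr) (by positivity)

namespace WL

variable {p : ℝ≥0∞} {s : ℝ}

/-- The element of the weighted space with the given values. -/
def mk (f : Vtx K N → ℂ) (h : f ∈ wlp K N p s) : WL K N p s := ⟨f, h⟩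

@[simp] lemma mk_apply (f : Vtx K N → ℂ) (h : f ∈ wlp K N p s) (x : Vtx K N) : mk f h x = f x := rfl

lemma mem_wlp (u : WL K N p s) : toFun u ∈ wlp K N p s := u.2

@[ext] lemma ext {u v : WL K N p s} (h : ∀ x, u x = v x) : u = v := Subtype.ext (funext h)

@[simp] lemma sub_apply (u v : WL K N p s) (x : Vtx K N) : (u - v) x = u x - v x := rfl

@[simp] lemma neg_apply (u : WL K N p s) (x : Vtx K N) : (-u) x = -u x := rfl

lemma sum_apply {ι : Type*} (F : Finset ι) (u : ι → WL K N p s) (x : Vtx K N) :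
    (∑ i ∈ F, u i) x = ∑ i ∈ F, u i x := by
  rw [map_sum, Finset.sum_apply]

variable [Fact (1 ≤ p)]

/-- Multiplication by the weight is an isometric isomorphism onto `ℓ^p`. -/
noncomputable def toLpIso : WL K N p s ≃ₗᵢ[ℂ] lp (fun _ : Vtx K N => ℂ) p :=
  LinearIsometryEquiv.ofSurjective ⟨toLp, fun _ => rfl⟩ (by
    intro f
    have e : ∀ x, (wt s x : ℂ) * ((wt s x : ℂ)⁻¹ * f x) = f x := fun x =>
      mul_inv_cancel_left₀ (by exact_mod_cast (wt_pos s x).ne') _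
    refine ⟨mk (fun x => (wt s x : ℂ)⁻¹ * f x) ?_, ?_⟩
    · change Memℓp _ p
      simp only [e]
      exact lp.memℓp f
    · apply lp.ext
      funext x
      exact e x)

instance : CompleteSpace (WL K N p s) :=
  ((toLpIso (K := K) (N := N) (p := p) (s := s)).isometry.isUniformInducing.completeSpace_congr
    toLpIso.surjective).2 inferInstance

/-- Evaluation at a vertex. -/
noncomputable def eval (p : ℝ≥0∞) [Fact (1 ≤ p)] (s : ℝ) (x : Vtx K N) : WL K N p s →L[ℂ] ℂ :=
  LinearMap.mkContinuous ((LinearMap.proj x).comp toFun) (wt s x)⁻¹ (by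
    intro u
    have h := lp.norm_apply_le_norm (zero_lt_one.trans_le (Fact.out : 1 ≤ p)).ne' (toLp u) x
    rw [toLp_apply, norm_mul, Complex.norm_real, Real.norm_of_nonneg (wt_pos s x).le] at h
    rw [inv_mul_eq_div, le_div_iff₀ (wt_pos s x), mul_comm]
    exact h)

@[simp] lemma eval_apply (x : Vtx K N) (u : WL K N p s) : eval p s x u = u x := rfl

end WL

/-! ### Unit vectors in `𝓛^s` -/

open scoped Classical in
/-- The indicator function of a vertex, as an element of `𝓛^s`. -/
noncomputable def delta (s : ℝ) (y : Vtx K N) : Ls K N s :=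
  WL.mk (Pi.single y 1) (by
    have e : (fun x : Vtx K N => (wt s x : ℂ) * (Pi.single y 1 : Vtx K N → ℂ) x) =
        lp.single 1 y (wt s y : ℂ) := by
      funext x
      rw [lp.coeFn_single]
      rcases eq_or_ne x y with rfl | h
      · simp
      · simp [h]
    change Memℓp _ 1
    rw [e]
    exact lp.memℓp _)

open scoped Classical in
lemma delta_apply (s : ℝ) (y x : Vtx K N) : delta s y x = if x = y then 1 else 0 := by
  simp [delta, Pi.single_apply]

open scoped Classical in
lemma toLp_smul_delta {s : ℝ} (u : Ls K N s) (y : Vtx K N) :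
    WL.toLp (u y • delta s y) = lp.single 1 y (WL.toLp u y) := by
  apply lp.ext
  funext x
  rw [WL.toLp_apply, lp.coeFn_single, WL.smul_apply, delta_apply]
  rcases eq_or_ne x y with rfl | h
  · simp [WL.toLp_apply]
  · simp [h]

lemma norm_delta (s : ℝ) (y : Vtx K N) : ‖delta s y‖ = wt s y := by
  classical
  have h := toLp_smul_delta (delta s y) y
  rw [WL.norm_def, ← one_smul ℂ (delta s y)]
  rw [WL.toLp_apply, delta_apply, if_pos rfl, one_smul, mul_one] at h
  rw [one_smul, h, lp.norm_single (by norm_num), Complex.norm_real,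
    Real.norm_of_nonneg (wt_pos s y).le]

lemma hasSum_smul_delta {s : ℝ} (u : Ls K N s) : HasSum (fun y => u y • delta s y) u := by
  classical
  have h := lp.hasSum_single (p := 1) (by simp) (WL.toLp u)
  have h2 := h.mapL (WL.toLpIso (K := K) (N := N) (p := 1) (s := s)).symm.toContinuousLinearEquiv.toContinuousLinearMap
  convert h2 using 1
  · funext y
    rw [← toLp_smul_delta]
    exact ((WL.toLpIso).symm_apply_apply _).symm
  · exact ((WL.toLpIso).symm_apply_apply _).symm

lemma hasSum_wt_mul_norm {s : ℝ} (u : Ls K N s) : HasSum (fun y => wt s y * ‖u y‖) ‖u‖ := by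
  have h := hasSum_norm_toLp u
  simpa only [WL.toLp_apply, norm_mul, Complex.norm_real, Real.norm_of_nonneg (wt_pos s _).le]
    using h

/-! ### Operators given by their values on unit vectors, and kernels -/

section Operators

variable {E : Type*} [NormedAddCommGroup E] [NormedSpace ℂ E] {s : ℝ}

lemma Ls.hom_ext {S T : Ls K N s →L[ℂ] E} (h : ∀ y, S (delta s y) = T (delta s y)) : S = T := by
  ext u
  have h1 := (hasSum_smul_delta u).mapL S
  have h2 := (hasSum_smul_delta u).mapL T
  simp only [map_smul, h] at h1 h2
  exact h1.unique h2

/-- In a weighted `ℓ¹` space the unit vectors span with coefficients whose weighted moduli sum to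
the norm, so an operator norm is controlled by the values on unit vectors alone. -/
lemma Ls.opNorm_le {T : Ls K N s →L[ℂ] E} {C : ℝ} (hC : 0 ≤ C)
    (h : ∀ y, ‖T (delta s y)‖ ≤ C * wt s y) : ‖T‖ ≤ C := by
  refine T.opNorm_le_bound hC fun u => ?_
  have h1 := (hasSum_smul_delta u).mapL T
  rw [← h1.tsum_eq]
  refine tsum_of_norm_bounded ((hasSum_wt_mul_norm u).mul_left C) fun y => ?_
  rw [map_smul, norm_smul]
  nlinarith [h y, norm_nonneg (u y)]

/-- The operator on `𝓛^s` with prescribed values on the unit vectors. -/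
noncomputable def Ls.lift [CompleteSpace E] (b : Vtx K N → E) (C : ℝ)
    (hb : ∀ y, ‖b y‖ ≤ C * wt s y) : Ls K N s →L[ℂ] E :=
  have hle : ∀ (u : Ls K N s) (y : Vtx K N), ‖u y • b y‖ ≤ C * (wt s y * ‖u y‖) := fun u y => by
    rw [norm_smul]
    nlinarith [hb y, norm_nonneg (u y)]
  have hs : ∀ u : Ls K N s, Summable fun y => u y • b y := fun u =>
    Summable.of_norm_bounded ((hasSum_wt_mul_norm u).summable.mul_left C) (hle u)
  LinearMap.mkContinuous
    { toFun := fun u => ∑' y, u y • b y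
      map_add' := fun u v => by
        simp only [WL.add_apply, add_smul]
        exact (hs u).tsum_add (hs v)
      map_smul' := fun c u => by
        simp only [WL.smul_apply, mul_smul, RingHom.id_apply]
        exact (hs u).tsum_const_smul c } C
    (fun u => tsum_of_norm_bounded ((hasSum_wt_mul_norm u).mul_left C) (hle u))

lemma Ls.lift_delta [CompleteSpace E] (b : Vtx K N → E) (C : ℝ)
    (hb : ∀ y, ‖b y‖ ≤ C * wt s y) (y : Vtx K N) : Ls.lift b C hb (delta s y) = b y := by
  classical
  change ∑' x, delta s y x • b x = b y
  rw [tsum_eq_single y]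
  · simp [delta_apply]
  · intro x hx
    simp [delta_apply, hx]

end Operators

lemma memℓp_infty_of_le {p : Vtx K N → ℂ} {s C : ℝ} (h : ∀ x, ‖p x‖ ≤ C * wt s x) :
    p ∈ wlp K N ∞ (-s) := by
  refine memℓp_infty ⟨C, ?_⟩
  rintro _ ⟨x, rfl⟩
  change ‖(wt (-s) x : ℂ) * p x‖ ≤ C
  rw [norm_mul, Complex.norm_real, Real.norm_of_nonneg (wt_pos _ x).le, wt_neg,
    inv_mul_le_iff₀ (wt_pos s x), mul_comm]
  exact h x

lemma LsDual.norm_le {s C : ℝ} (hC : 0 ≤ C) {u : LsDual K N s} (h : ∀ x, ‖u x‖ ≤ C * wt s x) :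
    ‖u‖ ≤ C := by
  rw [WL.norm_def]
  refine lp.norm_le_of_forall_le hC fun x => ?_
  rw [WL.toLp_apply, norm_mul, Complex.norm_real, Real.norm_of_nonneg (wt_pos _ x).le, wt_neg,
    inv_mul_le_iff₀ (wt_pos s x), mul_comm]
  exact h x

lemma LsDual.norm_apply_le {s : ℝ} (u : LsDual K N s) (x : Vtx K N) : ‖u x‖ ≤ ‖u‖ * wt s x := by
  have h := lp.norm_apply_le_norm (by simp) (WL.toLp u) x
  rwa [WL.toLp_apply, norm_mul, Complex.norm_real, Real.norm_of_nonneg (wt_pos _ x).le, wt_neg,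
    inv_mul_le_iff₀ (wt_pos s x), mul_comm] at h

/-- An element of `𝓑^s` is determined by its matrix elements. -/
lemma Bs.ext_delta {s : ℝ} {S T : Bs K N s} (h : ∀ y x, S (delta s y) x = T (delta s y) x) :
    S = T :=
  Ls.hom_ext fun y => WL.ext (h y)

/-- From `ℓ¹` to `ℓ^∞` the operator norm is a weighted supremum of matrix elements. Entrywise bounds
on kernels thus become estimates in `𝓑^s`. -/
lemma Bs.opNorm_le {s C : ℝ} (hC : 0 ≤ C) {T : Bs K N s}
    (h : ∀ y x, ‖T (delta s y) x‖ ≤ C * (wt s y * wt s x)) : ‖T‖ ≤ C :=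
  Ls.opNorm_le hC fun y => LsDual.norm_le (mul_nonneg hC (wt_pos s y).le) fun x => by
    rw [mul_assoc]; exact h y x

/-- Existence of the operator in `𝓑^s` with a prescribed kernel. -/
lemma Bs.exists_kernel {s C : ℝ} (hC : 0 ≤ C) (g : Vtx K N → Vtx K N → ℂ)
    (h : ∀ y x, ‖g y x‖ ≤ C * (wt s y * wt s x)) :
    ∃ T : Bs K N s, ∀ y x, T (delta s y) x = g y x := by
  have h' : ∀ y x, ‖g y x‖ ≤ C * wt s y * wt s x := fun y x => by rw [mul_assoc]; exact h y x
  refine ⟨Ls.lift (fun y => WL.mk (g y) (memℓp_infty_of_le (h' y))) C fun y => ?_, fun y x => ?_⟩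
  · exact LsDual.norm_le (mul_nonneg hC (wt_pos s y).le) (h' y)
  · rw [Ls.lift_delta]
    rfl

/-! ### Inclusions -/

/-- The inclusion `𝓛^s ⊂ 𝓛^t` for `t ≤ s`. -/
noncomputable def Ls.incl {s t : ℝ} (h : t ≤ s) : Ls K N s →L[ℂ] Ls K N t :=
  Ls.lift (delta t) 1 fun y => by rw [norm_delta, one_mul]; exact wt_mono h y

@[simp] lemma Ls.incl_delta {s t : ℝ} (h : t ≤ s) (y : Vtx K N) :
    Ls.incl h (delta s y) = delta t y := Ls.lift_delta _ _ _ y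

@[simp] lemma Ls.incl_apply {s t : ℝ} (h : t ≤ s) (u : Ls K N s) (x : Vtx K N) :
    Ls.incl h u x = u x := by
  classical
  have e : (WL.eval 1 t x).comp (Ls.incl h) = WL.eval 1 s x := by
    refine Ls.hom_ext fun y => ?_
    simp [delta_apply]
  exact congrArg (fun T => T u) e

/-- The inclusion `(𝓛^t)^* ⊂ (𝓛^s)^*` for `t ≤ s`. -/
noncomputable def LsDual.incl {s t : ℝ} (h : t ≤ s) : LsDual K N t →L[ℂ] LsDual K N s :=
  have hle : ∀ (u : LsDual K N t) (x : Vtx K N), ‖u x‖ ≤ ‖u‖ * wt s x := fun u x =>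
    (LsDual.norm_apply_le u x).trans (mul_le_mul_of_nonneg_left (wt_mono h x) (norm_nonneg u))
  LinearMap.mkContinuous
    { toFun := fun u => WL.mk (WL.toFun u) (memℓp_infty_of_le (hle u))
      map_add' := fun u v => rfl
      map_smul' := fun c u => rfl } 1
    (fun u => by
      rw [one_mul]
      exact LsDual.norm_le (norm_nonneg u) (hle u))

@[simp] lemma LsDual.incl_apply {s t : ℝ} (h : t ≤ s) (u : LsDual K N t) (x : Vtx K N) :
    LsDual.incl h u x = u x := rfl

lemma LsDual.toFun_incl {s t : ℝ} (h : t ≤ s) (u : LsDual K N t) :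
    WL.toFun (LsDual.incl h u) = WL.toFun u := funext fun x => LsDual.incl_apply h u x

lemma Ls.toFun_incl {s t : ℝ} (h : t ≤ s) (u : Ls K N s) :
    WL.toFun (Ls.incl h u) = WL.toFun u := funext fun x => Ls.incl_apply h u x

/-- The inclusion `𝓑^t ⊂ 𝓑^s` for `t ≤ s`. -/
noncomputable def Bs.incl {s t : ℝ} (h : t ≤ s) (T : Bs K N t) : Bs K N s :=
  (LsDual.incl h).comp (T.comp (Ls.incl h))

lemma Bs.incl_apply {s t : ℝ} (h : t ≤ s) (T : Bs K N t) (u : Ls K N s) (x : Vtx K N) :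
    Bs.incl h T u x = T (Ls.incl h u) x := rfl

lemma Bs.toFun_incl {s t : ℝ} (h : t ≤ s) (T : Bs K N t) (u : Ls K N s) :
    WL.toFun (Bs.incl h T u) = WL.toFun (T (Ls.incl h u)) := LsDual.toFun_incl h _

lemma Bs.incl_delta {s t : ℝ} (h : t ≤ s) (T : Bs K N t) (y x : Vtx K N) :
    Bs.incl h T (delta s y) x = T (delta t y) x := by
  rw [Bs.incl_apply, Ls.incl_delta]

/-- Norm convergence in `𝓑^s` implies convergence of the matrix elements. -/
lemma Bs.tendsto_entry {s : ℝ} {ι : Type*} {l : Filter ι} {T : ι → Bs K N s} {S : Bs K N s}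
    (h : Tendsto T l (𝓝 S)) (y x : Vtx K N) :
    Tendsto (fun i => T i (delta s y) x) l (𝓝 (S (delta s y) x)) :=
  (((WL.eval ∞ (-s) x).continuous.comp
    (ContinuousLinearMap.apply ℂ (LsDual K N s) (delta s y)).continuous).tendsto S).comp h

lemma isCompactOperator_rankOne {E F : Type*} [NormedAddCommGroup E] [NormedSpace ℂ E]
    [NormedAddCommGroup F] [NormedSpace ℂ F] (f : E →L[ℂ] ℂ) (x : F) :
    IsCompactOperator (f.smulRight x) := by
  have h : IsCompactOperator (f : E → ℂ) := isCompactOperator_of_locallyCompactSpace_dom f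
  exact h.clm_comp ((ContinuousLinearMap.id ℂ ℂ).smulRight x)

/-- The inclusion `𝓛^s ⊂ 𝓛^t` is compact if `t + 1 ≤ s`. -/
lemma Ls.isCompactOperator_incl [Fintype K] {s t : ℝ} (h : t + 1 ≤ s) :
    IsCompactOperator (Ls.incl (K := K) (N := N) (show t ≤ s by linarith)) := by
  classical
  let F : ℕ → Finset (Vtx K N) := fun n =>
    Finset.univ.disjSum (Finset.univ ×ˢ Finset.range n)
  let T : ℕ → Ls K N s →L[ℂ] Ls K N t := fun n =>
    ∑ y ∈ F n, (WL.eval 1 s y).smulRight (delta t y)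
  have hT : ∀ n, IsCompactOperator (T n) := fun n => by
    have : ∀ F : Finset (Vtx K N), IsCompactOperator
        (∑ y ∈ F, (WL.eval 1 s y).smulRight (delta t y) : Ls K N s →L[ℂ] Ls K N t) := by
      intro F
      induction F using Finset.induction_on with
      | empty => simpa using isCompactOperator_zero
      | insert y F hy ih =>
        rw [Finset.sum_insert hy]
        exact (isCompactOperator_rankOne _ _).add ih
    exact this _
  have hTd : ∀ n y, T n (delta s y) = if y ∈ F n then delta t y else 0 := by
    intro n y
    simp only [T, sum_apply, ContinuousLinearMap.smulRight_apply, WL.eval_apply, delta_apply]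
    simp
  -- Finite-rank truncations converge in norm: outside the first `n` vertices of each half-line the
  -- ratio of the weights `t` and `s` is at most `1/(n + 1)`, because `t + 1 ≤ s`.
  have hlim : Tendsto T atTop (𝓝 (Ls.incl (show t ≤ s by linarith))) := by
    rw [tendsto_iff_norm_sub_tendsto_zero]
    refine squeeze_zero (fun _ => norm_nonneg _) (fun n => ?_)
      (tendsto_one_div_add_atTop_nhds_zero_nat (𝕜 := ℝ))
    refine Ls.opNorm_le (by positivity) fun y => ?_
    rw [sub_apply, hTd, Ls.incl_delta]
    split_ifs with hy
    · rw [sub_self, norm_zero]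
      exact mul_nonneg (by positivity) (wt_pos s y).le
    · rw [zero_sub, norm_neg, norm_delta, one_div_mul_eq_div, le_div_iff₀ (by positivity)]
      rcases y with x | ⟨α, m⟩
      · simp [F] at hy
      · have hm : n ≤ m := by simpa [F] using hy
        have hm' : (n : ℝ) ≤ m := by exact_mod_cast hm
        have h1 := pow_le_wt (K := K) (j := 1) (s := 1) (by norm_num) α m
        rw [pow_one] at h1
        calc _ ≤ wt t (.inr (α, m)) * wt 1 (.inr (α, m)) := by
              gcongr
              · exact (wt_pos _ _).le
              · linarith
          _ = wt (t + 1) (.inr (α, m)) := (wt_add _ _ _).symm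
          _ ≤ _ := wt_mono h _
  exact isCompactOperator_of_tendsto hlim (Eventually.of_forall hT)

/-! ### The pairing -/

lemma pairing_delta (Ψ : Vtx K N → ℂ) (s : ℝ) (y : Vtx K N) :
    pairing Ψ (WL.toFun (delta s y)) = conj (Ψ y) := by
  classical
  rw [pairing, tsum_eq_single y]
  · simp [delta_apply]
  · intro x hx
    simp [delta_apply, hx]

lemma norm_pairing_le {s : ℝ} (Ψ : LsDual K N s) (u : Ls K N s) :
    ‖pairing (WL.toFun Ψ) (WL.toFun u)‖ ≤ ‖Ψ‖ * ‖u‖ :=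
  tsum_of_norm_bounded ((hasSum_norm_toLp u).mul_left ‖Ψ‖) (norm_mul_le_of_dual Ψ u)

lemma conj_pairing (u w : Vtx K N → ℂ) : conj (pairing u w) = pairing w u := by
  rw [pairing, Complex.conj_tsum, pairing]
  congr 1
  funext x
  simp [mul_comm]

/-- For `u ∈ 𝓛^s`, the bounded functional `Ψ ↦ ⟨u, Ψ⟩` on `(𝓛^s)^*`. -/
noncomputable def dualPairCLM {s : ℝ} (u : Ls K N s) : LsDual K N s →L[ℂ] ℂ :=
  LinearMap.mkContinuous
    { toFun := fun Ψ => pairing (WL.toFun u) (WL.toFun Ψ)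
      map_add' := fun Ψ Φ => by
        have hs : ∀ Ψ : LsDual K N s, Summable fun x => conj (u x) * Ψ x := fun Ψ => by
          have := ((summable_pairing Ψ u).map (starRingEnd ℂ) Complex.continuous_conj)
          simpa [Function.comp_def, mul_comm] using this
        simp only [pairing, WL.add_apply, mul_add]
        exact (hs Ψ).tsum_add (hs Φ)
      map_smul' := fun c Ψ => by
        simp only [pairing, WL.smul_apply, RingHom.id_apply, smul_eq_mul]
        rw [← tsum_mul_left]
        congr 1
        funext x
        ring } ‖u‖ (fun Ψ => by
      change ‖pairing (WL.toFun u) (WL.toFun Ψ)‖ ≤ _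
      rw [← conj_pairing, RCLike.norm_conj, mul_comm]
      exact norm_pairing_le Ψ u)

lemma dualPairCLM_apply {s : ℝ} (u : Ls K N s) (Ψ : LsDual K N s) :
    dualPairCLM u Ψ = pairing (WL.toFun u) (WL.toFun Ψ) := rfl

section Adjoint

variable {𝒦 : Type*} [NormedAddCommGroup 𝒦] [InnerProductSpace ℂ 𝒦] [CompleteSpace 𝒦]

/-- The adjoint `v^* : (𝓛^s)^* → 𝒦` as a bounded operator. -/
noncomputable def adjL {s : ℝ} (v : 𝒦 →L[ℂ] Ls K N s) : LsDual K N s →L[ℂ] 𝒦 :=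
  (adj v).mkContinuous ‖v‖ fun Ψ => by
    change ‖(InnerProductSpace.toDual ℂ 𝒦).symm ((pairCLM Ψ).comp v)‖ ≤ _
    rw [LinearIsometryEquiv.norm_map]
    refine ContinuousLinearMap.opNorm_le_bound _ (by positivity) fun f => ?_
    refine (norm_pairing_le Ψ (v f)).trans ?_
    calc _ ≤ ‖Ψ‖ * (‖v‖ * ‖f‖) := by gcongr; exact v.le_opNorm f
      _ = _ := by ring

@[simp] lemma adjL_apply {s : ℝ} (v : 𝒦 →L[ℂ] Ls K N s) (Ψ : LsDual K N s) :
    adjL v Ψ = adj v Ψ := rfl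

end Adjoint

/-- A symmetric kernel gives a symmetric operator. -/
lemma Bs.pairing_comm {s : ℝ} {T : Bs K N s}
    (h : ∀ y x, conj (T (delta s y) x) = T (delta s x) y) (u w : Ls K N s) :
    pairing (WL.toFun (T u)) (WL.toFun w) = pairing (WL.toFun u) (WL.toFun (T w)) := by
  -- Density of finite combinations of unit vectors is used in one argument at a time, first in `w`
  -- with `u` a unit vector, then in `u`.
  have step : ∀ (y : Vtx K N) (w : Ls K N s),
      pairing (WL.toFun (T (delta s y))) (WL.toFun w) = T w y := by
    intro y w
    have e : pairCLM (T (delta s y)) = (WL.eval ∞ (-s) y).comp T := by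
      refine Ls.hom_ext fun x => ?_
      rw [pairCLM_apply, pairing_delta, h]
      rfl
    exact congrArg (fun S => S w) e
  have e : pairCLM (T u) = (dualPairCLM u).comp T := by
    refine Ls.hom_ext fun y => ?_
    rw [pairCLM_apply, pairing_delta, ContinuousLinearMap.comp_apply, dualPairCLM_apply,
      ← conj_pairing, step]
  exact congrArg (fun S => S w) e

end RayGraph

namespace RayGraph

variable {K : Type*} {N : ℕ}

/-! ### The operator `h₀` on the finite graph -/

section FiniteGraph

variable [Fintype K] (Γ : SimpleGraph K) (a : Fin N → K)

/-- The operator `h₀` on the finite graph. -/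
noncomputable def coreOp : (K → ℂ) →L[ℂ] (K → ℂ) :=
  LinearMap.toContinuousLinearMap
    { toFun := fun f x => H₀fun Γ a (Sum.elim f 0) (.inl x)
      map_add' := fun f g => by
        have : (Sum.elim (f + g) 0 : Vtx K N → ℂ) = Sum.elim f 0 + Sum.elim g 0 := by
          funext x; rcases x with x | x <;> simp
        simp only [this, map_add]
        rfl
      map_smul' := fun c f => by
        have : (Sum.elim (c • f) 0 : Vtx K N → ℂ) = c • Sum.elim f 0 := by
          funext x; rcases x with x | x <;> simp
        simp only [this, map_smul]
        rfl }

lemma coreOp_apply (u : Vtx K N → ℂ) (x : K) :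
    coreOp Γ a (fun y => u (.inl y)) x = H₀fun Γ a u (.inl x) := rfl

lemma H₀fun_inr_zero (u : Vtx K N → ℂ) (α : Fin N) :
    H₀fun Γ a u (.inr (α, 0)) = 2 * u (.inr (α, 0)) - u (.inr (α, 1)) := rfl

lemma H₀fun_inr_succ (u : Vtx K N → ℂ) (α : Fin N) (n : ℕ) :
    H₀fun Γ a u (.inr (α, n + 1)) =
      2 * u (.inr (α, n + 1)) - u (.inr (α, n + 2)) - u (.inr (α, n)) := rfl

variable {Γ a}

/-- The Dirichlet terms make the Laplacian of a connected graph injective. -/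
lemma coreOp_injective (hΓ : Γ.Connected) (α₀ : Fin N) : Function.Injective (coreOp Γ a) := by
  classical
  rw [injective_iff_map_eq_zero]
  intro f hf
  have hx : ∀ x, (∑ y, if Γ.Adj x y then (f x - f y) else 0) +
      ∑ α : Fin N, (if x = a α then 1 else 0) * f x = 0 := by
    intro x
    have h : coreOp Γ a f x = 0 := congrFun hf x
    refine Eq.trans ?_ h
    change _ = H₀fun Γ a (Sum.elim f 0) (.inl x)
    simp only [H₀fun, LinearMap.coe_mk, AddHom.coe_mk, Sum.elim_inl, Finset.sum_filter]
  have e1 : ∑ x, ∑ y, (if Γ.Adj x y then conj (f x) * (f x - f y) else 0) +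
      ∑ α : Fin N, conj (f (a α)) * f (a α) = 0 := by
    have h2 : ∑ x, conj (f x) * ((∑ y, if Γ.Adj x y then (f x - f y) else 0) +
      ∑ α : Fin N, (if x = a α then 1 else 0) * f x) = 0 :=
      Finset.sum_eq_zero fun x _ => by rw [hx, mul_zero]
    simp only [mul_add, Finset.sum_add_distrib, Finset.mul_sum, mul_ite, mul_zero] at h2
    refine Eq.trans ?_ h2
    congr 1
    rw [Finset.sum_comm]
    refine Finset.sum_congr rfl fun α _ => ?_
    simp
  have e2 : ∑ x, ∑ y, (if Γ.Adj x y then conj (f x) * (f x - f y) else 0) =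
      ∑ x, ∑ y, (if Γ.Adj x y then conj (f y) * (f y - f x) else 0) := by
    rw [Finset.sum_comm]
    simp only [Γ.adj_comm]
  -- Adding `⟨f, h₀ f⟩ = 0` to itself with `x` and `y` exchanged gives a sum of squares: `f` is
  -- constant along edges and vanishes wherever a half-line is attached.
  have e3 : ∑ x, ∑ y, (if Γ.Adj x y then ‖f x - f y‖ ^ 2 else 0) +
      2 * ∑ α : Fin N, ‖f (a α)‖ ^ 2 = 0 := by
    have h3 : ∑ x, ∑ y, (if Γ.Adj x y then conj (f x - f y) * (f x - f y) else 0) +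
        2 * ∑ α : Fin N, conj (f (a α)) * f (a α) = 0 := by
      have h4 : ∑ x, ∑ y, (if Γ.Adj x y then conj (f x - f y) * (f x - f y) else 0) =
          ∑ x, ∑ y, (if Γ.Adj x y then conj (f x) * (f x - f y) else 0) +
            ∑ x, ∑ y, (if Γ.Adj x y then conj (f y) * (f y - f x) else 0) := by
        simp only [← Finset.sum_add_distrib]
        refine Finset.sum_congr rfl fun x _ => Finset.sum_congr rfl fun y _ => ?_
        split_ifs
        · rw [map_sub]; ring
        · simp
      rw [h4, ← e2]
      linear_combination 2 * e1
    simp only [Complex.conj_mul'] at h3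
    apply Complex.ofReal_injective
    rw [Complex.ofReal_zero, ← h3]
    push_cast
    simp only [apply_ite Complex.ofReal, Complex.ofReal_pow, Complex.ofReal_zero]
  have nn1 : ∀ x y, 0 ≤ (if Γ.Adj x y then ‖f x - f y‖ ^ 2 else 0) := fun x y => by
    split_ifs <;> positivity
  have nn2 : 0 ≤ ∑ x, ∑ y, (if Γ.Adj x y then ‖f x - f y‖ ^ 2 else 0) :=
    Finset.sum_nonneg fun x _ => Finset.sum_nonneg fun y _ => nn1 x y
  have nn3 : 0 ≤ ∑ α : Fin N, ‖f (a α)‖ ^ 2 := Finset.sum_nonneg fun _ _ => by positivity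
  have z1 : ∑ x, ∑ y, (if Γ.Adj x y then ‖f x - f y‖ ^ 2 else 0) = 0 := by linarith
  have z2 : ∑ α : Fin N, ‖f (a α)‖ ^ 2 = 0 := by linarith
  have hadj : ∀ x y, Γ.Adj x y → f x = f y := by
    intro x y hxy
    have h5 := (Finset.sum_eq_zero_iff_of_nonneg
      (fun x _ => Finset.sum_nonneg fun y _ => nn1 x y)).1 z1 x (Finset.mem_univ x)
    have h6 := (Finset.sum_eq_zero_iff_of_nonneg (fun y _ => nn1 x y)).1 h5 y (Finset.mem_univ y)
    rw [if_pos hxy] at h6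
    exact sub_eq_zero.1 (norm_eq_zero.1 (pow_eq_zero_iff two_ne_zero |>.1 h6))
  have ha : f (a α₀) = 0 := by
    have h7 := (Finset.sum_eq_zero_iff_of_nonneg (fun _ _ => by positivity)).1 z2 α₀
      (Finset.mem_univ _)
    exact norm_eq_zero.1 (pow_eq_zero_iff two_ne_zero |>.1 h7)
  funext x
  obtain ⟨w⟩ := hΓ.preconnected x (a α₀)
  have hw : ∀ x y (w : Γ.Walk x y), f x = f y := by
    intro x y w
    induction w with
    | nil => rfl
    | cons h _ ih => exact (hadj _ _ h).trans ih
  rw [hw x _ w, ha]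
  rfl

lemma isUnit_coreOp (hΓ : Γ.Connected) (α₀ : Fin N) : IsUnit (coreOp Γ a) := by
  rw [ContinuousLinearMap.isUnit_iff_bijective]
  have h := coreOp_injective (a := a) hΓ α₀
  exact ⟨h, (LinearMap.injective_iff_surjective (f := (coreOp Γ a).toLinearMap)).1 h⟩

end FiniteGraph

/-! ### Shifts along the half-lines -/

/-- The map moving each half-line by one step and fixing the finite graph. -/
def step : Vtx K N → Vtx K N
  | .inl x => .inl x
  | .inr (α, n) => .inr (α, n + 1)

lemma step_injective : Function.Injective (step : Vtx K N → Vtx K N) := by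
  rintro (x | ⟨α, n⟩) (y | ⟨β, m⟩) h <;> simp_all [step]

/-- Composition with the step, as a contraction on `ℓ²`. -/
noncomputable def leftShift : Hsp K N →L[ℂ] Hsp K N :=
  have hs : ∀ u : Hsp K N, Summable fun x => ‖u x‖ ^ 2 := fun u =>
    (memlp_two_iff _).1 (lp.memℓp u)
  LinearMap.mkContinuous
    { toFun := fun u => (⟨fun x => u (step x),
        (memlp_two_iff _).2 ((hs u).comp_injective step_injective)⟩ : Hsp K N)
      map_add' := fun u w => rfl
      map_smul' := fun c u => rfl } 1
    (fun u => by
      rw [one_mul]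
      refine lp.norm_le_of_tsum_le (by norm_num) (norm_nonneg u) ?_
      rw [lp.norm_rpow_eq_tsum (by norm_num)]
      simp only [ENNReal.toReal_ofNat, Real.rpow_two]
      exact tsum_comp_le_tsum_of_inj (hs u) (fun _ => by positivity) step_injective)

/-- The right inverse of `leftShift`, extending by zero. -/
noncomputable def rightShift : Hsp K N →L[ℂ] Hsp K N :=
  have hs : ∀ u : Hsp K N, Summable fun x => ‖u x‖ ^ 2 := fun u =>
    (memlp_two_iff _).1 (lp.memℓp u)
  have hext : ∀ u : Vtx K N → ℂ, ∀ x ∉ Set.range (step : Vtx K N → Vtx K N),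
      ‖Function.extend step u 0 x‖ ^ 2 = 0 := fun u x hx => by
    rw [Function.extend_apply' _ _ _ (by simpa using hx)]; simp
  have hcomp : ∀ u : Vtx K N → ℂ, (fun x => ‖Function.extend step u 0 x‖ ^ 2) ∘ step =
      fun x => ‖u x‖ ^ 2 := fun u => by
    funext x
    simp [step_injective.extend_apply]
  LinearMap.mkContinuous
    { toFun := fun u => (⟨Function.extend step u 0,
        (memlp_two_iff _).2 ((step_injective.summable_iff (hext u)).1
          (by rw [hcomp]; exact hs u))⟩ : Hsp K N)
      map_add' := fun u w => by
        apply lp.ext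
        have h := Function.extend_add step (fun x => u x) (fun x => w x) 0 0
        rwa [add_zero] at h
      map_smul' := fun c u => by
        apply lp.ext
        have h := Function.extend_smul c step (fun x => u x) 0
        rwa [smul_zero] at h } 1
    (fun u => by
      rw [one_mul]
      refine lp.norm_le_of_tsum_le (by norm_num) (norm_nonneg u) ?_
      rw [lp.norm_rpow_eq_tsum (by norm_num)]
      simp only [ENNReal.toReal_ofNat, Real.rpow_two]
      have := step_injective.tsum_eq (f := fun x => ‖Function.extend step (u : Vtx K N → ℂ) 0 x‖ ^ 2)
        (fun x hx => by_contra fun h => hx (hext u x h))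
      refine this.symm.trans_le (le_of_eq ?_)
      exact congrArg tsum (hcomp u))

lemma rightShift_step (u : Hsp K N) (x : Vtx K N) : rightShift u (step x) = u x :=
  step_injective.extend_apply _ _ _

lemma rightShift_inl (u : Hsp K N) (x : K) : rightShift u (.inl x) = u (.inl x) :=
  rightShift_step u (.inl x)

lemma rightShift_succ (u : Hsp K N) (α : Fin N) (n : ℕ) :
    rightShift u (.inr (α, n + 1)) = u (.inr (α, n)) :=
  rightShift_step u (.inr (α, n))

lemma rightShift_zero (u : Hsp K N) (α : Fin N) : rightShift u (.inr (α, 0)) = 0 := by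
  refine Function.extend_apply' _ _ _ ?_
  rintro ⟨x | ⟨β, n⟩, h⟩ <;> simp [step] at h

lemma norm_leftShift_le : ‖(leftShift : Hsp K N →L[ℂ] Hsp K N)‖ ≤ 1 := by
  unfold leftShift
  exact LinearMap.mkContinuous_norm_le _ zero_le_one _

lemma norm_rightShift_le : ‖(rightShift : Hsp K N →L[ℂ] Hsp K N)‖ ≤ 1 := by
  unfold rightShift
  exact LinearMap.mkContinuous_norm_le _ zero_le_one _

/-- `(1 - θ L)(1 - θ R)` with the two shifts. -/
noncomputable def shiftProd (θ : ℂ) : Hsp K N →L[ℂ] Hsp K N :=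
  (1 - θ • leftShift) * (1 - θ • rightShift)

/-- Each factor is invertible by a Neumann series, since both shifts are contractions and `|θ| < 1`.
-/
lemma isUnit_shiftProd {θ : ℂ} (hθ : ‖θ‖ < 1) : IsUnit (shiftProd (K := K) (N := N) θ) := by
  have aux : ∀ T : Hsp K N →L[ℂ] Hsp K N, ‖T‖ ≤ 1 → IsUnit (1 - θ • T) := fun T hT =>
    isUnit_one_sub_of_norm_lt_one (by
      rw [norm_smul]
      nlinarith [norm_nonneg θ, norm_nonneg T])
  exact (aux _ norm_leftShift_le).mul (aux _ norm_rightShift_le)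

lemma shiftProd_apply (θ : ℂ) (u : Hsp K N) (x : Vtx K N) :
    shiftProd θ u x = u x + θ ^ 2 * u x - θ * rightShift u x - θ * u (step x) := by
  change (u x - θ * rightShift u x) - θ * (u (step x) - θ * rightShift u (step x)) = _
  rw [rightShift_step]
  ring

/-- The kernel vanishing off the half-lines and given by `g` on each of them. -/
def rayKernel (g : ℕ → ℕ → ℂ) : Vtx K N → Vtx K N → ℂ
  | .inr (α, m), .inr (α', n) => if α' = α then g n m else 0
  | _, _ => 0

lemma rayKernel_inr (g : ℕ → ℕ → ℂ) (α α' : Fin N) (m n : ℕ) :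
    rayKernel (K := K) g (.inr (α, m)) (.inr (α', n)) = if α' = α then g n m else 0 := rfl

lemma norm_rayGreenCoeff_le {i j : ℕ} (hij : i ≤ j) (hj : 1 ≤ j) {s : ℝ} (hs : (j : ℝ) ≤ s)
    (α α' : Fin N) (m n : ℕ) :
    (rayGreenCoeff i n m : ℝ) ≤
      2 ^ j * (wt (K := K) s (.inr (α, m)) * wt (K := K) s (.inr (α', n))) := by
  have h1 : (rayGreenCoeff i n m : ℝ) ≤ 2 ^ j * (((n : ℝ) + 1) ^ j * ((m : ℝ) + 1) ^ j) := by
    exact_mod_cast rayGreenCoeff_le hij hj n m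
  refine h1.trans ?_
  rw [mul_comm (wt _ _)]
  have h2 := pow_le_wt (K := K) hs α m
  have h3 := pow_le_wt (K := K) hs α' n
  have := (wt_pos (K := K) s (.inr (α', n))).le
  gcongr

end RayGraph

namespace RayGraph

variable {K : Type*} {N : ℕ} [Fintype K]

/-! ### The free resolvent -/

section FreeResolvent

variable (Γ : SimpleGraph K) (a : Fin N → K)

/-- `h₀ + κ²` on the finite graph. -/
noncomputable def coreShift (κ : ℂ) : (K → ℂ) →L[ℂ] (K → ℂ) := coreOp Γ a + κ ^ 2 • 1

open scoped Classical in
/-- The kernel of the free resolvent. -/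
noncomputable def freeGreen (κ : ℂ) : Vtx K N → Vtx K N → ℂ
  | .inl b, .inl x => Ring.inverse (coreShift Γ a κ) (Pi.single b 1) x
  | .inr (α, m), .inr (α', n) => if α' = α then rayGreen (theta κ) n m else 0
  | .inl _, .inr _ => 0
  | .inr _, .inl _ => 0

variable {Γ a}

/-- On the half-lines `(1 - θ L)(1 - θ R)` factorizes `θ (H₀ + κ²)`. The zero that the right shift
inserts at the first vertex is exactly the Dirichlet value `u[0] = 0`. -/
lemma shiftProd_theta_inr (κ : ℂ) (u : Hsp K N) (q : Fin N × ℕ) :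
    shiftProd (theta κ) u (.inr q) = theta κ * (H₀fun Γ a u (.inr q) + κ ^ 2 * u (.inr q)) := by
  rw [shiftProd_apply]
  obtain ⟨α, _ | n⟩ := q
  · rw [rightShift_zero, H₀fun_inr_zero, step]
    linear_combination u (.inr (α, 0)) * theta_quadratic κ
  · rw [rightShift_succ, H₀fun_inr_succ, step]
    linear_combination u (.inr (α, n + 1)) * theta_quadratic κ

lemma memlp_core (w : K → ℂ) : Memℓp (Sum.elim w 0 : Vtx K N → ℂ) 2 := by
  rw [memlp_two_iff]
  refine (Sum.inl_injective.summable_iff ?_).1 (Summable.of_finite)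
  rintro (x | q) hx
  · exact absurd ⟨x, rfl⟩ hx
  · simp

lemma freeOp_apply (κ : ℂ) (u : Hsp K N) (x : Vtx K N) :
    (H₀ Γ a + κ ^ 2 • ContinuousLinearMap.id ℂ (Hsp K N)) u x =
      H₀fun Γ a u x + κ ^ 2 * u x := rfl

lemma freeOp_apply_inl (κ : ℂ) (u : Vtx K N → ℂ) (x : K) :
    H₀fun Γ a u (.inl x) + κ ^ 2 * u (.inl x) =
      coreShift Γ a κ (fun y => u (.inl y)) x := rfl

/-- `K` and the half-lines decouple: `coreShift` inverts the part on `K`, and the shift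
factorization inverts the rest. On `K` both shifts are the identity, so there `shiftProd` is
multiplication by `(1 - θ)²`. -/
lemma isUnit_freeOp {κ : ℂ} (hθ : ‖theta κ‖ < 1) (hc : IsUnit (coreShift Γ a κ)) :
    IsUnit (H₀ Γ a + κ ^ 2 • ContinuousLinearMap.id ℂ (Hsp K N)) := by
  have hc' := ContinuousLinearMap.isUnit_iff_bijective.1 hc
  have hX := ContinuousLinearMap.isUnit_iff_bijective.1 (isUnit_shiftProd (K := K) (N := N) hθ)
  rw [ContinuousLinearMap.isUnit_iff_bijective]
  constructor
  · rw [injective_iff_map_eq_zero]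
    intro u hu
    have hu' : ∀ x, H₀fun Γ a u x + κ ^ 2 * u x = 0 := fun x => by
      rw [← freeOp_apply, hu]; rfl
    have h0 : (fun y => u (.inl y)) = (0 : K → ℂ) := by
      apply hc'.1
      rw [map_zero]
      funext x
      rw [← freeOp_apply_inl, hu']
      rfl
    apply hX.1
    rw [map_zero]
    apply lp.ext
    funext x
    rcases x with x | q
    · rw [shiftProd_apply, rightShift_inl, step, congrFun h0 x]
      simp
    · rw [shiftProd_theta_inr (Γ := Γ) (a := a), hu', mul_zero]
      rfl
  · intro g
    obtain ⟨w, hw⟩ := hc'.2 (fun y => g (.inl y))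
    -- The correction makes the right-hand side equal to `(1 - θ)² w` on `K`, so that the preimage
    -- under `shiftProd` restricts to `w` there.
    let e : Hsp K N := ⟨_, memlp_core (fun y => (1 - theta κ) ^ 2 * w y - theta κ * g (.inl y))⟩
    obtain ⟨u, hu⟩ := hX.2 (theta κ • g + e)
    have hu' : ∀ x, shiftProd (theta κ) u x = theta κ * g x + e x := fun x => by rw [hu]; rfl
    have h1 : (1 - theta κ) ^ 2 ≠ 0 := by
      refine pow_ne_zero _ (sub_ne_zero.2 ?_)
      rintro h
      rw [← h] at hθ
      simp at hθ
    have hK : (fun y => u (.inl y)) = w := by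
      funext y
      have h2 := hu' (.inl y)
      rw [shiftProd_apply, rightShift_inl, step,
        show e (.inl y) = (1 - theta κ) ^ 2 * w y - theta κ * g (.inl y) from rfl] at h2
      apply mul_left_cancel₀ h1
      linear_combination h2
    refine ⟨u, lp.ext (funext fun x => ?_)⟩
    rw [freeOp_apply]
    rcases x with x | q
    · rw [freeOp_apply_inl, hK, hw]
    · have h2 := hu' (.inr q)
      rw [shiftProd_theta_inr (Γ := Γ) (a := a), show e (.inr q) = 0 from rfl, add_zero] at h2
      exact mul_left_cancel₀ (theta_ne_zero κ) h2

lemma memlp_freeGreen {κ : ℂ} (hθ : ‖theta κ‖ < 1) (y : Vtx K N) :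
    Memℓp (freeGreen Γ a κ y) 2 := by
  rcases y with b | ⟨α, m⟩
  · convert memlp_core (N := N) (Ring.inverse (coreShift Γ a κ) (Pi.single b 1)) using 1
    funext x
    rcases x with x | q <;> rfl
  · rw [memlp_two_iff]
    have hi : Function.Injective (fun n : ℕ => (.inr (α, n) : Vtx K N)) := by
      intro n n' h
      simpa using h
    refine (hi.summable_iff ?_).1 ?_
    · rintro (x | ⟨α', n⟩) hx
      · simp [freeGreen]
      · have : α' ≠ α := by
          rintro rfl
          exact hx ⟨n, rfl⟩
        simp [freeGreen, this]
    · simpa [Function.comp_def, freeGreen] using summable_norm_rayGreen_sq hθ m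

open scoped Classical in
/-- The kernel solves `(H₀ + κ²) u = δ_y`; this includes `κ = 0`. -/
lemma freeGreen_equation {κ : ℂ} (hc : IsUnit (coreShift Γ a κ)) (y x : Vtx K N) :
    H₀fun Γ a (freeGreen Γ a κ y) x + κ ^ 2 * freeGreen Γ a κ y x = if x = y then 1 else 0 := by
  rcases y with b | ⟨α, m⟩
  · rcases x with x | ⟨α', _ | n⟩
    · rw [freeOp_apply_inl]
      change (coreShift Γ a κ * Ring.inverse (coreShift Γ a κ)) (Pi.single b 1) x = _
      rw [Ring.mul_inverse_cancel _ hc]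
      simp [Pi.single_apply]
    · rw [H₀fun_inr_zero]
      simp [freeGreen]
    · rw [H₀fun_inr_succ]
      simp [freeGreen]
  · rcases x with x | ⟨α', _ | n⟩
    · rw [freeOp_apply_inl]
      have : (fun y => freeGreen Γ a κ (.inr (α, m)) (.inl y)) = 0 := rfl
      rw [this, map_zero]
      simp
    · rw [H₀fun_inr_zero]
      simp only [freeGreen, Sum.inr.injEq, Prod.mk.injEq]
      by_cases h : α' = α
      · simp only [h, if_true, true_and]
        have := rayGreen_zero_eq (theta_quadratic κ) m
        simp only [eq_comm (a := m)] at this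
        rw [← this]
        ring
      · simp [h]
    · rw [H₀fun_inr_succ]
      simp only [freeGreen, Sum.inr.injEq, Prod.mk.injEq]
      by_cases h : α' = α
      · simp only [h, if_true, true_and]
        have := rayGreen_succ_eq (theta_quadratic κ) n m
        simp only [eq_comm (a := m)] at this
        rw [← this]
        ring
      · simp [h]

/-- The column of the kernel is square summable and solves the resolvent equation, so it is the
image of the unit vector under the resolvent. -/
lemma toBs_R_delta {s : ℝ} (hs : 0 ≤ s) {κ : ℂ} (hθ : ‖theta κ‖ < 1)
    (hc : IsUnit (coreShift Γ a κ)) (y x : Vtx K N) :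
    toBs hs (R (H₀ Γ a) κ) (delta s y) x = freeGreen Γ a κ y x := by
  classical
  let c : Hsp K N := ⟨_, memlp_freeGreen (Γ := Γ) (a := a) hθ y⟩
  have h1 : (H₀ Γ a + κ ^ 2 • ContinuousLinearMap.id ℂ (Hsp K N)) c = LsToH hs (delta s y) := by
    apply lp.ext
    funext x
    rw [freeOp_apply, LsToH_apply, delta_apply]
    exact freeGreen_equation hc y x
  rw [toBs_apply, ← h1]
  change (R (H₀ Γ a) κ * (H₀ Γ a + κ ^ 2 • ContinuousLinearMap.id ℂ (Hsp K N))) c x = _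
  rw [R, Ring.inverse_mul_cancel _ (isUnit_freeOp hθ hc)]
  rfl

lemma coreShift_zero : coreShift Γ a 0 = coreOp Γ a := by
  have h : (0 : ℂ) • (1 : (K → ℂ) →L[ℂ] (K → ℂ)) = 0 := by ext; simp
  rw [coreShift, zero_pow two_ne_zero, h, add_zero]

lemma tendsto_coreShift : Tendsto (coreShift Γ a) thresholdFilter (𝓝 (coreOp Γ a)) := by
  have : Continuous (coreShift Γ a) := by unfold coreShift; fun_prop
  have := this.tendsto 0
  rw [coreShift_zero] at this
  exact this.mono_left thresholdFilter_le

lemma eventually_isUnit_coreShift (hu : IsUnit (coreOp Γ a)) :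
    ∀ᶠ κ in thresholdFilter, IsUnit (coreShift Γ a κ) := by
  obtain ⟨u, hu⟩ := hu
  have h := tendsto_coreShift (Γ := Γ) (a := a)
  rw [← hu] at h
  exact h (Units.isOpen.mem_nhds u.isUnit)

lemma hasExpansion_coreShift_inverse (n : ℕ) (hu : IsUnit (coreOp Γ a)) :
    HasExpansion thresholdFilter n (fun κ => Ring.inverse (coreShift Γ a κ)) := by
  refine HasExpansion.inverse thresholdFilter_le ?_ tendsto_coreShift hu
  exact (HasExpansion.const _).add
    (((HasExpansion.id thresholdFilter_le).pow thresholdFilter_le 2).smul thresholdFilter_le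
      (HasExpansion.const _))

/-- Only `κ²` occurs on `K`, so the finite graph contributes nothing to first order. -/
lemma hasDerivAt_coreShift_inverse (hu : IsUnit (coreOp Γ a)) :
    HasDerivAt (fun κ => Ring.inverse (coreShift Γ a κ)) 0 0 := by
  obtain ⟨u, hu⟩ := hu
  have h1 : HasDerivAt (coreShift Γ a) 0 0 := by
    have h := ((hasDerivAt_id (0 : ℂ)).fun_pow 2).smul_const (1 : (K → ℂ) →L[ℂ] (K → ℂ))
    have h' := h.const_add (coreOp Γ a)
    refine h'.congr_deriv ?_
    have h0 : (0 : ℂ) • (1 : (K → ℂ) →L[ℂ] (K → ℂ)) = 0 := by ext; simp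
    simp [h0]
  have h2 := hasFDerivAt_ringInverse (𝕜 := ℂ) u
  rw [hu, ← coreShift_zero] at h2
  exact (h2.comp_hasDerivAt 0 h1).congr_deriv (map_zero _)

/-- The first-order coefficient of the kernel of the free resolvent. -/
noncomputable def freeGreenOne : Vtx K N → Vtx K N → ℂ :=
  rayKernel fun n m => -((n + 1 : ℂ) * (m + 1))

lemma hasDerivAt_freeGreen (hu : IsUnit (coreOp Γ a)) (y x : Vtx K N) :
    HasDerivAt (fun κ => freeGreen Γ a κ y x) (freeGreenOne y x) 0 := by
  classical
  rcases y with b | ⟨α, m⟩ <;> rcases x with x | ⟨α', n⟩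
  · have h := ((ContinuousLinearMap.proj (R := ℂ) (φ := fun _ : K => ℂ) x).comp
      (ContinuousLinearMap.apply ℂ (K → ℂ)
        (Pi.single b 1 : K → ℂ))).hasFDerivAt.comp_hasDerivAt (0 : ℂ)
          (hasDerivAt_coreShift_inverse hu)
    refine (h.congr_deriv (by simp [freeGreenOne, rayKernel])).congr_of_eventuallyEq
      (Eventually.of_forall fun κ => ?_)
    simp only [freeGreen]
    congr!
  · exact hasDerivAt_const _ _
  · exact hasDerivAt_const _ _
  · simp only [freeGreen, freeGreenOne, rayKernel_inr]
    split_ifs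
    · exact hasDerivAt_rayGreen_theta n m
    · exact hasDerivAt_const _ _

/-- The expansion of the free resolvent. -/
theorem hasExpansion_free (hu : IsUnit (coreOp Γ a)) {s : ℝ} (hs : 0 ≤ s) {j : ℕ} (hj : 1 ≤ j)
    (hjs : (j : ℝ) ≤ s) :
    HasExpansion thresholdFilter j (fun κ => toBs hs (R (H₀ Γ a) κ)) := by
  classical
  have hA : ∀ i : ℕ, ∃ A : Bs K N s, i < j → ∀ y x, A (delta s y) x =
      rayKernel (fun n m => (rayGreenCoeff i n m : ℂ)) y x := by
    intro i
    by_cases hi : i < j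
    · obtain ⟨A, h⟩ := Bs.exists_kernel (K := K) (N := N) (s := s) (C := 2 ^ j) (by positivity)
        (rayKernel fun n m => (rayGreenCoeff i n m : ℂ)) (by
        have h0 : ∀ y x : Vtx K N, (0 : ℝ) ≤ 2 ^ j * (wt s y * wt s x) := fun y x =>
          mul_nonneg (by positivity) (mul_nonneg (wt_pos s y).le (wt_pos s x).le)
        rintro (b | ⟨α, m⟩) (x | ⟨α', n⟩)
        · simpa [rayKernel] using h0 _ _
        · simpa [rayKernel] using h0 _ _
        · simpa [rayKernel] using h0 _ _
        · rw [rayKernel_inr]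
          split_ifs
          · rw [Complex.norm_natCast]
            exact norm_rayGreenCoeff_le hi.le hj hjs α α' m n
          · simpa using h0 _ _)
      exact ⟨A, fun _ => h⟩
    · exact ⟨0, fun h => absurd h hi⟩
  choose A hA using hA
  -- Matrix units of the finite block; with them the inverse of `coreShift` becomes a finite sum in
  -- `𝓑^s` with scalar coefficients.
  have hE : ∀ b x : K, ∃ E : Bs K N s, ∀ y z, E (delta s y) z =
      if y = .inl b ∧ z = .inl x then 1 else 0 := fun b x =>
    Bs.exists_kernel (C := 1) zero_le_one _ (by
      intro y z
      split_ifs with h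
      · obtain ⟨rfl, rfl⟩ := h
        simp [wt_inl]
      · rw [norm_zero, one_mul]
        exact mul_nonneg (wt_pos s y).le (wt_pos s z).le)
  choose E hE using hE
  -- The comparison operator is polynomial in `θ - 1` rather than in `κ`: the half-line remainder is
  -- then precisely the binomial one, and the block on `K` is matched exactly.
  let T : ℂ → Bs K N s := fun κ => ∑ i ∈ Finset.range j, (theta κ - 1) ^ i • A i +
    ∑ b, ∑ x, (Ring.inverse (coreShift Γ a κ) (Pi.single b 1) x) • E b x
  have hT : HasExpansion thresholdFilter j T := by
    refine (HasExpansion.sum _ fun i _ => ?_).add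
      (HasExpansion.sum _ fun b _ => HasExpansion.sum _ fun x _ => ?_)
    · exact ((hasExpansion_theta_sub_one j).pow thresholdFilter_le i).smul thresholdFilter_le
        (HasExpansion.const _)
    · refine HasExpansion.smul thresholdFilter_le ?_ (HasExpansion.const _)
      exact (hasExpansion_coreShift_inverse j hu).clm
        ((ContinuousLinearMap.proj (R := ℂ) (φ := fun _ : K => ℂ) x).comp
          (ContinuousLinearMap.apply ℂ (K → ℂ) (Pi.single b 1 : K → ℂ)))
  have hrem : (fun κ => toBs hs (R (H₀ Γ a) κ) - T κ) =O[thresholdFilter] (fun κ => κ ^ j) := by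
    refine IsBigO.trans ?_ (theta_sub_one_isBigO.pow j)
    refine IsBigO.of_bound (2 ^ j) ?_
    filter_upwards [eventually_norm_theta_lt_one, eventually_isUnit_coreShift hu] with κ hθ hc
    rw [norm_pow]
    refine Bs.opNorm_le (by positivity) fun y x => ?_
    have h0 : (0 : ℝ) ≤ 2 ^ j * ‖theta κ - 1‖ ^ j * (wt s y * wt s x) :=
      mul_nonneg (by positivity) (mul_nonneg (wt_pos s y).le (wt_pos s x).le)
    have hTe : T κ (delta s y) x = ∑ i ∈ Finset.range j, (theta κ - 1) ^ i * A i (delta s y) x +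
        ∑ b, ∑ z, (Ring.inverse (coreShift Γ a κ) (Pi.single b 1) z) * E b z (delta s y) x := by
      simp only [T, add_apply, sum_apply, smul_apply, WL.add_apply, WL.sum_apply, WL.smul_apply]
    have hAsum : ∀ (f : ℕ → ℂ), ∑ i ∈ Finset.range j, f i * A i (delta s y) x =
        ∑ i ∈ Finset.range j, f i * rayKernel (fun n m => (rayGreenCoeff i n m : ℂ)) y x := fun f =>
      Finset.sum_congr rfl fun i hi => by rw [hA i (Finset.mem_range.1 hi)]
    rw [sub_apply, WL.sub_apply, toBs_R_delta hs hθ hc, hTe, hAsum]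
    simp only [hE]
    rcases y with b | ⟨α, m⟩ <;> rcases x with x | ⟨α', n⟩
    · have e : ∑ b', ∑ z, (Ring.inverse (coreShift Γ a κ) (Pi.single b' 1) z) *
          (if (Sum.inl b : Vtx K N) = .inl b' ∧ (Sum.inl x : Vtx K N) = .inl z then 1 else 0) =
          Ring.inverse (coreShift Γ a κ) (Pi.single b 1) x := by
        rw [Finset.sum_eq_single b, Finset.sum_eq_single x]
        · simp
        · intro z _ hz
          simp [hz.symm]
        · simp
        · intro b' _ hb
          simp [hb.symm]
        · simp
      rw [e]
      have e2 : freeGreen Γ a κ (.inl b : Vtx K N) (.inl x) =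
          Ring.inverse (coreShift Γ a κ) (Pi.single b 1) x := by
        simp only [freeGreen]
      rw [e2]
      simpa [rayKernel] using h0
    · simpa [freeGreen, rayKernel] using h0
    · simpa [freeGreen, rayKernel] using h0
    · by_cases h : α' = α
      · simp only [freeGreen, rayKernel_inr, h, if_true, reduceCtorEq, false_and, if_false, mul_zero,
          Finset.sum_const_zero, add_zero]
        refine (norm_rayGreen_sub_le hθ.le j n m).trans ?_
        rw [mul_right_comm]
        exact mul_le_mul_of_nonneg_right (norm_rayGreenCoeff_le le_rfl hj hjs α α m n)
          (by positivity)
      · simpa [freeGreen, rayKernel_inr, h] using h0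
  have := hT.add (HasExpansion.of_isBigO thresholdFilter_le_punctured hrem)
  exact this.congr (Eventually.of_forall fun κ => by abel)

end FreeResolvent

end RayGraph

namespace RayGraph

variable {K : Type*} {N : ℕ}

/-! ### The coefficients of the free resolvent at the threshold -/

/-- The function `n ↦ n` on the half-line `α`, extended by zero. -/
noncomputable def coordRay (α : Fin N) : LsDual K N 1 :=
  WL.mk (fun x => match x with
    | .inl _ => 0
    | .inr (α', n) => if α' = α then (n : ℂ) + 1 else 0) (memℓp_infty_of_le (C := 1) (by
      rintro (x | ⟨α', n⟩)
      · simp [wt_inl]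
      · dsimp only
        split_ifs
        · have h := pow_le_wt (K := K) (j := 1) (s := 1) (by norm_num) α' n
          rw [one_mul]
          refine le_trans (le_of_eq ?_) h
          rw [pow_one]
          exact_mod_cast Complex.norm_natCast (n + 1)
        · simpa using (wt_pos (K := K) 1 (.inr (α', n))).le))

lemma coordRay_inl (α : Fin N) (x : K) : coordRay α (.inl x) = 0 := rfl

lemma coordRay_inr (α α' : Fin N) (n : ℕ) :
    coordRay (K := K) α (.inr (α', n)) = if α' = α then (n : ℂ) + 1 else 0 := rfl

lemma conj_coordRay (α : Fin N) (x : Vtx K N) : conj (coordRay α x) = coordRay α x := by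
  rcases x with x | ⟨α', n⟩
  · simp [coordRay_inl]
  · rw [coordRay_inr]
    split_ifs <;> simp

/-- The first-order coefficient of the free resolvent. -/
noncomputable def greenOne : Bs K N 1 :=
  -∑ α : Fin N, (pairCLM (coordRay α)).smulRight (coordRay α)

lemma greenOne_apply (u : Ls K N 1) :
    greenOne u = -∑ α : Fin N, pairing (WL.toFun (coordRay α)) (WL.toFun u) • coordRay α := by
  simp [greenOne, pairCLM_apply]

lemma greenOne_delta (y x : Vtx K N) : greenOne (delta 1 y) x = freeGreenOne y x := by
  rw [greenOne_apply, WL.neg_apply, WL.sum_apply]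
  simp only [WL.smul_apply, pairing_delta, conj_coordRay]
  rcases y with b | ⟨α, m⟩ <;> rcases x with x | ⟨α', n⟩
  · simp [coordRay_inl, freeGreenOne, rayKernel]
  · simp [coordRay_inl, freeGreenOne, rayKernel]
  · simp [coordRay_inl, freeGreenOne, rayKernel]
  · simp only [coordRay_inr, freeGreenOne, rayKernel_inr, ite_mul, zero_mul, mul_ite, mul_zero]
    by_cases h : α' = α
    · simp [h, mul_comm]
    · simp [h, Ne.symm h]

variable [Fintype K] (Γ : SimpleGraph K) (a : Fin N → K)

/-- On a half-line the kernel at `κ = 0` is the smaller of the two coordinates, hence bounded by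
their product: weight `1` suffices. The constant `C` takes care of the finite block. -/
lemma exists_greenZero : ∃ G : Bs K N 1, ∀ y x, G (delta 1 y) x = freeGreen Γ a 0 y x := by
  classical
  let C : ℝ := 1 + ∑ b : K, ∑ x : K, ‖freeGreen Γ a 0 (.inl b) (.inl x)‖
  have hsum : 0 ≤ ∑ b : K, ∑ x : K, ‖freeGreen Γ a 0 (.inl b) (.inl x)‖ :=
    Finset.sum_nonneg fun _ _ => Finset.sum_nonneg fun _ _ => norm_nonneg _
  have hC : 1 ≤ C := by linarith
  refine Bs.exists_kernel (C := C) (by linarith) _ ?_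
  have h0 : ∀ y x : Vtx K N, 0 ≤ wt 1 y * wt 1 x := fun y x =>
    mul_nonneg (wt_pos 1 y).le (wt_pos 1 x).le
  rintro (b | ⟨α, m⟩) (x | ⟨α', n⟩)
  · have h1 : ‖freeGreen Γ a 0 (.inl b) (.inl x)‖ ≤
        ∑ b : K, ∑ x : K, ‖freeGreen Γ a 0 (.inl b) (.inl x)‖ :=
      (Finset.single_le_sum (f := fun x : K => ‖freeGreen Γ a 0 (.inl b) (.inl x)‖)
        (fun _ _ => norm_nonneg _) (Finset.mem_univ x)).trans
      (Finset.single_le_sum (f := fun b : K => ∑ x : K, ‖freeGreen Γ a 0 (.inl b) (.inl x)‖)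
        (fun _ _ => Finset.sum_nonneg fun _ _ => norm_nonneg _) (Finset.mem_univ b))
    simp only [wt_inl, mul_one]
    linarith
  · simpa [freeGreen] using mul_nonneg (by linarith : 0 ≤ C) (h0 _ _)
  · simpa [freeGreen] using mul_nonneg (by linarith : 0 ≤ C) (h0 _ _)
  · simp only [freeGreen, theta_zero, rayGreen_one]
    split_ifs
    · have h1 := pow_le_wt (K := K) (j := 1) (s := 1) (by norm_num) α m
      have h2 := pow_le_wt (K := K) (j := 1) (s := 1) (by norm_num) α' n
      rw [pow_one] at h1 h2
      have h3 : ‖((min n m : ℕ) : ℂ) + 1‖ = (min n m : ℕ) + 1 := by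
        exact_mod_cast Complex.norm_natCast (min n m + 1)
      have h4 : ((min n m : ℕ) : ℝ) ≤ n := by exact_mod_cast min_le_left _ _
      rw [h3]
      have hm : (0 : ℝ) ≤ m := m.cast_nonneg
      have hn : (0 : ℝ) ≤ n := n.cast_nonneg
      have h5 : 1 * (1 * ((n : ℝ) + 1)) ≤ C * (wt (K := K) 1 (.inr (α, m)) * wt (K := K) 1 (.inr (α', n))) := by
        gcongr
        all_goals exact le_trans (by linarith) h1
      linarith
    · simpa using mul_nonneg (by linarith : 0 ≤ C) (h0 _ _)

/-- The limit of the free resolvent at the threshold. -/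
noncomputable def greenZero : Bs K N 1 := (exists_greenZero Γ a).choose

lemma greenZero_delta (y x : Vtx K N) :
    greenZero Γ a (delta 1 y) x = freeGreen Γ a 0 y x := (exists_greenZero Γ a).choose_spec y x

variable {Γ a}

lemma tendsto_free_entry (hu : IsUnit (coreOp Γ a)) {s : ℝ} (hs : 0 ≤ s) (y x : Vtx K N) :
    Tendsto (fun κ => toBs hs (R (H₀ Γ a) κ) (delta s y) x) thresholdFilter
      (𝓝 (freeGreen Γ a 0 y x)) := by
  refine ((hasDerivAt_freeGreen hu y x).continuousAt.tendsto.mono_left thresholdFilter_le).congr' ?_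
  filter_upwards [eventually_norm_theta_lt_one, eventually_isUnit_coreShift hu] with κ hθ hc
  rw [toBs_R_delta hs hθ hc]

/-- The first-order expansion provides a norm limit; entrywise convergence of the kernel identifies
it. -/
lemma tendsto_free (hu : IsUnit (coreOp Γ a)) {s : ℝ} (hs : 1 ≤ s) :
    Tendsto (fun κ => toBs (zero_le_one.trans hs) (R (H₀ Γ a) κ)) thresholdFilter
      (𝓝 (Bs.incl hs (greenZero Γ a))) := by
  obtain ⟨c, F', h1, h2, h3⟩ := (hasExpansion_free hu (zero_le_one.trans hs) (j := 0 + 1) le_rfl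
    (by simpa using hs)).exists_tendsto thresholdFilter_le
  have : c = Bs.incl hs (greenZero Γ a) := Bs.ext_delta fun y x =>
    (tendsto_nhds_unique (Bs.tendsto_entry h3 y x) (tendsto_free_entry hu _ y x)).trans
      (by rw [Bs.incl_delta, greenZero_delta])
  rwa [← this]

/-- The expansion of the free resolvent with explicit coefficients of order zero and one. -/
lemma exists_free_expansion (hu : IsUnit (coreOp Γ a)) {s : ℝ} (hs : 1 ≤ s) {j : ℕ} (hj : 1 ≤ j)
    (hjs : (j : ℝ) + 1 ≤ s) : ∃ F' : ℂ → Bs K N s, HasExpansion thresholdFilter j F' ∧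
      (∀ᶠ κ in thresholdFilter, toBs (zero_le_one.trans hs) (R (H₀ Γ a) κ) =
        Bs.incl hs (greenZero Γ a) + κ • F' κ) ∧
      Tendsto F' thresholdFilter (𝓝 (Bs.incl hs greenOne)) := by
  obtain ⟨c, F', h1, h2, h3⟩ := (hasExpansion_free hu (zero_le_one.trans hs) (j := j + 1) (by omega)
    (by exact_mod_cast hjs)).exists_tendsto thresholdFilter_le
  obtain rfl := tendsto_nhds_unique h3 (tendsto_free hu hs)
  refine ⟨F', h1, h2, ?_⟩
  obtain ⟨i, rfl⟩ : ∃ i, j = i + 1 := ⟨j - 1, by omega⟩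
  obtain ⟨d, -, -, -, h4⟩ := h1.exists_tendsto thresholdFilter_le
  have : d = Bs.incl hs greenOne := by
    refine Bs.ext_delta fun y x => ?_
    rw [Bs.incl_delta, greenOne_delta]
    refine tendsto_nhds_unique (Bs.tendsto_entry h4 y x) ?_
    -- The entries of `F'` are the difference quotients of the kernel, so its limit is read off from
    -- the derivative at `0`.
    have h5 := (hasDerivAt_iff_tendsto_slope_zero.1 (hasDerivAt_freeGreen hu y x)).mono_left
      thresholdFilter_le_punctured
    refine h5.congr' ?_
    filter_upwards [eventually_norm_theta_lt_one, eventually_isUnit_coreShift hu, h2,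
      thresholdFilter_le_punctured self_mem_nhdsWithin] with κ hθ hc e hκ
    have h6 := toBs_R_delta (Γ := Γ) (a := a) (zero_le_one.trans hs) hθ hc y x
    rw [e, add_apply, WL.add_apply, Bs.incl_delta, greenZero_delta, smul_apply, WL.smul_apply] at h6
    rw [zero_add, ← h6, add_sub_cancel_left, smul_eq_mul]
    exact inv_mul_cancel_left₀ hκ _
  rwa [← this]

/-! ### Solutions of `H₀ Ψ = g` -/

/-- The value of `H₀ Ψ` at a vertex, as a bounded functional. -/
noncomputable def H₀eval (Γ : SimpleGraph K) (a : Fin N → K) (s : ℝ) (x : Vtx K N) :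
    LsDual K N s →L[ℂ] ℂ :=
  ⟨(LinearMap.proj x).comp ((H₀fun Γ a).comp WL.toFun), by
    have h : Continuous fun f : Vtx K N → ℂ => H₀fun Γ a f x := by
      rcases x with x | ⟨α, _ | m⟩
      · simp only [H₀fun, LinearMap.coe_mk, AddHom.coe_mk]
        fun_prop
      · simp only [H₀fun, LinearMap.coe_mk, AddHom.coe_mk]
        fun_prop
      · simp only [H₀fun, LinearMap.coe_mk, AddHom.coe_mk]
        fun_prop
    exact h.comp (continuous_pi fun y => (WL.eval ∞ (-s) y).continuous)⟩

lemma H₀eval_apply (s : ℝ) (x : Vtx K N) (Ψ : LsDual K N s) :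
    H₀eval Γ a s x Ψ = H₀fun Γ a (WL.toFun Ψ) x := rfl

/-- Both sides are bounded functionals of `g`, and on unit vectors the identity is the Green
function equation at `κ = 0`. -/
lemma H₀fun_greenZero (hu : IsUnit (coreOp Γ a)) (g : Ls K N 1) (x : Vtx K N) :
    H₀fun Γ a (WL.toFun (greenZero Γ a g)) x = g x := by
  classical
  have e : (H₀eval Γ a 1 x).comp (greenZero Γ a) = WL.eval 1 1 x := by
    refine Ls.hom_ext fun y => ?_
    rw [ContinuousLinearMap.comp_apply, H₀eval_apply, WL.eval_apply, delta_apply]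
    have h1 : WL.toFun (greenZero Γ a (delta 1 y)) = freeGreen Γ a 0 y :=
      funext fun x => greenZero_delta Γ a y x
    have h2 := freeGreen_equation (κ := 0) (by rwa [coreShift_zero]) y x (Γ := Γ) (a := a)
    rw [h1, ← h2]
    simp
  exact congrArg (fun T => T g) e

/-- A bounded solution of `H₀ Ψ = 0` vanishes. -/
lemma eq_zero_of_H₀fun_eq_zero (hu : IsUnit (coreOp Γ a)) {Ψ : Vtx K N → ℂ} {C : ℝ}
    (hb : ∀ x, ‖Ψ x‖ ≤ C) (h : H₀fun Γ a Ψ = 0) : Ψ = 0 := by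
  have hK : (fun y => Ψ (.inl y)) = (0 : K → ℂ) := by
    apply (ContinuousLinearMap.isUnit_iff_bijective.1 hu).1
    rw [map_zero]
    funext x
    rw [coreOp_apply, h]
    rfl
  funext x
  rcases x with x | ⟨α, n⟩
  · exact congrFun hK x
  · have hlin : ∀ n : ℕ, Ψ (.inr (α, n)) = (n + 1) * Ψ (.inr (α, 0)) ∧
        Ψ (.inr (α, n + 1)) = (n + 2) * Ψ (.inr (α, 0)) := by
      intro n
      induction n with
      | zero =>
        have h0 := congrFun h (.inr (α, 0))
        rw [H₀fun_inr_zero, Pi.zero_apply] at h0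
        exact ⟨by simp, by push_cast; linear_combination -h0⟩
      | succ n ih =>
        have h0 := congrFun h (.inr (α, n + 1))
        rw [H₀fun_inr_succ, Pi.zero_apply] at h0
        refine ⟨by rw [ih.2]; push_cast; ring, ?_⟩
        push_cast
        linear_combination -h0 + 2 * ih.2 - ih.1
    have h0 : Ψ (.inr (α, 0)) = 0 := by
      by_contra hne
      have hpos : 0 < ‖Ψ (.inr (α, 0))‖ := norm_pos_iff.2 hne
      obtain ⟨n, hn⟩ := exists_nat_gt (C / ‖Ψ (.inr (α, 0))‖)
      rw [div_lt_iff₀ hpos] at hn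
      have h1 := hb (.inr (α, n))
      rw [(hlin n).1, norm_mul] at h1
      have h2 : ‖(n : ℂ) + 1‖ = n + 1 := by exact_mod_cast Complex.norm_natCast (n + 1)
      rw [h2] at h1
      nlinarith
    rw [(hlin n).1, h0, mul_zero]
    rfl

lemma coreOp_symm (f g : K → ℂ) :
    ∑ x, conj (coreOp Γ a f x) * g x = ∑ x, conj (f x) * coreOp Γ a g x := by
  classical
  have e : ∀ (f : K → ℂ) (x : K), coreOp Γ a f x = (∑ y, if Γ.Adj x y then (f x - f y) else 0) +
      ∑ α : Fin N, (if x = a α then 1 else 0) * f x := by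
    intro f x
    change H₀fun Γ a (Sum.elim f 0) (.inl x) = _
    simp only [H₀fun, LinearMap.coe_mk, AddHom.coe_mk, Sum.elim_inl, Finset.sum_filter]
  have h1 : ∑ x, ∑ y, (if Γ.Adj x y then conj (f y) * g x else 0) =
      ∑ x, ∑ y, (if Γ.Adj x y then conj (f x) * g y else 0) := by
    rw [Finset.sum_comm]
    simp only [Γ.adj_comm]
  have h2 : ∀ x, conj (coreOp Γ a f x) * g x =
      ((∑ y, if Γ.Adj x y then conj (f x) * g x else 0) -
        ∑ y, if Γ.Adj x y then conj (f y) * g x else 0) +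
      ∑ α : Fin N, (if x = a α then 1 else 0) * (conj (f x) * g x) := by
    intro x
    rw [e, map_add, map_sum, map_sum, add_mul, Finset.sum_mul, Finset.sum_mul,
      ← Finset.sum_sub_distrib]
    congr 1
    · refine Finset.sum_congr rfl fun y _ => ?_
      split_ifs
      · rw [map_sub, sub_mul]
      · simp
    · refine Finset.sum_congr rfl fun α _ => ?_
      split_ifs <;> simp
  have h3 : ∀ x, conj (f x) * coreOp Γ a g x =
      ((∑ y, if Γ.Adj x y then conj (f x) * g x else 0) -
        ∑ y, if Γ.Adj x y then conj (f x) * g y else 0) +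
      ∑ α : Fin N, (if x = a α then 1 else 0) * (conj (f x) * g x) := by
    intro x
    rw [e, mul_add, Finset.mul_sum, Finset.mul_sum, ← Finset.sum_sub_distrib]
    congr 1
    · refine Finset.sum_congr rfl fun y _ => ?_
      split_ifs
      · rw [mul_sub]
      · simp
    · refine Finset.sum_congr rfl fun α _ => ?_
      split_ifs <;> simp
  simp only [h2, h3, Finset.sum_add_distrib, Finset.sum_sub_distrib, h1]

lemma conj_greenZero_delta (hu : IsUnit (coreOp Γ a)) (y x : Vtx K N) :
    conj (greenZero Γ a (delta 1 y) x) = greenZero Γ a (delta 1 x) y := by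
  classical
  rw [greenZero_delta, greenZero_delta]
  rcases y with b | ⟨α, m⟩ <;> rcases x with x | ⟨α', n⟩
  · have hmul : ∀ w, coreOp Γ a (Ring.inverse (coreOp Γ a) w) = w := fun w => by
      have := Ring.mul_inverse_cancel _ hu
      exact congrArg (fun T => T w) this
    have h := coreOp_symm (Γ := Γ) (a := a) (Ring.inverse (coreOp Γ a) (Pi.single b 1))
      (Ring.inverse (coreOp Γ a) (Pi.single x 1))
    rw [hmul, hmul] at h
    simp only [Pi.single_apply, mul_ite, mul_one, mul_zero, apply_ite conj, map_one, map_zero,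
      ite_mul, one_mul, zero_mul, Finset.sum_ite_eq', Finset.mem_univ, if_true] at h
    simp only [freeGreen, coreShift_zero]
    rw [← h]
  · simp [freeGreen]
  · simp [freeGreen]
  · simp only [freeGreen, theta_zero, rayGreen_one, min_comm n m, eq_comm (a := α')]
    split_ifs <;> simp

end RayGraph

namespace RayGraph

variable {K : Type*} {N : ℕ}

/-! ### Asymptotics along the half-lines -/

lemma oneRay_inr (α α' : Fin N) (n : ℕ) :
    oneRay (K := K) α (.inr (α', n)) = if α' = α then 1 else 0 := rfl

lemma oneRay_inl (α : Fin N) (x : K) : oneRay α (.inl x) = 0 := rfl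

lemma sum_smul_oneRay_inr (c : Fin N → ℂ) (α : Fin N) (n : ℕ) :
    (∑ α', c α' • oneRay (K := K) α') (.inr (α, n)) = c α := by
  simp [Finset.sum_apply, oneRay_inr]

lemma sum_smul_oneRay_inl (c : Fin N → ℂ) (x : K) : (∑ α', c α' • oneRay α') (.inl x) = 0 := by
  simp [Finset.sum_apply, oneRay_inl]

lemma norm_sum_smul_oneRay_le (c : Fin N → ℂ) (x : Vtx K N) :
    ‖(∑ α', c α' • oneRay α') x‖ ≤ ∑ α, ‖c α‖ := by
  rcases x with x | ⟨α, n⟩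
  · rw [sum_smul_oneRay_inl, norm_zero]
    exact Finset.sum_nonneg fun _ _ => norm_nonneg _
  · rw [sum_smul_oneRay_inr]
    exact Finset.single_le_sum (f := fun α => ‖c α‖) (fun _ _ => norm_nonneg _) (Finset.mem_univ α)

lemma Ls.norm_apply_le {s : ℝ} (hs : 0 ≤ s) (u : Ls K N s) (x : Vtx K N) : ‖u x‖ ≤ ‖u‖ := by
  have h1 := (hasSum_norm_toLp u)
  exact (norm_le_toLp hs u x).trans (le_hasSum h1 x fun _ _ => norm_nonneg _)

lemma mem_span_oneRay_sup {s : ℝ} {Ψ : Vtx K N → ℂ} :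
    Ψ ∈ Submodule.span ℂ (Set.range oneRay) ⊔ wlp K N 1 s ↔
      ∃ c : Fin N → ℂ, Ψ - ∑ α, c α • oneRay α ∈ wlp K N 1 s := by
  rw [Submodule.mem_sup]
  constructor
  · rintro ⟨y, hy, z, hz, rfl⟩
    obtain ⟨c, rfl⟩ := (Submodule.mem_span_range_iff_exists_fun ℂ).1 hy
    exact ⟨c, by rwa [add_sub_cancel_left]⟩
  · rintro ⟨c, hc⟩
    exact ⟨_, (Submodule.mem_span_range_iff_exists_fun ℂ).2 ⟨c, rfl⟩, _, hc, by abel⟩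

lemma exists_bound_of_sub_mem {s : ℝ} (hs : 0 ≤ s) {Ψ : Vtx K N → ℂ} {c : Fin N → ℂ}
    (h : Ψ - ∑ α, c α • oneRay α ∈ wlp K N 1 s) : ∃ C, ∀ x, ‖Ψ x‖ ≤ C := by
  refine ⟨‖(WL.mk _ h : Ls K N s)‖ + ∑ α, ‖c α‖, fun x => ?_⟩
  have h1 := Ls.norm_apply_le hs (WL.mk _ h) x
  have h2 := norm_sum_smul_oneRay_le c x
  rw [WL.mk_apply, Pi.sub_apply] at h1
  have h3 := norm_add_le (Ψ x - (∑ α, c α • oneRay α) x) ((∑ α, c α • oneRay α) x)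
  rw [sub_add_cancel] at h3
  linarith

/-- The leading coefficients along the half-lines are unique. -/
lemma eq_zero_of_sum_smul_oneRay_mem {s : ℝ} (hs : 0 ≤ s) {c : Fin N → ℂ}
    (h : ∑ α, c α • oneRay (K := K) α ∈ wlp K N 1 s) : c = 0 := by
  funext α
  have h1 : Summable fun n : ℕ => ‖WL.toLp (WL.mk _ h : Ls K N s) (.inr (α, n))‖ :=
    (hasSum_norm_toLp (WL.mk _ h : Ls K N s)).summable.comp_injective
      (i := fun n : ℕ => (.inr (α, n) : Vtx K N)) (fun n m h => by simpa using h)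
  have h2 : Summable fun _ : ℕ => ‖c α‖ := by
    refine Summable.of_nonneg_of_le (fun _ => norm_nonneg _) (fun n => ?_) h1
    have := norm_le_toLp hs (WL.mk _ h : Ls K N s) (.inr (α, n))
    rwa [WL.mk_apply, sum_smul_oneRay_inr] at this
  simpa using (summable_const_iff _).1 h2

variable [Fintype K] {Γ : SimpleGraph K} {a : Fin N → K}

/-- The solution `G₀ g` for `g ∈ 𝓛^s` equals a constant on each half-line, up to a remainder
in `𝓛^{s-2}`. -/
lemma exists_remainder (Γ : SimpleGraph K) (a : Fin N → K) {s : ℝ} (hs : 2 ≤ s) :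
    ∃ T : Ls K N s →L[ℂ] Ls K N (s - 2), ∀ (g : Ls K N s) (x : Vtx K N),
      greenZero Γ a (Ls.incl (by linarith) g) x =
        (∑ α, pairing (WL.toFun (coordRay α)) (WL.toFun g) • oneRay α) x + T g x := by
  classical
  -- On a half-line `min(n, m) + 1 = (m + 1) - (m - n)₊`. The first term produces the constant with
  -- moment coefficient, the second is the remainder; on `K` the whole column is remainder.
  let b : Vtx K N → Ls K N (s - 2) := fun y => match y with
    | .inl b => ∑ x, freeGreen Γ a 0 (.inl b) (.inl x) • delta (s - 2) (.inl x)
    | .inr (α, m) => -∑ n ∈ Finset.range m, ((m - n : ℕ) : ℂ) • delta (s - 2) (.inr (α, n))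
  let C : ℝ := 1 + ∑ b : K, ∑ x : K, ‖freeGreen Γ a 0 (.inl b) (.inl x)‖
  have hsum : 0 ≤ ∑ b : K, ∑ x : K, ‖freeGreen Γ a 0 (.inl b) (.inl x)‖ :=
    Finset.sum_nonneg fun _ _ => Finset.sum_nonneg fun _ _ => norm_nonneg _
  have hb : ∀ y, ‖b y‖ ≤ C * wt s y := by
    rintro (b' | ⟨α, m⟩)
    · have h1 : ‖b (.inl b')‖ ≤ ∑ x : K, ‖freeGreen Γ a 0 (.inl b') (.inl x)‖ := by
        refine norm_sum_le_of_le _ fun x _ => ?_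
        rw [norm_smul, norm_delta, wt_inl, mul_one]
      have h2 := Finset.single_le_sum
        (f := fun b : K => ∑ x : K, ‖freeGreen Γ a 0 (.inl b) (.inl x)‖)
        (fun _ _ => Finset.sum_nonneg fun _ _ => norm_nonneg _) (Finset.mem_univ b')
      rw [wt_inl, mul_one]
      linarith
    · have h1 : ‖b (.inr (α, m))‖ ≤
          ∑ n ∈ Finset.range m, ((m : ℝ) + 1) * wt (K := K) (s - 2) (.inr (α, m)) := by
        change ‖-∑ n ∈ Finset.range m, _‖ ≤ _
        rw [norm_neg]
        refine norm_sum_le_of_le _ fun n hn => ?_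
        rw [norm_smul, norm_delta, Complex.norm_natCast]
        have h3 : ((m - n : ℕ) : ℝ) ≤ (m : ℝ) + 1 := by
          have : m - n ≤ m + 1 := by omega
          exact_mod_cast this
        have h4 := wt_le_of_le (K := K) (s - 2) (by linarith) α (Finset.mem_range.1 hn).le
        have h5 := (wt_pos (K := K) (s - 2) (.inr (α, n))).le
        gcongr
      rw [Finset.sum_const, Finset.card_range, nsmul_eq_mul] at h1
      have h6 := pow_le_wt (K := K) (j := 2) (s := 2) (by norm_num) α m
      have h7 := wt_add (K := K) (s - 2) 2 (.inr (α, m))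
      rw [sub_add_cancel] at h7
      have h8 := wt_pos (K := K) (s - 2) (.inr (α, m))
      have h9 := wt_pos (K := K) s (.inr (α, m))
      calc ‖b (.inr (α, m))‖ ≤ (m : ℝ) * (((m : ℝ) + 1) * wt (K := K) (s - 2) (.inr (α, m))) := h1
        -- The column at `m` has `m` terms with coefficients at most `m + 1`; these two powers are
        -- the loss from `s` to `s - 2`.
        _ ≤ wt (K := K) (s - 2) (.inr (α, m)) * ((m : ℝ) + 1) ^ 2 := by
            have hm : (0 : ℝ) ≤ m := m.cast_nonneg
            nlinarith [mul_nonneg h8.le hm]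
        _ ≤ wt (K := K) s (.inr (α, m)) := by rw [h7]; gcongr
        _ ≤ C * wt (K := K) s (.inr (α, m)) := by
            have : 1 ≤ C := by linarith
            nlinarith
  refine ⟨Ls.lift b C hb, fun g x => ?_⟩
  have e : (WL.eval ∞ (-1) x).comp ((greenZero Γ a).comp (Ls.incl (by linarith : (1 : ℝ) ≤ s))) =
      ∑ α, oneRay α x • (pairCLM (coordRay α)).comp (Ls.incl (by linarith : (1 : ℝ) ≤ s)) +
        (WL.eval 1 (s - 2) x).comp (Ls.lift b C hb) := by
    refine Ls.hom_ext fun y => ?_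
    simp only [ContinuousLinearMap.comp_apply, Ls.incl_delta, WL.eval_apply, greenZero_delta,
      add_apply, sum_apply, smul_apply, Ls.lift_delta, pairCLM_apply, pairing_delta, conj_coordRay,
      smul_eq_mul]
    rcases y with b' | ⟨α, m⟩
    · simp only [b, WL.sum_apply, WL.smul_apply, delta_apply, coordRay_inl, mul_zero,
        Finset.sum_const_zero, zero_add]
      rcases x with x | ⟨α', n⟩
      · simp
      · simp [freeGreen]
    · simp only [b, WL.neg_apply, WL.sum_apply, WL.smul_apply, delta_apply]
      rcases x with x | ⟨α', n⟩
      · simp [freeGreen, oneRay_inl]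
      · simp only [freeGreen, theta_zero, rayGreen_one, oneRay_inr, coordRay_inr, Sum.inr.injEq,
          Prod.mk.injEq, ite_mul, one_mul, zero_mul, mul_ite, mul_one, mul_zero]
        by_cases h : α' = α
        · subst h
          rcases le_or_gt m n with hnm | hnm
          · have : ∀ k ∈ Finset.range m, (if n = k then ((m - k : ℕ) : ℂ) else 0) = 0 :=
              fun k hk => by
                have := Finset.mem_range.1 hk
                rw [if_neg (by omega)]
            simp [Finset.sum_eq_zero this, hnm]
          · simp [hnm.le, hnm, Nat.cast_sub]
            ring
        · simp [h]
  have h1 := congrArg (fun T => T g) e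
  simp only [ContinuousLinearMap.comp_apply, WL.eval_apply, add_apply, sum_apply, smul_apply,
    pairCLM_apply, smul_eq_mul] at h1
  rw [h1]
  congr 1
  rw [Finset.sum_apply]
  refine Finset.sum_congr rfl fun α _ => ?_
  rw [Pi.smul_apply, smul_eq_mul, mul_comm]
  congr 2
  funext x
  exact Ls.incl_apply _ _ _

end RayGraph

namespace RayGraph

variable {K : Type*} {N : ℕ} {𝒦 : Type*} [NormedAddCommGroup 𝒦] [InnerProductSpace ℂ 𝒦]
  [CompleteSpace 𝒦] {s : ℝ}

lemma IsFactorized.involutive {hs : 0 ≤ s} {V : Hsp K N →L[ℂ] Hsp K N} {v : 𝒦 →L[ℂ] Ls K N s}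
    {U : 𝒦 →L[ℂ] 𝒦} (hV : IsFactorized hs V v U) (f : 𝒦) : U (U f) = f := by
  have h := (Unitary.mem_iff.1 hV.unitary_U).1
  rw [hV.selfAdjoint_U.star_eq] at h
  exact congrArg (fun T => T f) h

/-! ### Sandwiched operators `v^* T v` -/

/-- The operator `v^* T v` on `𝒦`. -/
noncomputable def sandwich (v : 𝒦 →L[ℂ] Ls K N s) (T : Bs K N s) : 𝒦 →L[ℂ] 𝒦 :=
  (adjL v).comp (T.comp v)

/-- `T ↦ v^* T v` as a bounded operator. -/
noncomputable def sandwichL (v : 𝒦 →L[ℂ] Ls K N s) : Bs K N s →L[ℂ] 𝒦 →L[ℂ] 𝒦 :=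
  (ContinuousLinearMap.compL ℂ 𝒦 (LsDual K N s) 𝒦 (adjL v)).comp
    ((ContinuousLinearMap.compL ℂ 𝒦 (Ls K N s) (LsDual K N s)).flip v)

lemma sandwichL_apply (v : 𝒦 →L[ℂ] Ls K N s) (T : Bs K N s) : sandwichL v T = sandwich v T := rfl

lemma inner_sandwich (v : 𝒦 →L[ℂ] Ls K N s) (T : Bs K N s) (f g : 𝒦) :
    inner ℂ (sandwich v T f) g = pairing (WL.toFun (T (v f))) (WL.toFun (v g)) :=
  inner_adj v _ g

lemma inner_sandwich_comm (v : 𝒦 →L[ℂ] Ls K N s) {T : Bs K N s}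
    (h : ∀ y x, conj (T (delta s y) x) = T (delta s x) y) (f g : 𝒦) :
    inner ℂ (sandwich v T f) g = inner ℂ f (sandwich v T g) := by
  rw [← inner_conj_symm f, inner_sandwich, inner_sandwich, Bs.pairing_comm h, conj_pairing]

/-- `T` acts already at weight `1`, while `v` lands in `𝓛^s` with `s ≥ 2`; the compact inclusion of
`𝓛^s` in `𝓛^1` sits in between. -/
lemma isCompactOperator_sandwich_incl [Fintype K] (v : 𝒦 →L[ℂ] Ls K N s) (hs : 2 ≤ s)
    (T : Bs K N 1) : IsCompactOperator (sandwich v (Bs.incl (by linarith) T)) := by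
  have h := Ls.isCompactOperator_incl (K := K) (N := N) (s := s) (t := 1) (by linarith)
  exact ((h.comp_clm v).clm_comp T).clm_comp ((adjL v).comp (LsDual.incl (by linarith)))

/-- `p_α(f) = ⟨n^(α), v f⟩`. -/
noncomputable def rayMoment (v : 𝒦 →L[ℂ] Ls K N s) (α : Fin N) (f : 𝒦) : ℂ :=
  pairing (WL.toFun (coordRay α)) (WL.toFun (v f))

/-- The first-order coefficient is minus a sum of rank-one projectors on the coordinates. The
resulting negative form decides the invertibility of `M₀ + S M₁`. -/
lemma inner_sandwich_greenOne (v : 𝒦 →L[ℂ] Ls K N s) (hs : 1 ≤ s) (f g : 𝒦) :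
    inner ℂ (sandwich v (Bs.incl hs greenOne) f) g =
      -∑ α, conj (rayMoment v α f) * rayMoment v α g := by
  have h1 : conj (inner ℂ (sandwich v (Bs.incl hs greenOne) f) g) =
      dualPairCLM (Ls.incl hs (v g)) (greenOne (Ls.incl hs (v f))) := by
    rw [inner_sandwich, conj_pairing, Bs.toFun_incl, dualPairCLM_apply, Ls.toFun_incl]
  rw [← Complex.conj_conj (inner ℂ _ _), h1, greenOne_apply, map_neg, map_sum, map_neg, map_sum]
  congr 1
  refine Finset.sum_congr rfl fun α _ => ?_
  rw [map_smul, smul_eq_mul, map_mul, dualPairCLM_apply, conj_pairing, Ls.toFun_incl,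
    Ls.toFun_incl, rayMoment, rayMoment, conj_pairing, conj_pairing]

/-! ### Resonances and the kernel of `U + v^* G₀ v` -/

section Kernel

variable [Fintype K] (Γ : SimpleGraph K) (a : Fin N → K) (v : 𝒦 →L[ℂ] Ls K N s) (U : 𝒦 →L[ℂ] 𝒦)

/-- `M₀ = U + v^* G₀ v`. -/
noncomputable def Mzero (hs : 1 ≤ s) : 𝒦 →L[ℂ] 𝒦 :=
  U + sandwich v (Bs.incl hs (greenZero Γ a))

/-- The generalized eigenfunction `G₀ v f`. -/
noncomputable def genEigenfun (hs : 1 ≤ s) (f : 𝒦) : LsDual K N s :=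
  Bs.incl hs (greenZero Γ a) (v f)

variable {Γ a v U}

lemma mem_genEigenspace {Ψ : Vtx K N → ℂ} : Ψ ∈ genEigenspace Γ a v U ↔
    ∃ Φ : LsDual K N s, (∀ x, H₀fun Γ a (WL.toFun Φ) x + v (U (adj v Φ)) x = 0) ∧
      WL.toFun Φ = Ψ := by
  rw [genEigenspace, Submodule.mem_map]
  refine exists_congr fun Φ => and_congr_left' ?_
  rw [LinearMap.mem_ker]
  exact ⟨fun h x => congrFun h x, fun h => funext h⟩

/-- The moments of `f` are the leading coefficients of `G₀ v f` along the half-lines, which links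
the operator `M₁` with the normalization of resonance functions. -/
lemma genEigenfun_sub_mem (hs : 1 ≤ s) (hs2 : 2 ≤ s) (f : 𝒦) :
    WL.toFun (genEigenfun Γ a v hs f) - ∑ α, rayMoment v α f • oneRay α ∈ wlp K N 1 (s - 2) := by
  obtain ⟨T, hT⟩ := exists_remainder (N := N) Γ a hs2
  have : WL.toFun (genEigenfun Γ a v hs f) - ∑ α, rayMoment v α f • oneRay α =
      WL.toFun (T (v f)) := by
    funext x
    have h := hT (v f) x
    rw [Pi.sub_apply, sub_eq_iff_eq_add']
    exact h
  rw [this]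
  exact WL.mem_wlp _

lemma H₀fun_genEigenfun (hu : IsUnit (coreOp Γ a)) (hs : 1 ≤ s) (f : 𝒦) (x : Vtx K N) :
    H₀fun Γ a (WL.toFun (genEigenfun Γ a v hs f)) x = v f x :=
  (H₀fun_greenZero hu _ x).trans (Ls.incl_apply _ _ _)

/-- For `Ψ = G₀ v f`, the equation `M₀ f = 0` says `v^* Ψ = -U f`; hence `V Ψ = -v U U f = -v f =
-H₀ Ψ`. -/
lemma genEigenfun_mem (hu : IsUnit (coreOp Γ a)) (hU : ∀ f, U (U f) = f) (hs : 1 ≤ s) {f : 𝒦}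
    (hf : Mzero Γ a v U hs f = 0) :
    WL.toFun (genEigenfun Γ a v hs f) ∈ genEigenspace Γ a v U := by
  refine mem_genEigenspace.2 ⟨genEigenfun Γ a v hs f, fun x => ?_, rfl⟩
  have h1 : adj v (genEigenfun Γ a v hs f) = -U f := by
    rw [eq_neg_iff_add_eq_zero, add_comm]
    exact hf
  rw [H₀fun_genEigenfun hu, h1, map_neg, hU, map_neg, WL.neg_apply, add_neg_cancel]

lemma genEigenfun_mem_resonanceSpace (hu : IsUnit (coreOp Γ a)) (hU : ∀ f, U (U f) = f)
    (hs : 1 ≤ s) (hs2 : 2 ≤ s) {f : 𝒦} (hf : Mzero Γ a v U hs f = 0) :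
    WL.toFun (genEigenfun Γ a v hs f) ∈ resonanceSpace Γ a v U :=
  ⟨genEigenfun_mem hu hU hs hf,
    mem_span_oneRay_sup.2 ⟨fun α => rayMoment v α f, genEigenfun_sub_mem hs hs2 f⟩⟩

/-- Applying `H₀` recovers `v f`, and `v` is injective. -/
lemma genEigenfun_injective (hu : IsUnit (coreOp Γ a)) (hs : 1 ≤ s) (hv : Function.Injective v)
    {f : 𝒦} (h : WL.toFun (genEigenfun Γ a v hs f) = 0) : f = 0 := by
  apply hv
  rw [map_zero]
  ext x
  rw [← H₀fun_genEigenfun hu hs f x, h, map_zero]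
  rfl

/-- Every resonance function is of the form `G₀ v f` with `f` in the kernel of `M₀`. -/
lemma exists_of_mem_resonanceSpace (hu : IsUnit (coreOp Γ a)) (hU : ∀ f, U (U f) = f)
    (hs : 1 ≤ s) (hs2 : 2 ≤ s) {Ψ : Vtx K N → ℂ} (hΨ : Ψ ∈ resonanceSpace Γ a v U) :
    ∃ f, Mzero Γ a v U hs f = 0 ∧ WL.toFun (genEigenfun Γ a v hs f) = Ψ := by
  obtain ⟨h1, h2⟩ := hΨ
  obtain ⟨Φ, hΦ, rfl⟩ := mem_genEigenspace.1 h1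
  obtain ⟨c, hc⟩ := mem_span_oneRay_sup.1 h2
  -- The choice is forced by `v f = H₀ Φ = -v U v^* Φ` and injectivity of `v`, when the latter
  -- holds. With it, `G₀ v f - Φ` is a bounded solution of the free equation and therefore zero.
  set f := -U (adj v Φ) with hf
  obtain ⟨C, hC⟩ := exists_bound_of_sub_mem (by linarith) hc
  obtain ⟨D, hD⟩ := exists_bound_of_sub_mem (by linarith)
    (genEigenfun_sub_mem (Γ := Γ) (a := a) (v := v) hs hs2 f)
  have h3 : WL.toFun (genEigenfun Γ a v hs f) - WL.toFun Φ = 0 := by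
    refine eq_zero_of_H₀fun_eq_zero hu (C := D + C) (fun x => ?_) ?_
    · exact (norm_sub_le _ _).trans (add_le_add (hD x) (hC x))
    · funext x
      have h4 := hΦ x
      rw [map_sub, Pi.sub_apply, H₀fun_genEigenfun hu, hf, map_neg, WL.neg_apply, Pi.zero_apply]
      linear_combination -h4
  have h5 := sub_eq_zero.1 h3
  refine ⟨f, ?_, h5⟩
  have h6 : genEigenfun Γ a v hs f = Φ := WL.ext fun x => congrFun h5 x
  change U f + adj v (genEigenfun Γ a v hs f) = 0
  rw [h6, hf, map_neg, hU, neg_add_cancel]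

/-- Here the absence of bound states enters: without leading coefficients `G₀ v f` would be one. -/
lemma eq_zero_of_rayMoment_eq_zero (hu : IsUnit (coreOp Γ a)) (hU : ∀ f, U (U f) = f)
    (hs : 1 ≤ s) (hs2 : 2 ≤ s) (hv : Function.Injective v) (hE : boundSpace Γ a v U = ⊥) {f : 𝒦}
    (hf : Mzero Γ a v U hs f = 0) (hp : ∀ α, rayMoment v α f = 0) : f = 0 := by
  refine genEigenfun_injective hu hs hv ?_
  have h := genEigenfun_sub_mem (Γ := Γ) (a := a) (v := v) hs hs2 f
  simp only [hp, zero_smul, Finset.sum_const_zero, sub_zero] at h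
  have h2 : WL.toFun (genEigenfun Γ a v hs f) ∈ boundSpace Γ a v U :=
    ⟨genEigenfun_mem hu hU hs hf, h⟩
  rwa [hE, Submodule.mem_bot] at h2

lemma inner_Mzero_comm (hu : IsUnit (coreOp Γ a)) (hU : IsSelfAdjoint U) (hs : 1 ≤ s) (f g : 𝒦) :
    inner ℂ (Mzero Γ a v U hs f) g = inner ℂ f (Mzero Γ a v U hs g) := by
  have h1 := inner_sandwich_comm v (T := Bs.incl hs (greenZero Γ a)) (fun y x => by
    rw [Bs.incl_delta, Bs.incl_delta, conj_greenZero_delta hu]) f g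
  have h2 : inner ℂ (U f) g = inner ℂ f (U g) := hU.isSymmetric f g
  rw [Mzero, add_apply, add_apply, inner_add_left, inner_add_right, h1, h2]

end Kernel

/-! ### An abstract inversion -/

/-- The Fredholm alternative for compact perturbations of an involution. -/
lemma isUnit_add_of_isCompactOperator {U T : 𝒦 →L[ℂ] 𝒦} (hU : ∀ f, U (U f) = f)
    (hT : IsCompactOperator T) (hinj : ∀ f, (U + T) f = 0 → f = 0) : IsUnit (U + T) := by
  -- Multiplication by `U` gives `U (U + T) = 1 + U T`, an identity plus compact operator; an
  -- eigenvalue `1` of `-U T` would contradict injectivity.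
  have hUU : U * U = 1 := by
    ext f
    exact hU f
  have hUunit : IsUnit U := ⟨⟨U, U, hUU, hUU⟩, rfl⟩
  have hc : IsCompactOperator (-(U * T) : 𝒦 →L[ℂ] 𝒦) := (hT.clm_comp U).neg
  have e : (1 : 𝒦 →L[ℂ] 𝒦) - -(U * T) = U * (U + T) := by rw [mul_add, hUU, sub_neg_eq_add]
  rcases hc.hasEigenvalue_or_mem_resolventSet (one_ne_zero (α := ℂ)) with h | h
  · obtain ⟨f, hf⟩ := h.exists_hasEigenvector
    have h1 : (-(U * T) : 𝒦 →L[ℂ] 𝒦) f = f := by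
      simpa using hf.apply_eq_smul
    have h2 : (U * (U + T)) f = 0 := by
      rw [← e, sub_apply, h1]
      simp
    refine absurd (hinj f ?_) hf.2
    have := congrArg U h2
    rw [map_zero] at this
    exact (hU _).symm.trans this
  · rw [spectrum.mem_resolventSet_iff, map_one, e] at h
    have h3 := hUunit.mul h
    rwa [← mul_assoc, hUU, one_mul] at h3

end RayGraph

namespace RayGraph

lemma tendsto_clm_comp {ι E F G : Type*} [NormedAddCommGroup E] [NormedSpace ℂ E]
    [NormedAddCommGroup F] [NormedSpace ℂ F] [NormedAddCommGroup G] [NormedSpace ℂ G]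
    {l : Filter ι} {S : ι → F →L[ℂ] G} {T : ι → E →L[ℂ] F} {S₀ : F →L[ℂ] G} {T₀ : E →L[ℂ] F}
    (hS : Tendsto S l (𝓝 S₀)) (hT : Tendsto T l (𝓝 T₀)) :
    Tendsto (fun i => (S i).comp (T i)) l (𝓝 (S₀.comp T₀)) :=
  (isBoundedBilinearMap_comp (𝕜 := ℂ) (E := E) (F := F) (G := G)).continuous.tendsto (S₀, T₀)
    |>.comp (hS.prodMk_nhds hT)

/-! ### Expansion of an inverse with a singular leading coefficient -/

/-- Multiplying the `S`-component of `M` by `κ⁻¹` is harmless to `M₀` because `S M₀ = 0`, and it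
leaves `n(κ)` with invertible limit `M₀ + S M₁`. The inverse of `M` thus loses only one power of
`κ`, and only on the range of `S`. -/
lemma expansion_inverse_of_singular {A : Type*} [NormedRing A] [NormedAlgebra ℂ A]
    [CompleteSpace A] {l : Filter ℂ} (hl : l ≤ 𝓝[≠] 0) {M M' : ℂ → A} {M₀ M₁ S : A} {j : ℕ}
    (hM : ∀ᶠ κ in l, M κ = M₀ + κ • M' κ) (hM' : HasExpansion l j M')
    (hlim : Tendsto M' l (𝓝 M₁)) (hS : S * S = S) (hSM : S * M₀ = 0)
    (hu : IsUnit (M₀ + S * M₁)) :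
    (∀ᶠ κ in l, IsUnit (M κ)) ∧ HasExpansion l j (fun κ => κ • Ring.inverse (M κ)) ∧
      Tendsto (fun κ => κ • Ring.inverse (M κ)) l (𝓝 (Ring.inverse (M₀ + S * M₁) * S)) := by
  have hl' : l ≤ 𝓝 0 := hl.trans nhdsWithin_le_nhds
  have hid : Tendsto (fun κ : ℂ => κ) l (𝓝 0) := hl'
  let n : ℂ → A := fun κ => M₀ + S * M' κ + κ • ((1 - S) * M' κ)
  have hn : HasExpansion l j n :=
    ((HasExpansion.const _).add (hM'.clm (ContinuousLinearMap.mul ℂ A S))).add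
      ((hM'.clm (ContinuousLinearMap.mul ℂ A (1 - S))).id_smul' hl')
  have hnlim : Tendsto n l (𝓝 (M₀ + S * M₁)) := by
    have h1 := (tendsto_const_nhds (x := M₀)).add ((tendsto_const_nhds (x := S)).mul hlim)
    have h2 := hid.smul ((tendsto_const_nhds (x := 1 - S)).mul hlim)
    simpa using h1.add h2
  have hinv := hn.inverse hl' hnlim hu
  have hnu : ∀ᶠ κ in l, IsUnit (n κ) := by
    obtain ⟨u, hu⟩ := hu
    rw [← hu] at hnlim
    exact hnlim (Units.isOpen.mem_nhds u.isUnit)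
  have hinvlim : Tendsto (fun κ => Ring.inverse (n κ)) l (𝓝 (Ring.inverse (M₀ + S * M₁))) := by
    obtain ⟨u, hu⟩ := hu
    rw [← hu] at hnlim ⊢
    exact (NormedRing.inverse_continuousAt u).tendsto.comp hnlim
  have hne : ∀ᶠ κ in l, κ ≠ 0 := hl self_mem_nhdsWithin
  have key : ∀ᶠ κ in l, IsUnit (M κ) ∧
      κ • Ring.inverse (M κ) = Ring.inverse (n κ) * (κ • (1 - S) + S) := by
    filter_upwards [hM, hnu, hne] with κ h1 h2 hκ
    have hS1 : S * (1 - S) = 0 := by rw [mul_sub, hS, mul_one, sub_self]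
    have hS2 : (1 - S) * S = 0 := by rw [sub_mul, hS, one_mul, sub_self]
    have hS3 : (1 - S) * (1 - S) = 1 - S := by rw [mul_sub, hS2, mul_one, sub_zero]
    have hk1 : κ • κ⁻¹ • S = S := smul_inv_smul₀ hκ S
    have hk2 : κ⁻¹ • κ • S = S := inv_smul_smul₀ hκ S
    have hDE : ((1 - S) + κ⁻¹ • S) * ((1 - S) + κ • S) = 1 := by
      simp only [add_mul, mul_add, smul_mul_assoc, mul_smul_comm, hS, hS1, hS2, hS3, smul_zero]
      rw [zero_add, hk1]
      abel
    have hED : ((1 - S) + κ • S) * ((1 - S) + κ⁻¹ • S) = 1 := by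
      simp only [add_mul, mul_add, smul_mul_assoc, mul_smul_comm, hS, hS1, hS2, hS3, smul_zero]
      rw [zero_add, hk2]
      abel
    have hE : IsUnit ((1 - S) + κ • S) := ⟨⟨_, _, hED, hDE⟩, rfl⟩
    -- `S n = S M'` and `(1 - S) n = M₀ + κ (1 - S) M'`, so weighting the first by `κ` reassembles
    -- `M₀ + κ M'`.
    have hEN : ((1 - S) + κ • S) * n κ = M κ := by
      rw [h1]
      have e1 : (1 - S) * M₀ = M₀ := by rw [sub_mul, hSM, one_mul, sub_zero]
      simp only [n, add_mul, mul_add, smul_mul_assoc, mul_smul_comm, ← mul_assoc, hS, hS1, hS2, hS3,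
        hSM, e1, smul_zero, zero_mul]
      have e2 : κ • (M' κ - S * M' κ) = κ • M' κ - κ • (S * M' κ) := smul_sub _ _ _
      rw [sub_mul, one_mul, add_zero, add_zero, zero_add, e2]
      abel
    have hMu : IsUnit (M κ) := hEN ▸ hE.mul h2
    refine ⟨hMu, ?_⟩
    have h3 : Ring.inverse (n κ) * ((1 - S) + κ⁻¹ • S) * M κ = 1 := by
      rw [← hEN, ← mul_assoc, mul_assoc (Ring.inverse (n κ)), hDE, mul_one,
        Ring.inverse_mul_cancel _ h2]
    have h4 : Ring.inverse (M κ) = Ring.inverse (n κ) * ((1 - S) + κ⁻¹ • S) := by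
      have h5 := congrArg (· * Ring.inverse (M κ)) h3
      simp only [one_mul] at h5
      rw [← h5, mul_assoc, Ring.mul_inverse_cancel _ hMu, mul_one]
    rw [h4, ← mul_smul_comm, smul_add, hk1]
  refine ⟨key.mono fun _ h => h.1, ?_, ?_⟩
  · refine HasExpansion.congr ?_ (key.mono fun _ h => h.2)
    have h5 : HasExpansion l j (fun κ => κ • (1 - S) + S) :=
      ((HasExpansion.const (1 - S)).id_smul' hl').add (HasExpansion.const S)
    simpa using hinv.bilin hl' (ContinuousLinearMap.mul ℂ A) h5
  · refine Tendsto.congr' (key.mono fun _ h => h.2.symm) ?_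
    have h6 : Tendsto (fun κ : ℂ => κ • (1 - S) + S) l (𝓝 S) := by
      simpa using (hid.smul (tendsto_const_nhds (x := 1 - S))).add (tendsto_const_nhds (x := S))
    exact hinvlim.mul h6

/-! ### The resolvent formula -/

section ResolventFormula

variable {H 𝒦 : Type*} [NormedAddCommGroup H] [NormedSpace ℂ H] [NormedAddCommGroup 𝒦]
  [NormedSpace ℂ 𝒦]

/-- The resolvent formula for a perturbation `P U Q` with an involution `U`. -/
lemma inverse_add_factorized {A : H →L[ℂ] H} {P : 𝒦 →L[ℂ] H} {Q : H →L[ℂ] 𝒦} {U M : 𝒦 →L[ℂ] 𝒦}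
    (hA : IsUnit A) (hU : ∀ f, U (U f) = f) (hM : IsUnit M)
    (hMe : ∀ f, M f = U f + Q (Ring.inverse A (P f))) {T : H →L[ℂ] H}
    (hT : ∀ h, T h = A h + P (U (Q h))) :
    IsUnit T ∧ ∀ h, Ring.inverse T h =
      Ring.inverse A h - Ring.inverse A (P (Ring.inverse M (Q (Ring.inverse A h)))) := by
  have hA1 : ∀ h, A (Ring.inverse A h) = h := fun h =>
    congrArg (fun T => T h) (Ring.mul_inverse_cancel _ hA)
  have hA2 : ∀ h, Ring.inverse A (A h) = h := fun h =>
    congrArg (fun T => T h) (Ring.inverse_mul_cancel _ hA)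
  have hM1 : ∀ h, M (Ring.inverse M h) = h := fun h =>
    congrArg (fun T => T h) (Ring.mul_inverse_cancel _ hM)
  have hM2 : ∀ h, Ring.inverse M (M h) = h := fun h =>
    congrArg (fun T => T h) (Ring.inverse_mul_cancel _ hM)
  have hQ : ∀ f, Q (Ring.inverse A (P f)) = M f - U f := fun f => by rw [hMe]; abel
  let X : H →L[ℂ] H := Ring.inverse A -
    (Ring.inverse A).comp (P.comp ((Ring.inverse M).comp (Q.comp (Ring.inverse A))))
  have hX : ∀ h, X h =
      Ring.inverse A h - Ring.inverse A (P (Ring.inverse M (Q (Ring.inverse A h)))) := fun h => rfl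
  have hTX : T * X = 1 := by
    ext h
    change T (X h) = h
    rw [hT, hX, map_sub, hA1, hA1, map_sub Q, hQ, hM1]
    simp only [map_sub, hU]
    abel
  have hXT : X * T = 1 := by
    ext h
    change X (T h) = h
    rw [hX, hT, map_add, hA2, map_add Q, hQ, hU, add_sub_cancel, hM2]
    abel
  have hu : IsUnit T := ⟨⟨T, X, hTX, hXT⟩, rfl⟩
  refine ⟨hu, fun h => ?_⟩
  have : Ring.inverse T = X := by
    rw [← mul_one X, ← Ring.mul_inverse_cancel _ hu, ← mul_assoc, hXT, one_mul]
  rw [this, hX]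

end ResolventFormula

/-! ### The perturbed resolvent and the kernel of `M₀` -/

section Perturbed

variable {K : Type*} {N : ℕ} [Fintype K] {𝒦 : Type*} [NormedAddCommGroup 𝒦]
  [InnerProductSpace ℂ 𝒦] [CompleteSpace 𝒦] {Γ : SimpleGraph K} {a : Fin N → K} {β : ℝ}
  {hβ : 0 ≤ β} {V : Hsp K N →L[ℂ] Hsp K N} {v : 𝒦 →L[ℂ] Ls K N β} {U : 𝒦 →L[ℂ] 𝒦}

/-- `M(κ) = U + v^* (H₀ + κ²)⁻¹ v`. -/
noncomputable def Mop (Γ : SimpleGraph K) (a : Fin N → K) (hβ : 0 ≤ β) (v : 𝒦 →L[ℂ] Ls K N β)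
    (U : 𝒦 →L[ℂ] 𝒦) (κ : ℂ) : 𝒦 →L[ℂ] 𝒦 := U + sandwich v (toBs hβ (R (H₀ Γ a) κ))

/-- The perturbation maps into `𝓛^β` and sees functions through `(𝓛^β)^*`. The outer free resolvents
can therefore be read at any weight `s ≤ β`, while `M` stays at weight `β`. -/
lemma resolvent_formula (hV : IsFactorized hβ V v U) {κ : ℂ}
    (hA : IsUnit (H₀ Γ a + κ ^ 2 • ContinuousLinearMap.id ℂ (Hsp K N)))
    (hM : IsUnit (Mop Γ a hβ v U κ)) {s : ℝ} (hs : 0 ≤ s) (hsβ : s ≤ β) :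
    IsUnit (H₀ Γ a + V + κ ^ 2 • ContinuousLinearMap.id ℂ (Hsp K N)) ∧
    toBs hs (R (H₀ Γ a + V) κ) = toBs hs (R (H₀ Γ a) κ) -
      ((toBs hs (R (H₀ Γ a) κ)).comp ((Ls.incl hsβ).comp v)).comp
        ((Ring.inverse (Mop Γ a hβ v U κ)).comp
          (((adjL v).comp (LsDual.incl hsβ)).comp (toBs hs (R (H₀ Γ a) κ)))) := by
  obtain ⟨h1, h2⟩ := inverse_add_factorized (P := (LsToH hβ).comp v)
    (Q := (adjL v).comp (HToDual hβ)) (U := U) (M := Mop Γ a hβ v U κ)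
    (T := H₀ Γ a + V + κ ^ 2 • ContinuousLinearMap.id ℂ (Hsp K N)) hA hV.involutive hM
    (fun f => rfl) (fun h => by
      have := hV.factorization h
      change H₀ Γ a h + V h + κ ^ 2 • h = (H₀ Γ a h + κ ^ 2 • h) + LsToH hβ (v (U (adj v _)))
      rw [this]
      exact add_right_comm _ _ _)
  refine ⟨h1, ?_⟩
  ext u x
  have e1 : ∀ w : Ls K N β, LsToH hs (Ls.incl hsβ w) = LsToH hβ w := fun w =>
    lp.ext (funext fun x => Ls.incl_apply hsβ w x)
  have e2 : ∀ ψ : Hsp K N, LsDual.incl hsβ (HToDual hs ψ) = HToDual hβ ψ := fun ψ =>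
    WL.ext fun x => rfl
  have h3 := congrArg (fun ψ : Hsp K N => ψ x) (h2 (LsToH hs u))
  refine h3.trans ?_
  rw [sub_apply, WL.sub_apply, toBs_apply]
  change _ - _ = _ - R (H₀ Γ a) κ (LsToH hs (Ls.incl hsβ (v (Ring.inverse (Mop Γ a hβ v U κ)
    (adjL v (LsDual.incl hsβ (HToDual hs (R (H₀ Γ a) κ (LsToH hs u))))))))) x
  rw [e1, e2]
  rfl

section Projection

variable (Γ a v U)

/-- The orthogonal projection onto the kernel of `M₀`. -/
noncomputable def kerProj (hs : 1 ≤ β) : 𝒦 →L[ℂ] 𝒦 :=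
  haveI : CompleteSpace (LinearMap.ker (Mzero Γ a v U hs).toLinearMap) :=
    (ContinuousLinearMap.isClosed_ker (Mzero Γ a v U hs)).completeSpace_coe
  (LinearMap.ker (Mzero Γ a v U hs).toLinearMap).starProjection

variable {Γ a v U} (hs : 1 ≤ β)

lemma Mzero_kerProj (f : 𝒦) : Mzero Γ a v U hs (kerProj Γ a v U hs f) = 0 := by
  have : CompleteSpace (LinearMap.ker (Mzero Γ a v U hs).toLinearMap) :=
    (ContinuousLinearMap.isClosed_ker (Mzero Γ a v U hs)).completeSpace_coe
  exact (LinearMap.ker (Mzero Γ a v U hs).toLinearMap).starProjection_apply_mem f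

lemma kerProj_of_Mzero {f : 𝒦} (hf : Mzero Γ a v U hs f = 0) : kerProj Γ a v U hs f = f := by
  have : CompleteSpace (LinearMap.ker (Mzero Γ a v U hs).toLinearMap) :=
    (ContinuousLinearMap.isClosed_ker (Mzero Γ a v U hs)).completeSpace_coe
  exact Submodule.starProjection_eq_self_iff.2 hf

lemma inner_kerProj (f g : 𝒦) :
    inner ℂ (kerProj Γ a v U hs f) g = inner ℂ f (kerProj Γ a v U hs g) := by
  have : CompleteSpace (LinearMap.ker (Mzero Γ a v U hs).toLinearMap) :=
    (ContinuousLinearMap.isClosed_ker (Mzero Γ a v U hs)).completeSpace_coe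
  exact Submodule.inner_starProjection_left_eq_right _ f g

lemma kerProj_mul_self : kerProj Γ a v U hs * kerProj Γ a v U hs = kerProj Γ a v U hs := by
  ext f
  exact kerProj_of_Mzero hs (Mzero_kerProj hs f)

/-- By symmetry of `M₀` and `S` this is the adjoint of `M₀ S = 0`. -/
lemma kerProj_mul_Mzero (hu : IsUnit (coreOp Γ a)) (hU : IsSelfAdjoint U) :
    kerProj Γ a v U hs * Mzero Γ a v U hs = 0 := by
  ext f
  refine ext_inner_right ℂ fun g => ?_
  change inner ℂ (kerProj Γ a v U hs (Mzero Γ a v U hs f)) g = inner ℂ (0 : 𝒦) g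
  rw [inner_kerProj, inner_Mzero_comm hu hU, Mzero_kerProj, inner_zero_left, inner_zero_right]

variable (Γ a v U) in
/-- `M₀ + S M₁`, which is invertible for an exceptional point of the first kind. -/
noncomputable def Nzero : 𝒦 →L[ℂ] 𝒦 :=
  Mzero Γ a v U hs + kerProj Γ a v U hs * sandwich v (Bs.incl hs greenOne)

/-- `N₀` is `U` plus a compact operator, so injectivity suffices. If `N₀ f = 0`, applying `S`
separates the equation into `M₀ f = 0` and `S M₁ f = 0`; then `⟨M₁ f, f⟩ = 0` kills all moments, and
`f = 0` since there is no bound state. -/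
lemma isUnit_Nzero (hV : IsFactorized hβ V v U) (hu : IsUnit (coreOp Γ a)) (hs2 : 2 ≤ β)
    (hE : boundSpace Γ a v U = ⊥) : IsUnit (Nzero Γ a v U hs) := by
  have e : Nzero Γ a v U hs = U + (sandwich v (Bs.incl hs (greenZero Γ a)) +
      kerProj Γ a v U hs * sandwich v (Bs.incl hs greenOne)) := by
    rw [Nzero, Mzero, add_assoc]
  rw [e]
  refine isUnit_add_of_isCompactOperator hV.involutive
    ((isCompactOperator_sandwich_incl v hs2 _).add
      ((isCompactOperator_sandwich_incl v hs2 _).clm_comp (kerProj Γ a v U hs))) fun f hf => ?_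
  rw [← e] at hf
  have h1 : Mzero Γ a v U hs f +
      kerProj Γ a v U hs (sandwich v (Bs.incl hs greenOne) f) = 0 := hf
  have h2 : kerProj Γ a v U hs (Mzero Γ a v U hs f) = 0 :=
    congrArg (fun T => T f) (kerProj_mul_Mzero hs hu hV.selfAdjoint_U)
  have h3 : kerProj Γ a v U hs (sandwich v (Bs.incl hs greenOne) f) = 0 := by
    have h := congrArg (kerProj Γ a v U hs) h1
    rwa [map_add, h2, zero_add, map_zero, kerProj_of_Mzero hs (Mzero_kerProj hs _)] at h
  rw [h3, add_zero] at h1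
  refine eq_zero_of_rayMoment_eq_zero hu hV.involutive hs hs2 hV.injective hE h1 fun α => ?_
  -- As `f = S f`, the form equals `⟨S M₁ f, f⟩`, which vanishes.
  have h4 : inner ℂ (sandwich v (Bs.incl hs greenOne) f) f = (0 : ℂ) := by
    conv_lhs => rw [← kerProj_of_Mzero hs h1]
    rw [kerProj_of_Mzero hs h1]
    nth_rewrite 2 [← kerProj_of_Mzero hs h1]
    rw [← inner_kerProj, h3, inner_zero_left]
  rw [inner_sandwich_greenOne, neg_eq_zero] at h4
  simp only [Complex.conj_mul'] at h4
  have h5 : ∑ α, ‖rayMoment v α f‖ ^ 2 = 0 := by exact_mod_cast h4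
  have h6 := (Finset.sum_eq_zero_iff_of_nonneg (fun _ _ => by positivity)).1 h5 α
    (Finset.mem_univ α)
  exact norm_eq_zero.1 (pow_eq_zero_iff two_ne_zero |>.1 h6)

end Projection

/-- The limit of `κ (H + κ²)⁻¹` in `𝓑^s`. -/
noncomputable def residue (Γ : SimpleGraph K) (a : Fin N → K) (v : 𝒦 →L[ℂ] Ls K N β)
    (U : 𝒦 →L[ℂ] 𝒦) {s : ℝ} (hs : 1 ≤ s) (hsβ : s ≤ β) : Bs K N s :=
  -((Bs.incl hs (greenZero Γ a)).comp ((Ls.incl hsβ).comp v)).comp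
    ((Ring.inverse (Nzero Γ a v U (hs.trans hsβ)) * kerProj Γ a v U (hs.trans hsβ)).comp
      (((adjL v).comp (LsDual.incl hsβ)).comp (Bs.incl hs (greenZero Γ a))))

/-- Two weight conditions appear: the outer free resolvents need `n ≤ s`, whereas `M'` comes from
dividing by `κ` at weight `β` and needs `n + 1 ≤ β`. Keeping `s` free yields the sharper weights of
the individual coefficients. -/
theorem expansion_perturbed (hV : IsFactorized hβ V v U) (hu : IsUnit (coreOp Γ a))
    (hE : boundSpace Γ a v U = ⊥) {s : ℝ} (hs : 1 ≤ s) (hsβ : s ≤ β) (hs2 : 2 ≤ β) {n : ℕ}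
    (hn : 1 ≤ n) (hns : (n : ℝ) ≤ s) (hnβ : (n : ℝ) + 1 ≤ β) :
    (∀ᶠ κ in thresholdFilter,
      IsUnit (H₀ Γ a + V + κ ^ 2 • ContinuousLinearMap.id ℂ (Hsp K N))) ∧
    HasExpansion thresholdFilter n
      (fun κ => κ • toBs (zero_le_one.trans hs) (R (H₀ Γ a + V) κ)) ∧
    Tendsto (fun κ => κ • toBs (zero_le_one.trans hs) (R (H₀ Γ a + V) κ)) thresholdFilter
      (𝓝 (residue Γ a v U hs hsβ)) := by
  have h1β : 1 ≤ β := hs.trans hsβ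
  obtain ⟨F', h1, h2, h3⟩ := exists_free_expansion (Γ := Γ) (a := a) hu h1β hn hnβ
  have hM : ∀ᶠ κ in thresholdFilter, Mop Γ a hβ v U κ =
      Mzero Γ a v U h1β + κ • sandwichL v (F' κ) := by
    filter_upwards [h2] with κ e
    rw [Mop, e, Mzero, add_assoc, ← sandwichL_apply, map_add, map_smul, sandwichL_apply]
  obtain ⟨hMu, hMe, hMl⟩ := expansion_inverse_of_singular thresholdFilter_le_punctured hM
    (h1.clm (sandwichL v)) (((sandwichL v).continuous.tendsto _).comp h3)
    (kerProj_mul_self h1β) (kerProj_mul_Mzero h1β hu hV.selfAdjoint_U)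
    (isUnit_Nzero h1β hV hu hs2 hE)
  have hF := hasExpansion_free (Γ := Γ) (a := a) hu (zero_le_one.trans hs) hn hns
  have hFl := tendsto_free (Γ := Γ) (a := a) hu hs
  have key : ∀ᶠ κ in thresholdFilter,
      IsUnit (H₀ Γ a + V + κ ^ 2 • ContinuousLinearMap.id ℂ (Hsp K N)) ∧
      κ • toBs (zero_le_one.trans hs) (R (H₀ Γ a + V) κ) =
        κ • toBs (zero_le_one.trans hs) (R (H₀ Γ a) κ) -
        ((toBs (zero_le_one.trans hs) (R (H₀ Γ a) κ)).comp ((Ls.incl hsβ).comp v)).comp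
        ((κ • Ring.inverse (Mop Γ a hβ v U κ)).comp (((adjL v).comp (LsDual.incl hsβ)).comp
          (toBs (zero_le_one.trans hs) (R (H₀ Γ a) κ)))) := by
    filter_upwards [hMu, eventually_norm_theta_lt_one, eventually_isUnit_coreShift hu]
      with κ hκ hθ hc
    obtain ⟨e1, e2⟩ := resolvent_formula hV (isUnit_freeOp hθ hc) hκ (zero_le_one.trans hs) hsβ
    refine ⟨e1, ?_⟩
    rw [e2, smul_sub]
    congr 1
    ext u x
    simp
  refine ⟨key.mono fun _ h => h.1, ?_, ?_⟩
  · refine HasExpansion.congr ?_ (key.mono fun _ h => h.2)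
    refine (hF.id_smul' thresholdFilter_le).sub ?_
    exact (hF.comp thresholdFilter_le (HasExpansion.const _)).comp thresholdFilter_le
      (hMe.comp thresholdFilter_le ((HasExpansion.const _).comp thresholdFilter_le hF))
  · refine Tendsto.congr' (key.mono fun _ h => h.2.symm) ?_
    have h5 := (hF.tendsto_smul_zero thresholdFilter_le).sub
      (tendsto_clm_comp (tendsto_clm_comp hFl (tendsto_const_nhds (x := (Ls.incl hsβ).comp v)))
        (tendsto_clm_comp hMl (tendsto_clm_comp
          (tendsto_const_nhds (x := (adjL v).comp (LsDual.incl hsβ))) hFl)))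
    rw [zero_sub] at h5
    exact h5

end Perturbed

end RayGraph

namespace RayGraph

section Residue

variable {K : Type*} {N : ℕ} [Fintype K] {𝒦 : Type*} [NormedAddCommGroup 𝒦]
  [InnerProductSpace ℂ 𝒦] [CompleteSpace 𝒦] {Γ : SimpleGraph K} {a : Fin N → K} {β : ℝ}
  {hβ : 0 ≤ β} {V : Hsp K N →L[ℂ] Hsp K N} {v : 𝒦 →L[ℂ] Ls K N β} {U : 𝒦 →L[ℂ] 𝒦}

/-! ### The residue and the resonance projection -/

/-- The vector of the ray moments `p_α(f)` as a linear map. -/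
noncomputable def momentMap (hs : 1 ≤ β) (v : 𝒦 →L[ℂ] Ls K N β) :
    𝒦 →ₗ[ℂ] EuclideanSpace ℂ (Fin N) :=
  (WithLp.linearEquiv 2 ℂ (Fin N → ℂ)).symm.toLinearMap.comp
    (LinearMap.pi fun α => ((pairCLM (coordRay α)).comp ((Ls.incl hs).comp v)).toLinearMap)

lemma momentMap_apply (hs : 1 ≤ β) (f : 𝒦) (α : Fin N) :
    momentMap hs v f α = rayMoment v α f := by
  change pairing (WL.toFun (coordRay α)) (WL.toFun (Ls.incl hs (v f))) = _
  rw [Ls.toFun_incl, rayMoment]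

/-- `f ↦ G₀ v f` as a linear map. -/
noncomputable def genEigenfunL (Γ : SimpleGraph K) (a : Fin N → K) (v : 𝒦 →L[ℂ] Ls K N β)
    (hs : 1 ≤ β) : 𝒦 →ₗ[ℂ] (Vtx K N → ℂ) :=
  WL.toFun.comp ((Bs.incl hs (greenZero Γ a)).comp v).toLinearMap

lemma genEigenfunL_apply (hs : 1 ≤ β) (f : 𝒦) :
    genEigenfunL Γ a v hs f = WL.toFun (genEigenfun Γ a v hs f) := rfl

lemma inner_sandwich_greenOne_eq (hs : 1 ≤ β) (f g : 𝒦) :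
    inner ℂ (sandwich v (Bs.incl hs greenOne) f) g =
      -inner ℂ (momentMap hs v f) (momentMap hs v g) := by
  rw [inner_sandwich_greenOne, PiLp.inner_apply]
  congr 1
  refine Finset.sum_congr rfl fun α _ => ?_
  rw [momentMap_apply, momentMap_apply, RCLike.inner_apply, mul_comm]

/-- The inverse of `M₀ + S M₁` on the kernel of `M₀`, in a basis with orthonormal moments. -/
lemma inverse_Nzero_kerProj (hs : 1 ≤ β) (hN : IsUnit (Nzero Γ a v U hs)) {d : ℕ} {f : Fin d → 𝒦}
    (hf : ∀ γ, Mzero Γ a v U hs (f γ) = 0)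
    (hon : Orthonormal ℂ fun γ => momentMap hs v (f γ))
    (hspan : ∀ h, Mzero Γ a v U hs h = 0 → ∃ b : Fin d → ℂ, h = ∑ γ, b γ • f γ) (g : 𝒦) :
    Ring.inverse (Nzero Γ a v U hs) (kerProj Γ a v U hs g) =
      -∑ γ, inner ℂ (f γ) g • f γ := by
  set h : 𝒦 := -∑ γ, inner ℂ (f γ) g • f γ with hh
  have h0 : Mzero Γ a v U hs h = 0 := by simp [hh, hf]
  -- Minus the form of `M₁` is the inner product of moment vectors, which are orthonormal along `f`;
  -- hence `M₁ h` and `g` have the same inner products with `ker M₀`, that is `S M₁ h = S g`.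
  have hbasis : ∀ δ, inner ℂ (sandwich v (Bs.incl hs greenOne) h) (f δ) = inner ℂ g (f δ) := by
    intro δ
    rw [inner_sandwich_greenOne_eq, hh, map_neg, inner_neg_left, neg_neg, map_sum, sum_inner]
    simp only [map_smul, inner_smul_left, orthonormal_iff_ite.1 hon]
    simp
  have h1 : kerProj Γ a v U hs (sandwich v (Bs.incl hs greenOne) h) = kerProj Γ a v U hs g := by
    refine ext_inner_right ℂ fun k => ?_
    rw [inner_kerProj, inner_kerProj]
    obtain ⟨b, hb⟩ := hspan _ (Mzero_kerProj hs k)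
    rw [hb]
    simp only [inner_sum, inner_smul_right, hbasis]
  have h2 : Nzero Γ a v U hs h = kerProj Γ a v U hs g := by
    rw [← h1]
    change Mzero Γ a v U hs h + kerProj Γ a v U hs (sandwich v (Bs.incl hs greenOne) h) = _
    rw [h0, zero_add]
  rw [← h2]
  exact congrArg (fun T => T h) (Ring.inverse_mul_cancel _ hN)

/-- Symmetry of `G₀` turns `⟨f_γ, v^* G₀ u⟩` into `⟨G₀ v f_γ, u⟩`; the minus sign of the resolvent
formula cancels that of `N₀⁻¹ S`. -/
lemma residue_apply (hu : IsUnit (coreOp Γ a)) {s : ℝ} (hs : 1 ≤ s) (hsβ : s ≤ β)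
    (hN : IsUnit (Nzero Γ a v U (hs.trans hsβ))) {d : ℕ} {f : Fin d → 𝒦}
    (hf : ∀ γ, Mzero Γ a v U (hs.trans hsβ) (f γ) = 0)
    (hon : Orthonormal ℂ fun γ => momentMap (hs.trans hsβ) v (f γ))
    (hspan : ∀ h, Mzero Γ a v U (hs.trans hsβ) h = 0 → ∃ b : Fin d → ℂ, h = ∑ γ, b γ • f γ) :
    IsSumRankOne (fun γ => WL.toFun (genEigenfun Γ a v (hs.trans hsβ) (f γ)))
      (residue Γ a v U hs hsβ) := by
  intro u x
  set g : 𝒦 := adjL v (LsDual.incl hsβ (Bs.incl hs (greenZero Γ a) u)) with hg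
  have e1 : ∀ w : Ls K N β, Bs.incl hs (greenZero Γ a) (Ls.incl hsβ w) x =
      Bs.incl (hs.trans hsβ) (greenZero Γ a) w x := by
    intro w
    have h : Ls.incl hs (Ls.incl hsβ w) = Ls.incl (hs.trans hsβ) w :=
      WL.ext fun x => by rw [Ls.incl_apply, Ls.incl_apply, Ls.incl_apply]
    rw [Bs.incl_apply, Bs.incl_apply, h]
  have e2 : residue Γ a v U hs hsβ u =
      -Bs.incl hs (greenZero Γ a) (Ls.incl hsβ (v
        (Ring.inverse (Nzero Γ a v U (hs.trans hsβ)) (kerProj Γ a v U (hs.trans hsβ) g)))) := rfl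
  have e3 : ∀ γ, inner ℂ (f γ) g =
      pairing (WL.toFun (genEigenfun Γ a v (hs.trans hsβ) (f γ))) (WL.toFun u) := by
    intro γ
    rw [← inner_conj_symm, hg, adjL_apply, inner_adj, conj_pairing, LsDual.toFun_incl,
      Bs.toFun_incl, genEigenfun, Bs.toFun_incl,
      ← Ls.toFun_incl (hs.trans hsβ), ← Bs.pairing_comm (conj_greenZero_delta hu), Ls.toFun_incl]
  rw [e2, inverse_Nzero_kerProj (hs.trans hsβ) hN hf hon hspan g]
  simp only [map_neg, map_sum, map_smul, neg_neg, WL.sum_apply, WL.smul_apply, e1, e3]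
  rfl

/-! ### Resonance bases -/

lemma exists_coeff_of_isResonanceBasis {ℰ E : Submodule ℂ (Vtx K N → ℂ)} (hE : E = ⊥) {d : ℕ}
    {Ψ : Fin d → ℰ} (h : IsResonanceBasis ℰ E Ψ) (Φ : ℰ) :
    ∃ b : Fin d → ℂ, Φ.1 = ∑ γ, b γ • (Ψ γ).1 := by
  have h1 : (E.comap ℰ.subtype).mkQ Φ ∈
      Submodule.span ℂ (Set.range fun γ => (E.comap ℰ.subtype).mkQ (Ψ γ)) := by
    rw [h.2]
    trivial
  obtain ⟨b, hb⟩ := (Submodule.mem_span_range_iff_exists_fun ℂ).1 h1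
  refine ⟨b, ?_⟩
  simp only [← map_smul, ← map_sum] at hb
  rw [← sub_eq_zero, ← map_sub, Submodule.mkQ_apply, Submodule.Quotient.mk_eq_zero,
    Submodule.mem_comap, hE, Submodule.mem_bot, map_sub, map_sum, sub_eq_zero] at hb
  exact hb.symm

/-- Leading coefficients modulo `𝓛^{β-2}` are unique, so the orthonormal vectors in the definition
of a resonance basis must be the moment vectors. -/
lemma moment_eq_of_sub_mem (hs : 1 ≤ β) (hs2 : 2 ≤ β) {f : 𝒦} {c : EuclideanSpace ℂ (Fin N)}
    (h : WL.toFun (genEigenfun Γ a v hs f) - ∑ α, c α • oneRay α ∈ wlp K N 1 (β - 2)) :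
    momentMap hs v f = c := by
  have h1 := Submodule.sub_mem _ h (genEigenfun_sub_mem (Γ := Γ) (a := a) (v := v) hs hs2 f)
  have h2 : ∑ α, (rayMoment v α f - c α) • oneRay (K := K) α ∈ wlp K N 1 (β - 2) := by
    convert h1 using 1
    simp only [sub_smul, Finset.sum_sub_distrib]
    abel
  have h3 := eq_zero_of_sum_smul_oneRay_mem (by linarith) h2
  ext α
  rw [momentMap_apply]
  exact sub_eq_zero.1 (congrFun h3 α)

/-- Every orthonormal resonance basis yields the residue. -/
lemma isSumRankOne_residue (hV : IsFactorized hβ V v U) (hu : IsUnit (coreOp Γ a)) (hs2 : 2 ≤ β)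
    (hE : boundSpace Γ a v U = ⊥) {s : ℝ} (hs : 1 ≤ s) (hsβ : s ≤ β) {d : ℕ}
    {Ψ : Fin d → resonanceSpace Γ a v U}
    (h : IsOrthonormalResonanceBasis β (resonanceSpace Γ a v U) (boundSpace Γ a v U) Ψ) :
    IsSumRankOne (fun γ => (Ψ γ).1) (residue Γ a v U hs hsβ) := by
  have h1β := hs.trans hsβ
  choose f hf hfΨ using fun γ =>
    exists_of_mem_resonanceSpace hu hV.involutive h1β hs2 (Ψ γ).2
  obtain ⟨hb, -, c, hc, hcΨ⟩ := h
  have hmc : ∀ γ, momentMap h1β v (f γ) = c γ := fun γ =>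
    moment_eq_of_sub_mem (Γ := Γ) (a := a) h1β hs2 (by rw [hfΨ]; exact hcΨ γ)
  have hres := residue_apply hu hs hsβ (isUnit_Nzero h1β hV hu hs2 hE) hf
    (by simpa only [hmc] using hc) (fun h hh => by
      obtain ⟨b, hb⟩ := exists_coeff_of_isResonanceBasis hE hb
        ⟨_, genEigenfun_mem_resonanceSpace hu hV.involutive h1β hs2 hh⟩
      refine ⟨b, sub_eq_zero.1 (genEigenfun_injective hu h1β hV.injective ?_)⟩
      rw [← genEigenfunL_apply, map_sub, map_sum, sub_eq_zero]
      simp only [map_smul, genEigenfunL_apply, hfΨ]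
      exact hb)
  simpa only [hfΨ] using hres

/-- Orthonormal resonance bases exist. -/
lemma exists_orthonormalResonanceBasis (hV : IsFactorized hβ V v U) (hu : IsUnit (coreOp Γ a))
    (hs2 : 2 ≤ β) (hE : boundSpace Γ a v U = ⊥) :
    ∃ (d : ℕ) (Ψ : Fin d → resonanceSpace Γ a v U),
      IsOrthonormalResonanceBasis β (resonanceSpace Γ a v U) (boundSpace Γ a v U) Ψ := by
  have h1β : 1 ≤ β := by linarith
  -- The moment map embeds `ker M₀` in `ℂ^N`; an orthonormal basis of the image pulls back to the
  -- desired family, and `𝓔` is seen to be finite-dimensional.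
  let R : Submodule ℂ (EuclideanSpace ℂ (Fin N)) :=
    (LinearMap.ker (Mzero Γ a v U h1β).toLinearMap).map (momentMap h1β v)
  let e := stdOrthonormalBasis ℂ R
  have hmem : ∀ γ, ∃ f, Mzero Γ a v U h1β f = 0 ∧ momentMap h1β v f = (e γ : EuclideanSpace ℂ _) :=
    fun γ => (Submodule.mem_map.1 (e γ).2)
  choose f hf hfe using hmem
  have hinj : ∀ h, Mzero Γ a v U h1β h = 0 → momentMap h1β v h = 0 → h = 0 := fun h hh hm =>
    eq_zero_of_rayMoment_eq_zero hu hV.involutive h1β hs2 hV.injective hE hh fun α => by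
      rw [← momentMap_apply h1β, hm]
      rfl
  have hon : Orthonormal ℂ fun γ => (e γ : EuclideanSpace ℂ (Fin N)) :=
    e.orthonormal.comp_linearIsometry R.subtypeₗᵢ
  let Ψ : Fin (Module.finrank ℂ R) → resonanceSpace Γ a v U := fun γ =>
    ⟨_, genEigenfun_mem_resonanceSpace hu hV.involutive h1β hs2 (hf γ)⟩
  have hΨ : ∀ γ, (Ψ γ).1 = genEigenfunL Γ a v h1β (f γ) := fun γ => rfl
  have hsum : ∀ b : Fin (Module.finrank ℂ R) → ℂ,
      (∑ γ, b γ • Ψ γ).1 = genEigenfunL Γ a v h1β (∑ γ, b γ • f γ) := fun b => by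
    rw [map_sum, Submodule.coe_sum]
    exact Finset.sum_congr rfl fun γ _ => by rw [map_smul, Submodule.coe_smul, hΨ]
  refine ⟨_, Ψ, ⟨?_, ?_⟩, ?_, fun γ => e γ, hon, fun γ => ?_⟩
  · rw [Fintype.linearIndependent_iff]
    intro b hb
    simp only [← map_smul, ← map_sum] at hb
    rw [Submodule.mkQ_apply, Submodule.Quotient.mk_eq_zero, Submodule.mem_comap, hE,
      Submodule.mem_bot, Submodule.subtype_apply, hsum] at hb
    have h1 := genEigenfun_injective hu h1β hV.injective hb
    have h2 := congrArg (momentMap h1β v) h1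
    simp only [map_sum, map_smul, hfe, map_zero] at h2
    exact Fintype.linearIndependent_iff.1 hon.linearIndependent b h2
  · rw [eq_top_iff]
    rintro q -
    obtain ⟨Φ, rfl⟩ := Submodule.mkQ_surjective _ q
    obtain ⟨h, hh, hhΦ⟩ := exists_of_mem_resonanceSpace hu hV.involutive h1β hs2 Φ.2
    have h3 : momentMap h1β v h ∈ R := ⟨h, hh, rfl⟩
    obtain ⟨b, hb⟩ : ∃ b : Fin (Module.finrank ℂ R) → ℂ,
        momentMap h1β v h = ∑ γ, b γ • (e γ : EuclideanSpace ℂ (Fin N)) := by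
      refine ⟨fun γ => e.repr ⟨_, h3⟩ γ, ?_⟩
      have := congrArg (Subtype.val) (e.sum_repr ⟨_, h3⟩)
      refine this.symm.trans ?_
      rw [Submodule.coe_sum]
      rfl
    have h4 : h = ∑ γ, b γ • f γ := by
      refine sub_eq_zero.1 (hinj _ ?_ ?_)
      · simp [hh, hf]
      · rw [map_sub, hb, map_sum, sub_eq_zero]
        simp only [map_smul, hfe]
    have h5 : Φ = ∑ γ, b γ • Ψ γ := Subtype.ext (by
      rw [hsum, ← h4, genEigenfunL_apply, hhΦ])
    rw [h5, map_sum]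
    refine Submodule.sum_mem _ fun γ _ => ?_
    rw [map_smul]
    exact Submodule.smul_mem _ _ (Submodule.subset_span ⟨γ, rfl⟩)
  · intro γ Φ hΦ
    rw [hE, Submodule.mem_bot] at hΦ
    subst hΦ
    refine ⟨?_, by simp [pairing]⟩
    have e : (fun x : Vtx K N => conj ((0 : Vtx K N → ℂ) x) * (Ψ γ).1 x) = 0 := by
      funext x
      simp
    rw [e]
    exact Submodule.zero_mem _
  · have := genEigenfun_sub_mem (Γ := Γ) (a := a) (v := v) h1β hs2 (f γ)
    simp only [← momentMap_apply h1β, hfe] at this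
    exact this

/-- The residue does not vanish at an exceptional point of the first kind. -/
lemma residue_ne_zero (hV : IsFactorized hβ V v U) (hu : IsUnit (coreOp Γ a)) (hs2 : 2 ≤ β)
    (hfirst : IsExceptionalFirstKind Γ a v U) {s : ℝ} (hs : 1 ≤ s) (hsβ : s ≤ β) :
    residue Γ a v U hs hsβ ≠ 0 := by
  intro h0
  obtain ⟨d, Ψ, hΨ⟩ := exists_orthonormalResonanceBasis hV hu hs2 hfirst.2
  have h1 := isSumRankOne_residue hV hu hs2 hfirst.2 hs hsβ hΨ
  have h2 : ∀ γ, (Ψ γ).1 = 0 := by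
    intro γ
    funext x
    have h3 := h1 (delta s x) x
    rw [h0] at h3
    -- A diagonal matrix element of the projection is a sum of squares, so a vanishing residue would
    -- annihilate the whole resonance basis.
    have h4 : ∑ γ, conj ((Ψ γ).1 x) * (Ψ γ).1 x = 0 := by
      simp only [pairing_delta] at h3
      rw [← h3]
      rfl
    simp only [Complex.conj_mul'] at h4
    have h5 : ∑ γ, ‖(Ψ γ).1 x‖ ^ 2 = 0 := by exact_mod_cast h4
    have h6 := (Finset.sum_eq_zero_iff_of_nonneg (fun _ _ => by positivity)).1 h5 γ
      (Finset.mem_univ γ)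
    exact norm_eq_zero.1 (pow_eq_zero_iff two_ne_zero |>.1 h6)
  refine hfirst.1.ne (le_antisymm hfirst.1.le fun Φ hΦ => ?_)
  obtain ⟨b, hb⟩ := exists_coeff_of_isResonanceBasis hfirst.2 hΨ.1 ⟨Φ, hΦ⟩
  simp only [h2, smul_zero, Finset.sum_const_zero] at hb
  rw [hb]
  exact Submodule.zero_mem _

/-- At an exceptional point of the first kind there is a half-line. -/
lemma IsExceptionalFirstKind.nonempty_ray (h : IsExceptionalFirstKind Γ a v U) :
    Nonempty (Fin N) := by
  by_contra hN
  rw [not_nonempty_iff] at hN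
  refine h.1.ne (le_antisymm h.1.le fun Φ hΦ => ⟨hΦ.1, ?_⟩)
  obtain ⟨c, hc⟩ := mem_span_oneRay_sup.1 hΦ.2
  simpa using hc

end Residue

end RayGraph

namespace RayGraph

/-! ### The coefficients at different weights, and the bound projection -/

section Main

variable {K : Type*} {N : ℕ}

/-- The matrix coefficient `T ↦ (T u)[x]` as a continuous functional on `𝓑^s`. -/
noncomputable def Bs.coeffCLM {s : ℝ} (u : Ls K N s) (x : Vtx K N) : Bs K N s →L[ℂ] ℂ :=
  (WL.eval ∞ (-s) x).comp (ContinuousLinearMap.apply ℂ (LsDual K N s) u)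

lemma Bs.coeffCLM_apply {s : ℝ} (u : Ls K N s) (x : Vtx K N) (T : Bs K N s) :
    Bs.coeffCLM u x T = T u x := rfl

lemma isBigO_coeff {s : ℝ} {l : Filter ℂ} {n : ℕ} {F : ℂ → Bs K N s} {c : ℕ → Bs K N s}
    (h : (fun κ => F κ - ∑ i ∈ Finset.range n, κ ^ i • c i) =O[l] (fun κ => κ ^ n))
    (u : Ls K N s) (x : Vtx K N) :
    (fun κ => F κ u x - ∑ i ∈ Finset.range n, κ ^ i • c i u x) =O[l] (fun κ => κ ^ n) := by
  refine (IsBigO.trans ((Bs.coeffCLM u x).isBigO_comp _ l) h).congr_left fun κ => ?_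
  simp only [map_sub, map_sum, map_smul, Bs.coeffCLM_apply]

/-- Coefficients of expansions of one and the same operator on `𝓗`, taken in `𝓑^s` and
in `𝓑^t`, agree. -/
lemma belongsTo_coeff {s t : ℝ} (hs : 0 ≤ s) (ht : 0 ≤ t) {l : Filter ℂ} (hl : l ≤ 𝓝[≠] 0)
    [l.NeBot] {T : ℂ → Hsp K N →L[ℂ] Hsp K N} {m n : ℕ} (hmn : m ≤ n) {c : ℕ → Bs K N s}
    {d : ℕ → Bs K N t}
    (hc : (fun κ => κ • toBs hs (T κ) - ∑ i ∈ Finset.range n, κ ^ i • c i) =O[l] (fun κ => κ ^ n))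
    (hd : (fun κ => κ • toBs ht (T κ) - ∑ i ∈ Finset.range m, κ ^ i • d i) =O[l] (fun κ => κ ^ m))
    {i : ℕ} (hi : i < m) : BelongsTo t (c i) := by
  refine ⟨d i, fun u u' huu x => ?_⟩
  have e : LsToH hs u = LsToH ht u' := lp.ext (funext huu)
  have h1 := isBigO_coeff hc u x
  have h2 := isBigO_coeff hd u' x
  have h3 : ∀ κ, (κ • toBs hs (T κ)) u x = (κ • toBs ht (T κ)) u' x := fun κ => by
    rw [smul_apply, smul_apply, WL.smul_apply, WL.smul_apply, toBs_apply, toBs_apply, e]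
  have h4 : (fun κ => (κ • toBs ht (T κ)) u' x - ∑ i ∈ Finset.range n, κ ^ i • c i u x)
      =O[l] (fun κ => κ ^ n) := h1.congr_left fun κ => by rw [h3]
  exact coeff_unique_of_isBigO (c := fun i => c i u x) (d := fun i => d i u' x) hl hmn h4 h2 hi

lemma isBoundProjection_bot {s : ℝ} :
    IsBoundProjection (⊥ : Submodule ℂ (Vtx K N → ℂ)) (0 : Bs K N s) := by
  refine ⟨⟨0, Fin.elim0, linearIndependent_empty_type, Subsingleton.elim _ _,
    fun γ => γ.elim0⟩, fun d Ψ _ u x => ?_⟩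
  refine (Finset.sum_eq_zero fun γ _ => ?_).symm
  change _ * (Ψ γ).1 x = 0
  rw [(Submodule.mem_bot ℂ).1 (Ψ γ).2, Pi.zero_apply, mul_zero]

lemma notMem_spectrum_of_isUnit {H : Hsp K N →L[ℂ] Hsp K N} {κ : ℂ}
    (h : IsUnit (H + κ ^ 2 • ContinuousLinearMap.id ℂ (Hsp K N))) : -κ ^ 2 ∉ spectrum ℂ H := by
  rw [spectrum.notMem_iff]
  convert h.neg using 1
  rw [Algebra.algebraMap_eq_smul_one, neg_smul, neg_add']
  exact sub_eq_add_neg _ _ |>.trans (add_comm _ _)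

/-- Division of an expansion by `κ`. -/
lemma isBigO_laurent_of_isBigO {E : Type*} [NormedAddCommGroup E] [NormedSpace ℂ E]
    {l : Filter ℂ} (hl : l ≤ 𝓝[≠] 0) {n : ℕ} {F : ℂ → E} {c : ℕ → E} {G : ℤ → E}
    (hG : ∀ i < n, G ((i : ℤ) - 1) = c i)
    (h : (fun κ => κ • F κ - ∑ i ∈ Finset.range n, κ ^ i • c i) =O[l] (fun κ => κ ^ n)) :
    (fun κ => F κ - ∑ j ∈ Finset.Icc (-1 : ℤ) ((n : ℤ) - 2), κ ^ j • G j)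
      =O[l] (fun κ : ℂ => κ ^ ((n : ℤ) - 1)) := by
  have hne : ∀ᶠ κ in l, κ ≠ 0 := hl self_mem_nhdsWithin
  have h1 := (isBigO_refl (fun κ : ℂ => κ⁻¹) l).smul h
  refine h1.congr' ?_ ?_
  · filter_upwards [hne] with κ hκ
    rw [smul_sub, inv_smul_smul₀ hκ, Finset.smul_sum]
    congr 1
    refine Finset.sum_bij (fun i _ => (i : ℤ) - 1) ?_ ?_ ?_ ?_
    · intro i hi
      rw [Finset.mem_range] at hi
      rw [Finset.mem_Icc]
      omega
    · intro i _ j _ hij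
      omega
    · intro j hj
      rw [Finset.mem_Icc] at hj
      refine ⟨(j + 1).toNat, ?_, ?_⟩
      · rw [Finset.mem_range]
        omega
      · omega
    · intro i hi
      rw [hG i (Finset.mem_range.1 hi), smul_smul, zpow_sub_one₀ hκ, zpow_natCast, mul_comm]
  · filter_upwards [hne] with κ hκ
    rw [zpow_sub_one₀ hκ, zpow_natCast, smul_eq_mul, mul_comm]

end Main

end RayGraph

/-! ### The expansion at an exceptional point of the first kind -/

open RayGraph

theorem theorem3p6
    {K : Type*} [Fintype K] {N : ℕ} (Γ : SimpleGraph K) (hΓ : Γ.Connected) (a : Fin N → K)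
    {𝒦 : Type*} [NormedAddCommGroup 𝒦] [InnerProductSpace ℂ 𝒦] [CompleteSpace 𝒦]
    (β : ℕ) (hβ : 3 ≤ β)
    (V : Hsp K N →L[ℂ] Hsp K N) (v : 𝒦 →L[ℂ] Ls K N β) (U : 𝒦 →L[ℂ] 𝒦)
    (hV : IsFactorized β.cast_nonneg V v U)
    (hfirst : IsExceptionalFirstKind Γ a v U) :
    (∀ᶠ κ : ℂ in 𝓝[{κ : ℂ | 0 < κ.re}] 0, -κ ^ 2 ∉ spectrum ℂ (H₀ Γ a + V)) ∧
    ∃ G : ℤ → Bs K N ((β : ℝ) - 1),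
      (fun κ : ℂ => toBs (sub_one_nonneg' hβ) (R (H₀ Γ a + V) κ) -
          ∑ j ∈ Finset.Icc (-1 : ℤ) ((β : ℤ) - 4), κ ^ j • G j)
        =O[𝓝[{κ : ℂ | 0 < κ.re}] 0] (fun κ : ℂ => κ ^ ((β : ℤ) - 3)) ∧
      (∀ j : ℤ, -1 ≤ j → j ≤ (β : ℤ) - 4 → Even j → BelongsTo ((j : ℝ) + 3) (G j)) ∧
      (∀ j : ℤ, -1 ≤ j → j ≤ (β : ℤ) - 4 → Odd j → BelongsTo ((j : ℝ) + 2) (G j)) ∧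
      IsBoundProjection (boundSpace Γ a v U) (G (-2)) ∧ G (-2) = 0 ∧
      IsResonanceProjection β (resonanceSpace Γ a v U) (boundSpace Γ a v U) (G (-1)) ∧
      G (-1) ≠ 0 := by
  obtain ⟨α₀⟩ := hfirst.nonempty_ray
  have hu : IsUnit (coreOp Γ a) := isUnit_coreOp hΓ α₀
  have hE : boundSpace Γ a v U = ⊥ := hfirst.2
  have hβ3 : (3 : ℝ) ≤ β := by exact_mod_cast hβ
  have hs2 : (2 : ℝ) ≤ β := by linarith
  have hs : (1 : ℝ) ≤ (β : ℝ) - 1 := by linarith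
  have hsβ : (β : ℝ) - 1 ≤ β := by linarith
  have hcast : ((β - 2 : ℕ) : ℝ) = (β : ℝ) - 2 := by
    rw [Nat.cast_sub (by omega)]
    norm_num
  have hl := thresholdFilter_le_punctured
  -- The `β - 2` coefficients of `κ R(κ)` are those of `R(κ)` for `-1 ≤ j ≤ β - 4`.
  obtain ⟨hunit, hexp, hlim⟩ := expansion_perturbed hV hu hE hs hsβ hs2 (n := β - 2) (by omega)
    (by linarith) (by linarith)
  obtain ⟨c, hc⟩ := hexp.exists_isBigO
  have hc0 : c 0 = residue Γ a v U hs hsβ :=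
    coeff_zero_eq_of_tendsto thresholdFilter_le (by omega) hc hlim
  -- The coefficient of `κ^j` is number `j + 1` of `κ R(κ)`, so an expansion with `j + 2` terms
  -- reaches it; weight `t ≥ j + 2` suffices for that.
  have hbelongs : ∀ (j : ℤ) (t : ℝ), -1 ≤ j → j ≤ (β : ℤ) - 4 → 1 ≤ t → t ≤ β → (j : ℝ) + 2 ≤ t →
      BelongsTo t (c (j + 1).toNat) := by
    intro j t hj hjβ ht htβ hjt
    obtain ⟨m, rfl⟩ : ∃ m : ℕ, j = (m : ℤ) - 1 := ⟨(j + 1).toNat, by omega⟩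
    push_cast at hjt
    have hm : ((m + 1 : ℕ) : ℝ) + 1 ≤ β := by
      have : m + 1 + 1 ≤ β := by omega
      exact_mod_cast this
    obtain ⟨-, hexp', -⟩ := expansion_perturbed hV hu hE ht htβ hs2 (n := m + 1) (by omega)
      (by push_cast; linarith) hm
    obtain ⟨d, hd⟩ := hexp'.exists_isBigO
    exact belongsTo_coeff _ _ hl (by omega) hc hd (by omega)
  refine ⟨hunit.mono fun κ h => notMem_spectrum_of_isUnit h,
    -- Since `(j + 1).toNat` would also return index `0` for `j ≤ -2`, those coefficients are set to
    -- zero separately.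
    fun j => if j ≤ -2 then 0 else c (j + 1).toNat, ?_, ?_, ?_, ?_, ?_, ?_, ?_⟩
  · have h := isBigO_laurent_of_isBigO hl (G := fun j => if j ≤ -2 then 0 else c (j + 1).toNat)
      (fun i _ => by rw [if_neg (by omega), sub_add_cancel, Int.toNat_natCast]) hc
    have e1 : ((β - 2 : ℕ) : ℤ) - 2 = (β : ℤ) - 4 := by omega
    have e2 : ((β - 2 : ℕ) : ℤ) - 1 = (β : ℤ) - 3 := by omega
    rw [e1, e2] at h
    exact h
  · intro j hj hjβ heven
    have hj0 : 0 ≤ j := by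
      obtain ⟨k, rfl⟩ := heven
      omega
    have h0 : (0 : ℝ) ≤ j := by exact_mod_cast hj0
    have h1 : (j : ℝ) ≤ β - 4 := by exact_mod_cast hjβ
    dsimp only
    rw [if_neg (by omega)]
    -- Weight `j + 2` is already available for every `j`; the weight `j + 3` asked for even `j` is a
    -- weaker condition.
    exact hbelongs j _ hj hjβ (by linarith) (by linarith) (by linarith)
  · intro j hj hjβ _
    have h0 : (-1 : ℝ) ≤ j := by exact_mod_cast hj
    have h1 : (j : ℝ) ≤ β - 4 := by exact_mod_cast hjβ
    dsimp only
    rw [if_neg (by omega)]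
    exact hbelongs j _ hj hjβ (by linarith) (by linarith) le_rfl
  · dsimp only
    rw [if_pos le_rfl, hE]
    exact isBoundProjection_bot
  · exact if_pos le_rfl
  · have e : (if (-1 : ℤ) ≤ -2 then 0 else c ((-1 : ℤ) + 1).toNat) = residue Γ a v U hs hsβ := hc0
    dsimp only
    rw [e]
    exact ⟨exists_orthonormalResonanceBasis hV hu hs2 hE,
      fun d Ψ hΨ => isSumRankOne_residue hV hu hs2 hE hs hsβ hΨ⟩
  · have e : (if (-1 : ℤ) ≤ -2 then 0 else c ((-1 : ℤ) + 1).toNat) = residue Γ a v U hs hsβ := hc0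
    dsimp only
    rw [e]
    exact residue_ne_zero hV hu hs2 hfirst hs hsβ
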